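/- **Setting.** Let $d\ge 1$, $\Omega=[0,1]^d$. For $x\in\mathbb R^d$, $R>0$ let $B_R(x)$ be the set of $z\in\Omega$ with $x_m-R\le z_m<x_m+R$ for all $m$, where $z_m=x_m+R$ is also allowed if it equals $1$. A *spatial network* is a connected finite graph $\mathcal G=(\mathcal N,\mathcal E)$ with $\mathcal N\subset\Omega$; $\hat V=\mathbb R^{\mathcal N}$, $\mathcal N(\omega)=\mathcal N\cap\omega$, and $(M_\omega u,v)=\sum_{x\in\mathcal N(\omega)}\frac12\sum_{y\sim x}|x-y|u(x)v(x)$, $(L_\omega v,v)=\sum_{x\in\mathcal N(\omega)}\frac12\sum_{y\sim x}\frac{(v(x)-v(y))^2}{|x-y|}$, $M=M_\Omega$, $L=L_\Omega$, $|v|_{M,\omega}^2=(M_\omega v,v)$, $|v|_{L,\omega}^2=(L_\omega v,v)$, $|v|_M=|v|_{M,\Omega}$, $|v|_L=|v|_{L,\Omega}$. Let $\emptyset\ne\Gamma\subseteq\partial\Omega$ be a union of full faces of elements of the mesh $\mathcal T_H$ below, and $V=\{v\in\hat V: v=0\text{ on }\mathcal N(\Gamma)\}$. The network has the following properties with parameters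 $R_0,\rho,\sigma$ ($R_0,\rho>0$): for all $R\ge R_0$ and all $x$ whose cube of centre $x$ and side $2R$ lies in $\Omega$, (1) $\rho\le(2R)^{-d}|1|^2_{M,B_R(x)}\le\sigma\rho$, and (2) there is a connected subgraph that contains every edge with an endpoint in $B_R(x)$ and only edges with both endpoints in $B_{R+R_0}(x)$; moreover (3) every edge is shorter than $R_0$, and (4) every $y\in\Gamma$ has a node of $\mathcal N(\Gamma)$ at distance less than $R_0$. Let $\mu_{\mathcal G}$ be the Poincaré-type constant of the network: the infimum of the $\mu\ge0$ such that $\min_c|v-c|_{M,B_R(x)}\le\mu R|v|_{L,B_{R+R_0}(x)}$ for $v\in\hat V$ and all such $x,R$; $|v|_{M,B_R(x)}\le\mu R|v|_{L,B_{R+R_0}(x)}$ for $v\in V$ and all such $x,R$ for which a whole face of the cube lies in $\Gamma$; and $|v|_M\le\mu|v|_L$ for $v\in V$. Let $K=\sum_{x\in\mathcal N}K_x$ with $K_x$ symmetric, positive semi-definite, supported on $x$ and its neighbours, and $\alpha(Lv,v)\le(Kv,v)\le\beta(Lv,v)$ for $v\in V$, $0<\alpha\le\beta$; $|v|_K^2=(Kv,v)$,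 $K_\omega=\sum_{x\in\mathcal N(\omega)}K_x$. **Method.** Let $H=2^{-i}$, $i\in\{0,1,2,\dots\}$, let $\mathcal T_H$ be the partition of $\Omega$ into boxes $B_{H/2}(x)$ of side $H$, $y_j$ its mesh nodes, $\varphi_j$ the restrictions to $\mathcal N$ of the $d$-linear Lagrange basis functions, $\hat V_H=\operatorname{span}\{\varphi_j\}$, $V_H=\operatorname{span}\{\varphi_j:y_j\notin\Gamma\}$. Let $T_j\in\mathcal T_H$ be the element containing $y_j$, $\psi_j\in\hat V_H$ with $(M_{T_j}\psi_j,\varphi_l)=\delta_{jl}$, $\mathcal Iv=\sum_{y_j\notin\Gamma}(M_{T_j}\psi_j,v)\varphi_j$, $W=\{v\in V:\mathcal Iv=0\}$. Let $U(\omega)$ be the union of the elements whose closure meets $\overline\omega$, $U_k=U\circ\dots\circ U$ ($k$ times), and let $\mathcal Q_k=\sum_{T\in\mathcal T_H}\mathcal Q_k^T$, where $\mathcal Q_k^Tv\in W_k^T:=\{w\in W:\operatorname{supp}w\subseteq U_k(T)\}$ solves $(K\mathcal Q_k^Tv,w)=(K_Tv,w)$ for all $w\in W_k^T$. Put $V^{ms}_{H,k}=\{v-\mathcal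 Q_kv:v\in V_H\}$ and let $R^{ms}_k:V\to V^{ms}_{H,k}$ be the projection orthogonal with respect to $(K\cdot,\cdot)$. Let $f\in C^2([0,T];\hat V)$, let $u\in C^2([0,T];V)$ solve $(MD_t^2u,v)+(Ku,v)=(Mf,v)$ for all $v\in V$, and let $\tau=T/N$, $t_s=s\tau$. Let $u^{ms,n}_{H,k}\in V^{ms}_{H,k}$, $0\le n\le N$, with arbitrary $u^{ms,0}_{H,k},u^{ms,1}_{H,k}$, satisfy for $1\le n\le N-1$ and all $v\in V^{ms}_{H,k}$ $$(M\partial_t\bar\partial_tu^{ms,n}_{H,k},v)+(K\tfrac12(u^{ms,n+1/2}_{H,k}+u^{ms,n-1/2}_{H,k}),v)=(Mf(t_n),v),$$ where $\partial_tw^n=(w^{n+1}-w^n)/\tau$, $\bar\partial_tw^n=(w^n-w^{n-1})/\tau$, $w^{n+1/2}=(w^{n+1}+w^n)/2$. Write $\|v\|_{L^\infty(\mathcal B)}=\max_{[0,T]}|v(t)|_{\mathcal B}$ and $\|v\|_{L^1(\mathcal B)}=\int_0^T|v(t)|_{\mathcal B}\,dt$ for $\mathcal B\in\{M,K\}$.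 **Theorem.** For all $d,\sigma,\mu,\alpha,\beta$ there is $c_0>0$, and for every $T_0>0$ there is $C>0$, depending only on $d,\sigma,\mu,\alpha,\beta$ and (for $C$) $T_0$, such that in the above setting, whenever $\mu_{\mathcal G}\le\mu$, $H\ge 8dR_0$, $k\ge1$, $k\ge c_0\log(1/H)$ and $T\ge T_0$, $$\begin{aligned}\max_{1\le n\le N-1}|u^{ms,n+1/2}_{H,k}-u(t_{n+1/2})|_K\le C\Big[&H\big(\|f\|_{L^\infty(M)}+\|D_t^2u\|_{L^\infty(M)}+\|u\|_{L^\infty(K)}+T\|D_t^2u\|_{L^\infty(K)}\big)\\&+\tau^2\big(\|D_t^4u\|_{L^1(M)}+\|D_t^2f\|_{L^1(M)}+H\|D_t^2u\|_{L^1(K)}\big)\\&+|\partial_tu^{ms,0}_{H,k}-R^{ms}_k\partial_tu(t_0)|_M+|u^{ms,1/2}_{H,k}-R^{ms}_ku(t_{1/2})|_K\Big],\end{aligned}$$ where $\partial_tu(t_0)=(u(t_1)-u(t_0))/\tau$. -/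

import Mathlib

open scoped Classical in
/-- Sum of `F` over those elements of a finite type that satisfy `p`. -/
noncomputable def sumOver {ι : Type*} [Fintype ι] (p : ι → Prop) (F : ι → ℝ) : ℝ :=
  ∑ x ∈ Finset.univ.filter p, F x

/-- The unit hypercube `Ω = [0,1]^d`. -/
def unitCube (d : ℕ) : Set (EuclideanSpace ℝ (Fin d)) :=
  {z | ∀ m, 0 ≤ z m ∧ z m ≤ 1}

/-- The box `B_R(x) ⊆ Ω` with centre `x` and side length `2R`: it contains its lower faces, and an
upper face only where that face lies on the upper face `z_m = 1` of `Ω`. -/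
def box {d : ℕ} (R : ℝ) (x : EuclideanSpace ℝ (Fin d)) : Set (EuclideanSpace ℝ (Fin d)) :=
  {z | z ∈ unitCube d ∧
    ∀ m, x m - R ≤ z m ∧ (z m < x m + R ∨ (z m = 1 ∧ z m ≤ x m + R))}

/-- The closed cube of centre `x` and side length `2R` is contained in `Ω`. -/
def BoxInside {d : ℕ} (R : ℝ) (x : EuclideanSpace ℝ (Fin d)) : Prop :=
  ∀ m, 0 ≤ x m - R ∧ x m + R ≤ 1

/-! ### Spatial networks -/

/-- A spatial network: a connected graph on a finite set of nodes in `Ω`. -/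
structure SpatialNetwork (d : ℕ) where
  nodes : Finset (EuclideanSpace ℝ (Fin d))
  nodes_subset : ∀ x ∈ nodes, x ∈ unitCube d
  graph : SimpleGraph nodes
  connected : graph.Connected

namespace SpatialNetwork

variable {d : ℕ} (G : SpatialNetwork d)

/-- The space `V̂` of real functions on the nodes. -/
abbrev VHat : Type := G.nodes → ℝ

/-- The space `V` of functions that vanish at the nodes on `Γ`. -/
def V (Γ : Set (EuclideanSpace ℝ (Fin d))) : Submodule ℝ G.VHat where
  carrier := {v | ∀ x : G.nodes, (x : EuclideanSpace ℝ (Fin d)) ∈ Γ → v x = 0}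
  add_mem' := by
    intro a b ha hb x hx
    simp [ha x hx, hb x hx]
  zero_mem' := by
    intro x _
    rfl
  smul_mem' := by
    intro c a ha x hx
    simp [ha x hx]

/-- `(M_ω u, v)`, where `(M_x u, v) = (1/2) ∑_{y ∼ x} |x - y| u(x) v(x)` and
`M_ω = ∑_{x ∈ N(ω)} M_x`. -/
noncomputable def formM (ω : Set (EuclideanSpace ℝ (Fin d))) (u v : G.VHat) : ℝ :=
  sumOver (fun x : G.nodes => (x : EuclideanSpace ℝ (Fin d)) ∈ ω) fun x =>
    (1 / 2) * sumOver (fun y => G.graph.Adj x y) fun y =>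
      dist (x : EuclideanSpace ℝ (Fin d)) y * (u x * v x)

/-- `(L_ω v, v)`, where `(L_x v, v) = (1/2) ∑_{y ∼ x} (v(x) - v(y))² / |x - y|` and
`L_ω = ∑_{x ∈ N(ω)} L_x`. -/
noncomputable def quadL (ω : Set (EuclideanSpace ℝ (Fin d))) (v : G.VHat) : ℝ :=
  sumOver (fun x : G.nodes => (x : EuclideanSpace ℝ (Fin d)) ∈ ω) fun x =>
    (1 / 2) * sumOver (fun y => G.graph.Adj x y) fun y =>
      (v x - v y) ^ 2 / dist (x : EuclideanSpace ℝ (Fin d)) y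

/-- `|v|_{M,ω}`. -/
noncomputable def normMOn (ω : Set (EuclideanSpace ℝ (Fin d))) (v : G.VHat) : ℝ :=
  Real.sqrt (G.formM ω v v)

/-- `|v|_{L,ω}`. -/
noncomputable def normLOn (ω : Set (EuclideanSpace ℝ (Fin d))) (v : G.VHat) : ℝ :=
  Real.sqrt (G.quadL ω v)

/-- `|v|_M`. -/
noncomputable def normM (v : G.VHat) : ℝ := G.normMOn (unitCube d) v

/-- `|v|_L`. -/
noncomputable def normL (v : G.VHat) : ℝ := G.normLOn (unitCube d) v

/-- The network properties with homogeneity parameter `R₀`, density `ρ` and uniformity constant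
`σ`, for the Dirichlet boundary `Γ`. The boxes `B_R(x)` are those contained in `Ω`. -/
structure NetworkProperties (Γ : Set (EuclideanSpace ℝ (Fin d))) (R₀ ρ σ : ℝ) : Prop where
  R₀_pos : 0 < R₀
  ρ_pos : 0 < ρ
  homogeneity : ∀ (R : ℝ) (x : EuclideanSpace ℝ (Fin d)), R₀ ≤ R → BoxInside R x →
    ρ ≤ G.normMOn (box R x) 1 ^ 2 / (2 * R) ^ d ∧
      G.normMOn (box R x) 1 ^ 2 / (2 * R) ^ d ≤ σ * ρ
  connectivity : ∀ (R : ℝ) (x : EuclideanSpace ℝ (Fin d)), R₀ ≤ R → BoxInside R x →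
    ∃ S : G.graph.Subgraph, S.Connected ∧
      (∀ a b : G.nodes, G.graph.Adj a b →
        ((a : EuclideanSpace ℝ (Fin d)) ∈ box R x ∨ (b : EuclideanSpace ℝ (Fin d)) ∈ box R x) →
          S.Adj a b) ∧
      (∀ a b : G.nodes, S.Adj a b →
        (a : EuclideanSpace ℝ (Fin d)) ∈ box (R + R₀) x ∧
          (b : EuclideanSpace ℝ (Fin d)) ∈ box (R + R₀) x)
  locality : ∀ a b : G.nodes, G.graph.Adj a b →
    dist (a : EuclideanSpace ℝ (Fin d)) b < R₀
  boundary_density : ∀ y ∈ Γ, ∃ x : G.nodes,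
    (x : EuclideanSpace ℝ (Fin d)) ∈ Γ ∧ dist (x : EuclideanSpace ℝ (Fin d)) y < R₀

/-- `μ` is admissible in the Poincaré inequality on boxes, in the Friedrichs inequality on boxes
that have a whole face on `Γ`, and in the Friedrichs inequality on the whole network. -/
def IsPoincareBound (Γ : Set (EuclideanSpace ℝ (Fin d))) (R₀ μ : ℝ) : Prop :=
  (∀ (R : ℝ) (x : EuclideanSpace ℝ (Fin d)), R₀ ≤ R → BoxInside R x → ∀ v : G.VHat,
    ∃ c : ℝ, G.normMOn (box R x) (fun y => v y - c) ≤ μ * R * G.normLOn (box (R + R₀) x) v) ∧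
  (∀ (R : ℝ) (x : EuclideanSpace ℝ (Fin d)), R₀ ≤ R → BoxInside R x →
    (∃ (l : Fin d) (b : ℝ), (b = 0 ∨ b = 1) ∧ |b - x l| ≤ R ∧
      {z : EuclideanSpace ℝ (Fin d) | (∀ m, |z m - x m| ≤ R) ∧ z l = b} ⊆ Γ) →
    ∀ v ∈ G.V Γ, G.normMOn (box R x) v ≤ μ * R * G.normLOn (box (R + R₀) x) v) ∧
  (∀ v ∈ G.V Γ, G.normM v ≤ μ * G.normL v)

/-- The Poincaré-type constant of the network: the best constant in the Poincaré and Friedrichs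
inequalities. It measures the connectivity of the network, and for every network with the
properties above the set of admissible constants is non-empty. -/
noncomputable def poincareConst (Γ : Set (EuclideanSpace ℝ (Fin d))) (R₀ : ℝ) : ℝ :=
  sInf {μ : ℝ | 0 ≤ μ ∧ G.IsPoincareBound Γ R₀ μ}

/-- A family of local operators `K_x`: symmetric, positive semi-definite, supported on `x` and
the nodes adjacent to it. -/
structure LocalOperator where
  mat : G.nodes → Matrix G.nodes G.nodes ℝ
  posSemidef : ∀ x, (mat x).PosSemidef
  isLocal : ∀ x y z, mat x y z ≠ 0 →
    (y = x ∨ G.graph.Adj x y) ∧ (z = x ∨ G.graph.Adj x z)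

variable {G}

/-- `(K_ω u, v)`, where `K_ω = ∑_{x ∈ N(ω)} K_x`. -/
noncomputable def LocalOperator.formOn (K : G.LocalOperator)
    (ω : Set (EuclideanSpace ℝ (Fin d))) (u v : G.VHat) : ℝ :=
  sumOver (fun x : G.nodes => (x : EuclideanSpace ℝ (Fin d)) ∈ ω) fun x =>
    dotProduct ((K.mat x).mulVec u) v

/-- `(K u, v)`. -/
noncomputable def LocalOperator.form (K : G.LocalOperator) (u v : G.VHat) : ℝ :=
  K.formOn (unitCube d) u v

/-- `|v|_K`. -/
noncomputable def LocalOperator.norm (K : G.LocalOperator) (v : G.VHat) : ℝ :=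
  Real.sqrt (K.form v v)

/-- `α (L v, v) ≤ (K v, v) ≤ β (L v, v)` for all `v ∈ V`. -/
def LocalOperator.IsBoundedCoercive (K : G.LocalOperator)
    (Γ : Set (EuclideanSpace ℝ (Fin d))) (α β : ℝ) : Prop :=
  ∀ v ∈ G.V Γ, α * G.quadL (unitCube d) v ≤ K.form v v ∧
    K.form v v ≤ β * G.quadL (unitCube d) v

end SpatialNetwork

/-! ### The coarse mesh and the finite element functions -/

/-- The mesh size `H = 2^{-i}`. -/
noncomputable def meshSize (i : ℕ) : ℝ := ((2 : ℝ) ^ i)⁻¹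

/-- The element of the mesh of size `H = 2^{-i}` with multi-index `t`: the box of side length `H`
and centre `((t_m + 1/2) H)_m`. -/
noncomputable def element {d : ℕ} (i : ℕ) (t : Fin d → Fin (2 ^ i)) :
    Set (EuclideanSpace ℝ (Fin d)) :=
  box (meshSize i / 2) (WithLp.toLp 2 fun m => ((t m : ℕ) + 1 / 2 : ℝ) * meshSize i)

/-- The mesh node `y_j = j H`. -/
noncomputable def meshNode {d : ℕ} (i : ℕ) (j : Fin d → Fin (2 ^ i + 1)) :
    EuclideanSpace ℝ (Fin d) :=
  WithLp.toLp 2 fun m => ((j m : ℕ) : ℝ) * meshSize i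

/-- The `d`-linear Lagrange basis function of the mesh node `y_j` (a product of hat functions). -/
noncomputable def lagrange {d : ℕ} (i : ℕ) (j : Fin d → Fin (2 ^ i + 1))
    (z : EuclideanSpace ℝ (Fin d)) : ℝ :=
  ∏ m, max 0 (1 - |z m - meshNode i j m| / meshSize i)

/-- `Γ` is a union of full faces on `∂Ω` of elements of the mesh of size `2^{-i}`. -/
def IsUnionOfBoundaryFaces {d : ℕ} (i : ℕ) (Γ : Set (EuclideanSpace ℝ (Fin d))) : Prop :=
  ∀ y ∈ Γ, ∃ (t : Fin d → Fin (2 ^ i)) (l : Fin d) (b : ℝ), (b = 0 ∨ b = 1) ∧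
    y ∈ {z | z ∈ closure (element i t) ∧ z l = b} ∧
    {z | z ∈ closure (element i t) ∧ z l = b} ⊆ Γ

/-- The patch `U(ω)`: the union of the elements whose closure meets the closure of `ω`. -/
def patch {d : ℕ} (i : ℕ) (ω : Set (EuclideanSpace ℝ (Fin d))) :
    Set (EuclideanSpace ℝ (Fin d)) :=
  {x | ∃ t : Fin d → Fin (2 ^ i), x ∈ element i t ∧ (closure (element i t) ∩ closure ω).Nonempty}

/-- The patch `U_k(ω)`, with `U_1 = U` and `U_k(ω) = U_{k-1}(U(ω))`. -/
def patchIter {d : ℕ} (i k : ℕ) (ω : Set (EuclideanSpace ℝ (Fin d))) :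
    Set (EuclideanSpace ℝ (Fin d)) :=
  (patch i)^[k] ω

/-- The element that contains the mesh node `y_j` (the elements partition `Ω`). -/
def nodeElement {d : ℕ} (i : ℕ) (j : Fin d → Fin (2 ^ i + 1)) :
    Set (EuclideanSpace ℝ (Fin d)) :=
  {z | ∃ t : Fin d → Fin (2 ^ i), meshNode i j ∈ element i t ∧ z ∈ element i t}

namespace SpatialNetwork

variable {d : ℕ} (G : SpatialNetwork d)

/-- The restriction `φ_j` of a Lagrange basis function to the network. -/
noncomputable def basisFun (i : ℕ) (j : Fin d → Fin (2 ^ i + 1)) : G.VHat :=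
  fun x => lagrange i j x

/-- The space `V̂_H`. -/
noncomputable def VHatH (i : ℕ) : Submodule ℝ G.VHat :=
  Submodule.span ℝ (Set.range (G.basisFun i))

/-- The space `V_H`, spanned by the basis functions of the mesh nodes off `Γ`. -/
noncomputable def VH (Γ : Set (EuclideanSpace ℝ (Fin d))) (i : ℕ) : Submodule ℝ G.VHat :=
  Submodule.span ℝ (G.basisFun i '' {j | meshNode i j ∉ Γ})

open scoped Classical in
/-- The dual function `ψ_j ∈ V̂_H` with `(M_{T_j} ψ_j, φ_l) = δ_{jl}`. -/
noncomputable def dualFun (i : ℕ) (j : Fin d → Fin (2 ^ i + 1)) : G.VHat :=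
  Classical.epsilon fun ψ => ψ ∈ G.VHatH i ∧
    ∀ l, G.formM (nodeElement i j) ψ (G.basisFun i l) = if j = l then 1 else 0

open scoped Classical in
/-- The interpolant `I v = ∑_j (M_{T_j} ψ_j, v) φ_j`, summed over the mesh nodes off `Γ`. -/
noncomputable def interp (Γ : Set (EuclideanSpace ℝ (Fin d))) (i : ℕ) (v : G.VHat) : G.VHat :=
  ∑ j ∈ Finset.univ.filter (fun j : Fin d → Fin (2 ^ i + 1) => meshNode i j ∉ Γ),
    G.formM (nodeElement i j) (G.dualFun i j) v • G.basisFun i j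

/-- The fine-scale space `W = ker I ⊆ V`. -/
def fineSpace (Γ : Set (EuclideanSpace ℝ (Fin d))) (i : ℕ) : Set G.VHat :=
  {v | v ∈ G.V Γ ∧ G.interp Γ i v = 0}

/-- The functions in `W` supported in `U_k(ω)`. -/
def fineSpaceOn (Γ : Set (EuclideanSpace ℝ (Fin d))) (i k : ℕ)
    (ω : Set (EuclideanSpace ℝ (Fin d))) : Set G.VHat :=
  {v | v ∈ G.fineSpace Γ i ∧
    ∀ x : G.nodes, v x ≠ 0 → (x : EuclideanSpace ℝ (Fin d)) ∈ patchIter i k ω}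

variable {G}

/-- The solution `r ∈ S` of `(K r, w) = ℓ(w)` for all `w ∈ S`. -/
noncomputable def LocalOperator.solveIn (K : G.LocalOperator) (S : Set G.VHat)
    (ℓ : G.VHat → ℝ) : G.VHat :=
  Classical.epsilon fun r => r ∈ S ∧ ∀ w ∈ S, K.form r w = ℓ w

/-- The localized element corrector `Q_k^T`. -/
noncomputable def LocalOperator.elementCorrector (K : G.LocalOperator)
    (Γ : Set (EuclideanSpace ℝ (Fin d))) (i k : ℕ) (t : Fin d → Fin (2 ^ i))
    (v : G.VHat) : G.VHat :=
  K.solveIn (G.fineSpaceOn Γ i k (element i t)) (K.formOn (element i t) v)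

/-- The localized corrector `Q_k = ∑_T Q_k^T`. -/
noncomputable def LocalOperator.corrector (K : G.LocalOperator)
    (Γ : Set (EuclideanSpace ℝ (Fin d))) (i k : ℕ) (v : G.VHat) : G.VHat :=
  ∑ t : Fin d → Fin (2 ^ i), K.elementCorrector Γ i k t v

/-- The localized multiscale space `V^ms_{H,k} = {v - Q_k v : v ∈ V_H}`. -/
def LocalOperator.msSpace (K : G.LocalOperator) (Γ : Set (EuclideanSpace ℝ (Fin d)))
    (i k : ℕ) : Set G.VHat :=
  {w | ∃ v ∈ G.VH Γ i, w = v - K.corrector Γ i k v}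

/-- The localized Ritz projection `R^ms_k` onto `V^ms_{H,k}`. -/
noncomputable def LocalOperator.ritz (K : G.LocalOperator)
    (Γ : Set (EuclideanSpace ℝ (Fin d))) (i k : ℕ) (v : G.VHat) : G.VHat :=
  K.solveIn (K.msSpace Γ i k) (K.form v)

/-! ### The wave equation and the fully discrete method -/

/-- The time derivative `D_t^m v` of a function on `[0,T]` (one-sided at the end points). -/
noncomputable def timeDeriv (T : ℝ) (m : ℕ) (v : ℝ → G.VHat) : ℝ → G.VHat :=
  iteratedDerivWithin m v (Set.Icc 0 T)

/-- `u` solves `(M D_t² u, v) + (K u, v) = (M f, v)` for all `v ∈ V`, on `[0,T]`. -/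
structure LocalOperator.IsWaveSolution (K : G.LocalOperator)
    (Γ : Set (EuclideanSpace ℝ (Fin d))) (T : ℝ) (f u : ℝ → G.VHat) : Prop where
  contDiff : ContDiffOn ℝ 2 u (Set.Icc 0 T)
  mem : ∀ t ∈ Set.Icc 0 T, u t ∈ G.V Γ
  eqn : ∀ t ∈ Set.Icc 0 T, ∀ v ∈ G.V Γ,
    G.formM (unitCube d) (timeDeriv T 2 u t) v + K.form (u t) v = G.formM (unitCube d) (f t) v

/-- Forward difference quotient `∂_t U^n`. -/
noncomputable def fwdDiff (τ : ℝ) (U : ℕ → G.VHat) (n : ℕ) : G.VHat :=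
  τ⁻¹ • (U (n + 1) - U n)

/-- Backward difference quotient (used for `n ≥ 1`). -/
noncomputable def bwdDiff (τ : ℝ) (U : ℕ → G.VHat) (n : ℕ) : G.VHat :=
  τ⁻¹ • (U n - U (n - 1))

/-- `U^{n+1/2} = (U^{n+1} + U^n) / 2`. -/
noncomputable def halfStep (U : ℕ → G.VHat) (n : ℕ) : G.VHat :=
  (1 / 2 : ℝ) • (U (n + 1) + U n)

/-- `U^0, …, U^N` is a solution of the localized multiscale method with time step `τ`; the initial
values `U^0, U^1 ∈ V^ms_{H,k}` are arbitrary. -/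
structure LocalOperator.IsMultiscaleSolution (K : G.LocalOperator)
    (Γ : Set (EuclideanSpace ℝ (Fin d))) (i k N : ℕ) (τ : ℝ) (f : ℝ → G.VHat)
    (U : ℕ → G.VHat) : Prop where
  mem : ∀ n ≤ N, U n ∈ K.msSpace Γ i k
  eqn : ∀ n, 1 ≤ n → n + 1 ≤ N → ∀ v ∈ K.msSpace Γ i k,
    G.formM (unitCube d) (fwdDiff τ (bwdDiff τ U) n) v
        + K.form ((1 / 2 : ℝ) • (halfStep U n + halfStep U (n - 1))) v
      = G.formM (unitCube d) (f (n * τ)) v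

/-- `max_{[0,T]} |v(t)|`. -/
noncomputable def supNorm (nrm : G.VHat → ℝ) (T : ℝ) (v : ℝ → G.VHat) : ℝ :=
  sSup ((fun t => nrm (v t)) '' Set.Icc 0 T)

/-- `∫_0^T |v(t)| dt`. -/
noncomputable def oneNorm (nrm : G.VHat → ℝ) (T : ℝ) (v : ℝ → G.VHat) : ℝ :=
  ∫ t in (0 : ℝ)..T, nrm (v t)

end SpatialNetwork

/-! Let P be the K-orthogonal projection onto the multiscale space and θ^n = U^n - P u(t_n). The
error at t_{n+1/2} is the mean of θ^n and θ^{n+1}, minus the mean of the Ritz errors u - P u at t_n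
and t_{n+1}, plus the midpoint defect (u(t_n) + u(t_{n+1}))/2 - u(t_{n+1/2}).

Space. P is first-order accurate with constants that see K only through α and β. Every corner of an
element holds a box of side H/(4d), whose mass is bounded below because H ≥ 8dR₀; hence the dual
functions exist with controlled norm (`coarse_lower_bound`, `dualFun_spec`). With the Poincaré and
Friedrichs inequalities this gives local interpolation estimates (`interp_local`), so |w|_M ≤ C H
|w|_L on W = ker I. If K(z,v) = (Mg,v) on V, then z - Iz + Q Iz, with Q the corrector without
truncation, lies in W, and testing with itself bounds its energy by C H |g|_M. Replacing Q by Q_k is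
cheap because the element correctors decay exponentially (`quadL_cut_le`, `quadL_outside_step`): the
truncation error, summed crudely over the H^{-d} elements, is still O(H) once k ≥ c₀ log(1/H)
(`corrector_error`, `sqrt_decay_le`). This gives the energy estimate `norm_sub_ritz_le`, and by
duality the M-norm estimate `normM_sub_ritz_le`.

Time. θ solves the scheme with a residual (`error_equation`) made of second differences of f and
D_t²u, the consistency error of the second difference of u, and the Ritz error of that second
difference. Testing with the sum of two consecutive difference quotients conserves a discrete
energy, so |θ^{n+1/2}|_K is at most the initial energy terms plus τ times the sum of the residuals
(`discrete_energy_le`). The Ritz error of u itself is O(H) since Ku = M(f - D_t²u) when tested on V.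

The midpoint defect is of size τ² max|D_t²u|_K, a term that the claim does not contain. But u is C⁴
in time, and w = D_t²u solves the wave equation with data D_t²f. `energyNorm_wave_le` bounds
max|w|_K by the L¹ norms of |D_t²w|_M and |D_t²f|_M alone, without initial values; this is where T ≥
T₀ is needed. -/

/-! ### Positive semi-definite bilinear forms -/

/-- A symmetric positive semi-definite bilinear form. -/
structure IsPSDForm {E : Type*} [AddCommGroup E] [Module ℝ E] (B : LinearMap.BilinForm ℝ E) :
    Prop where
  symm : ∀ x y, B x y = B y x
  nonneg : ∀ x, 0 ≤ B x x

/-- The seminorm `√(B v v)`. -/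
noncomputable def energyNorm {E : Type*} [AddCommGroup E] [Module ℝ E]
    (B : LinearMap.BilinForm ℝ E) (v : E) : ℝ := Real.sqrt (B v v)

namespace IsPSDForm

variable {E : Type*} [AddCommGroup E] [Module ℝ E] {B : LinearMap.BilinForm ℝ E}

lemma energyNorm_nonneg (B : LinearMap.BilinForm ℝ E) (v : E) : 0 ≤ energyNorm B v :=
  Real.sqrt_nonneg _

lemma energyNorm_sq (hB : IsPSDForm B) (v : E) : energyNorm B v ^ 2 = B v v :=
  Real.sq_sqrt (hB.nonneg v)

lemma abs_apply_le (hB : IsPSDForm B) (u v : E) :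
    |B u v| ≤ energyNorm B u * energyNorm B v := by
  have h := LinearMap.BilinForm.apply_mul_apply_le_of_forall_zero_le B hB.nonneg u v
  rw [hB.symm v u] at h
  rw [energyNorm, energyNorm, ← Real.sqrt_mul (hB.nonneg u)]
  exact Real.abs_le_sqrt (by nlinarith)

lemma apply_le (hB : IsPSDForm B) (u v : E) : B u v ≤ energyNorm B u * energyNorm B v :=
  (le_abs_self _).trans (hB.abs_apply_le u v)

lemma energyNorm_add_le (hB : IsPSDForm B) (u v : E) :
    energyNorm B (u + v) ≤ energyNorm B u + energyNorm B v := by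
  have h1 := hB.apply_le u v
  have h2 := hB.energyNorm_sq u
  have h3 := hB.energyNorm_sq v
  have h4 := hB.energyNorm_sq (u + v)
  simp only [map_add, LinearMap.add_apply] at h4
  rw [hB.symm v u] at h4
  refine abs_le_of_sq_le_sq' ?_ (add_nonneg (energyNorm_nonneg B u) (energyNorm_nonneg B v)) |>.2
  nlinarith

lemma energyNorm_smul (B : LinearMap.BilinForm ℝ E) (c : ℝ) (v : E) :
    energyNorm B (c • v) = |c| * energyNorm B v := by
  simp only [energyNorm, map_smul, LinearMap.smul_apply, smul_eq_mul]
  rw [← mul_assoc, Real.sqrt_mul (mul_self_nonneg c), Real.sqrt_mul_self_eq_abs]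

lemma energyNorm_neg (B : LinearMap.BilinForm ℝ E) (v : E) :
    energyNorm B (-v) = energyNorm B v := by
  simp [energyNorm]

lemma energyNorm_zero (B : LinearMap.BilinForm ℝ E) : energyNorm B 0 = 0 := by
  simp [energyNorm]

lemma energyNorm_sub_le (hB : IsPSDForm B) (u v : E) :
    energyNorm B (u - v) ≤ energyNorm B u + energyNorm B v := by
  rw [sub_eq_add_neg, ← energyNorm_neg B v]
  exact hB.energyNorm_add_le u (-v)

lemma energyNorm_sum_le (hB : IsPSDForm B) {ι : Type*} (s : Finset ι) (f : ι → E) :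
    energyNorm B (∑ j ∈ s, f j) ≤ ∑ j ∈ s, energyNorm B (f j) := by
  classical
  induction s using Finset.induction_on with
  | empty => simp [energyNorm_zero]
  | insert a s ha ih =>
    rw [Finset.sum_insert ha, Finset.sum_insert ha]
    exact (hB.energyNorm_add_le _ _).trans (by linarith)

/-- A bound `|v|² ≤ a |v|` gives `|v| ≤ a`. -/
lemma energyNorm_le_of_apply_le (hB : IsPSDForm B) {v : E} {a : ℝ} (ha : 0 ≤ a)
    (h : B v v ≤ a * energyNorm B v) : energyNorm B v ≤ a := by
  rw [← hB.energyNorm_sq v] at h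
  by_contra hlt
  push Not at hlt
  nlinarith [energyNorm_nonneg B v]

/-- Galerkin solvability on a subspace of a finite-dimensional space on which the form is
definite. -/
lemma exists_solution [FiniteDimensional ℝ E] (B : LinearMap.BilinForm ℝ E)
    (S : Submodule ℝ E) (hdef : ∀ v ∈ S, B v v = 0 → v = 0) (ℓ : E →ₗ[ℝ] ℝ) :
    ∃ r ∈ S, ∀ w ∈ S, B r w = ℓ w := by
  -- Definiteness makes the map S → S* injective, since a vector of its kernel pairs to zero with
  -- itself; equal dimensions make it surjective.
  let A : S →ₗ[ℝ] Module.Dual ℝ S := (B.compl₁₂ S.subtype S.subtype)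
  have hinj : Function.Injective A := by
    rw [injective_iff_map_eq_zero]
    intro v hv
    have : B v v = 0 := by
      have := LinearMap.congr_fun hv v
      simpa [A] using this
    exact Subtype.ext (hdef v v.2 this)
  have hsurj : Function.Surjective A :=
    (LinearMap.injective_iff_surjective_of_finrank_eq_finrank
      (Subspace.dual_finrank_eq).symm).1 hinj
  obtain ⟨r, hr⟩ := hsurj (ℓ.comp S.subtype)
  refine ⟨r, r.2, fun w hw => ?_⟩
  have := LinearMap.congr_fun hr ⟨w, hw⟩
  simpa [A] using this

/-- Quasi-optimality of the Galerkin projection. -/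
lemma energyNorm_sub_le_of_orthogonal (hB : IsPSDForm B) {S : Submodule ℝ E} {z r w : E}
    (hr : r ∈ S) (horth : ∀ s ∈ S, B r s = B z s) (hw : w ∈ S) :
    energyNorm B (z - r) ≤ energyNorm B (z - w) := by
  refine hB.energyNorm_le_of_apply_le (energyNorm_nonneg B _) ?_
  have h0 : B (z - r) (r - w) = 0 := by
    simp [horth _ (S.sub_mem hr hw)]
  have h1 : B (z - r) (z - r) = B (z - r) (z - w) := by
    have : z - w = (z - r) + (r - w) := by abel
    rw [this, map_add, h0, add_zero]
  rw [h1, mul_comm]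
  exact hB.apply_le _ _

lemma energyNorm_le_of_orthogonal (hB : IsPSDForm B) {S : Submodule ℝ E} {z r : E}
    (hr : r ∈ S) (horth : ∀ s ∈ S, B r s = B z s) :
    energyNorm B r ≤ energyNorm B z := by
  refine hB.energyNorm_le_of_apply_le (energyNorm_nonneg B _) ?_
  rw [horth r hr]
  exact hB.apply_le _ _

end IsPSDForm

/-! ### Sums over nodes that satisfy a predicate -/

section SumOver

open scoped Classical

variable {ι : Type*} [Fintype ι] {p q : ι → Prop} {F F' : ι → ℝ}

lemma sumOver_nonneg (h : ∀ x, p x → 0 ≤ F x) : 0 ≤ sumOver p F :=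
  Finset.sum_nonneg fun x hx => h x (Finset.mem_filter.1 hx).2

lemma sumOver_le_sumOver (h : ∀ x, p x → F x ≤ F' x) : sumOver p F ≤ sumOver p F' :=
  Finset.sum_le_sum fun x hx => h x (Finset.mem_filter.1 hx).2

lemma sumOver_congr (h : ∀ x, p x → F x = F' x) : sumOver p F = sumOver p F' :=
  Finset.sum_congr rfl fun x hx => h x (Finset.mem_filter.1 hx).2

lemma sumOver_mono (hpq : ∀ x, p x → q x) (h : ∀ x, q x → 0 ≤ F x) :
    sumOver p F ≤ sumOver q F :=
  Finset.sum_le_sum_of_subset_of_nonneg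
    (fun x hx => Finset.mem_filter.2 ⟨Finset.mem_univ x, hpq x (Finset.mem_filter.1 hx).2⟩)
    fun x hx _ => h x (Finset.mem_filter.1 hx).2

lemma sumOver_add (p : ι → Prop) (F F' : ι → ℝ) :
    sumOver p (fun x => F x + F' x) = sumOver p F + sumOver p F' :=
  Finset.sum_add_distrib

lemma mul_sumOver (p : ι → Prop) (c : ℝ) (F : ι → ℝ) :
    c * sumOver p F = sumOver p fun x => c * F x :=
  Finset.mul_sum _ _ _

lemma sumOver_mul (p : ι → Prop) (c : ℝ) (F : ι → ℝ) :
    sumOver p F * c = sumOver p fun x => F x * c :=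
  Finset.sum_mul _ _ _

lemma single_le_sumOver (h : ∀ x, p x → 0 ≤ F x) {a : ι} (ha : p a) : F a ≤ sumOver p F :=
  Finset.single_le_sum (f := F) (fun x hx => h x (Finset.mem_filter.1 hx).2)
    (Finset.mem_filter.2 ⟨Finset.mem_univ a, ha⟩)

lemma sumOver_eq_zero (h : ∀ x, p x → F x = 0) : sumOver p F = 0 :=
  Finset.sum_eq_zero fun x hx => h x (Finset.mem_filter.1 hx).2

lemma sumOver_of_forall (h : ∀ x, p x) : sumOver p F = ∑ x, F x := by
  classical
  unfold sumOver
  congr 1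
  exact Finset.filter_true_of_mem fun x _ => h x

lemma sumOver_eq_sum_ite (p : ι → Prop) (F : ι → ℝ) :
    sumOver p F = ∑ x, if p x then F x else 0 :=
  Finset.sum_filter _ _

/-- Summing over a family of sets that covers each point at most `n` times. -/
lemma sum_sumOver_le {κ : Type*} (s : Finset κ) (P : κ → ι → Prop) (n : ℝ)
    (hF : ∀ x, 0 ≤ F x) (hq : ∀ j ∈ s, ∀ x, P j x → q x)
    (hn : ∀ x, ∀ t : Finset κ, (∀ j ∈ t, P j x) → (t.card : ℝ) ≤ n) :
    ∑ j ∈ s, sumOver (P j) F ≤ n * sumOver q F := by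
  classical
  simp only [sumOver_eq_sum_ite]
  rw [Finset.sum_comm, Finset.mul_sum]
  refine Finset.sum_le_sum fun x _ => ?_
  rw [← Finset.sum_filter, Finset.sum_const, nsmul_eq_mul]
  split_ifs with hx
  · exact mul_le_mul_of_nonneg_right (hn x _ fun j hj => (Finset.mem_filter.1 hj).2) (hF x)
  · have : s.filter (fun j => P j x) = ∅ :=
      Finset.filter_eq_empty_iff.2 fun j hj hjx => hx (hq j hj x hjx)
    simp [this]

/-- Splitting a sum by the values of a map. -/
lemma sumOver_eq_sum_fiber {κ : Type*} [Fintype κ] (g : ι → κ) (p : ι → Prop) (F : ι → ℝ) :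
    sumOver p F = ∑ j, sumOver (fun x => p x ∧ g x = j) F := by
  classical
  simp only [sumOver_eq_sum_ite]
  rw [Finset.sum_comm]
  refine Finset.sum_congr rfl fun x _ => ?_
  by_cases hx : p x <;> simp [hx]

end SumOver

/-! ### The forms of a spatial network -/

namespace SpatialNetwork

variable {d : ℕ} (G : SpatialNetwork d)

/-- The mass `(1/2) ∑_{y ∼ x} |x - y|` of a node. -/
noncomputable def mass (x : G.nodes) : ℝ :=
  (1 / 2) * sumOver (fun y => G.graph.Adj x y) fun y => dist (x : EuclideanSpace ℝ (Fin d)) y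

/-- The contribution `(L_x v, v)` of a node. -/
noncomputable def nodeL (v : G.VHat) (x : G.nodes) : ℝ :=
  (1 / 2) * sumOver (fun y => G.graph.Adj x y) fun y =>
      (v x - v y) ^ 2 / dist (x : EuclideanSpace ℝ (Fin d)) y

lemma mass_nonneg (x : G.nodes) : 0 ≤ G.mass x :=
  mul_nonneg (by norm_num) (sumOver_nonneg fun _ _ => dist_nonneg)

lemma nodeL_nonneg (v : G.VHat) (x : G.nodes) : 0 ≤ G.nodeL v x :=
  mul_nonneg (by norm_num) (sumOver_nonneg fun _ _ => div_nonneg (sq_nonneg _) dist_nonneg)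

/-- The neighbour sum does not involve the functions, so M is diagonal with nodal weights `mass`.
Monotonicity and pointwise comparison all come from this. -/
lemma formM_eq (ω : Set (EuclideanSpace ℝ (Fin d))) (u v : G.VHat) :
    G.formM ω u v = sumOver (fun x : G.nodes => (x : EuclideanSpace ℝ (Fin d)) ∈ ω)
      fun x => G.mass x * (u x * v x) := by
  unfold formM mass
  refine sumOver_congr fun x _ => ?_
  rw [mul_assoc, sumOver_mul]

lemma quadL_eq (ω : Set (EuclideanSpace ℝ (Fin d))) (v : G.VHat) :
    G.quadL ω v = sumOver (fun x : G.nodes => (x : EuclideanSpace ℝ (Fin d)) ∈ ω) (G.nodeL v) :=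
  rfl

/-- `M_ω` as a bilinear form. -/
noncomputable def bilinM (ω : Set (EuclideanSpace ℝ (Fin d))) : LinearMap.BilinForm ℝ G.VHat :=
  LinearMap.mk₂ ℝ (G.formM ω)
    (fun u u' v => by
      simp only [formM_eq, ← sumOver_add]
      exact sumOver_congr fun x _ => by simp only [Pi.add_apply]; ring)
    (fun c u v => by
      simp only [formM_eq, smul_eq_mul, mul_sumOver]
      exact sumOver_congr fun x _ => by simp only [Pi.smul_apply, smul_eq_mul]; ring)
    (fun u v v' => by
      simp only [formM_eq, ← sumOver_add]
      exact sumOver_congr fun x _ => by simp only [Pi.add_apply]; ring)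
    (fun c u v => by
      simp only [formM_eq, smul_eq_mul, mul_sumOver]
      exact sumOver_congr fun x _ => by simp only [Pi.smul_apply, smul_eq_mul]; ring)

lemma bilinM_apply (ω : Set (EuclideanSpace ℝ (Fin d))) (u v : G.VHat) :
    G.bilinM ω u v = G.formM ω u v := rfl

lemma isPSDForm_bilinM (ω : Set (EuclideanSpace ℝ (Fin d))) : IsPSDForm (G.bilinM ω) where
  symm u v := by
    simp only [bilinM_apply, formM_eq]
    exact sumOver_congr fun x _ => by ring
  nonneg u := by
    simp only [bilinM_apply, formM_eq]
    exact sumOver_nonneg fun x _ => mul_nonneg (G.mass_nonneg x) (mul_self_nonneg _)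

lemma normMOn_eq (ω : Set (EuclideanSpace ℝ (Fin d))) (v : G.VHat) :
    G.normMOn ω v = energyNorm (G.bilinM ω) v := rfl

lemma normMOn_sq (ω : Set (EuclideanSpace ℝ (Fin d))) (v : G.VHat) :
    G.normMOn ω v ^ 2 = G.formM ω v v := (G.isPSDForm_bilinM ω).energyNorm_sq v

lemma formM_self_nonneg (ω : Set (EuclideanSpace ℝ (Fin d))) (v : G.VHat) :
    0 ≤ G.formM ω v v := (G.isPSDForm_bilinM ω).nonneg v

lemma formM_self_mono {ω ω' : Set (EuclideanSpace ℝ (Fin d))} (h : ω ⊆ ω') (v : G.VHat) :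
    G.formM ω v v ≤ G.formM ω' v v := by
  simp only [formM_eq]
  exact sumOver_mono (fun x hx => h hx) fun x _ =>
    mul_nonneg (G.mass_nonneg x) (mul_self_nonneg _)

lemma normMOn_mono {ω ω' : Set (EuclideanSpace ℝ (Fin d))} (h : ω ⊆ ω') (v : G.VHat) :
    G.normMOn ω v ≤ G.normMOn ω' v := Real.sqrt_le_sqrt (G.formM_self_mono h v)

lemma quadL_nonneg (ω : Set (EuclideanSpace ℝ (Fin d))) (v : G.VHat) : 0 ≤ G.quadL ω v :=
  sumOver_nonneg fun x _ => G.nodeL_nonneg v x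

lemma normLOn_sq (ω : Set (EuclideanSpace ℝ (Fin d))) (v : G.VHat) :
    G.normLOn ω v ^ 2 = G.quadL ω v := Real.sq_sqrt (G.quadL_nonneg ω v)

lemma quadL_mono {ω ω' : Set (EuclideanSpace ℝ (Fin d))} (h : ω ⊆ ω') (v : G.VHat) :
    G.quadL ω v ≤ G.quadL ω' v :=
  sumOver_mono (fun _ hx => h hx) fun x _ => G.nodeL_nonneg v x

lemma normLOn_mono {ω ω' : Set (EuclideanSpace ℝ (Fin d))} (h : ω ⊆ ω') (v : G.VHat) :
    G.normLOn ω v ≤ G.normLOn ω' v := Real.sqrt_le_sqrt (G.quadL_mono h v)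

/-- (a + b)² ≤ 2a² + 2b² on every edge. The energy L is kept as a quadratic form and never
polarised; this factor 2 stands in for the triangle inequality. -/
lemma nodeL_add_le (u v : G.VHat) (x : G.nodes) :
    G.nodeL (u + v) x ≤ 2 * G.nodeL u x + 2 * G.nodeL v x := by
  have : sumOver (fun y => G.graph.Adj x y) (fun y =>
      ((u + v) x - (u + v) y) ^ 2 / dist (x : EuclideanSpace ℝ (Fin d)) y) ≤
      2 * sumOver (fun y => G.graph.Adj x y) (fun y =>
        (u x - u y) ^ 2 / dist (x : EuclideanSpace ℝ (Fin d)) y) +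
      2 * sumOver (fun y => G.graph.Adj x y) (fun y =>
        (v x - v y) ^ 2 / dist (x : EuclideanSpace ℝ (Fin d)) y) := by
    rw [mul_sumOver, mul_sumOver, ← sumOver_add]
    refine sumOver_le_sumOver fun y _ => ?_
    rw [mul_div_assoc', mul_div_assoc', ← add_div]
    refine div_le_div_of_nonneg_right ?_ dist_nonneg
    simp only [Pi.add_apply]
    nlinarith [sq_nonneg ((u x - u y) - (v x - v y))]
  unfold nodeL
  linarith

lemma quadL_add_le (ω : Set (EuclideanSpace ℝ (Fin d))) (u v : G.VHat) :
    G.quadL ω (u + v) ≤ 2 * G.quadL ω u + 2 * G.quadL ω v := by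
  simp only [quadL_eq]
  rw [mul_sumOver, mul_sumOver, ← sumOver_add]
  exact sumOver_le_sumOver fun x _ => G.nodeL_add_le u v x

lemma nodeL_neg (v : G.VHat) (x : G.nodes) : G.nodeL (-v) x = G.nodeL v x := by
  unfold nodeL
  congr 1
  exact sumOver_congr fun y _ => by simp only [Pi.neg_apply]; ring

lemma quadL_sub_le (ω : Set (EuclideanSpace ℝ (Fin d))) (u v : G.VHat) :
    G.quadL ω (u - v) ≤ 2 * G.quadL ω u + 2 * G.quadL ω v := by
  have h : G.quadL ω (-v) = G.quadL ω v := by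
    simp only [quadL_eq]
    exact sumOver_congr fun x _ => G.nodeL_neg v x
  rw [sub_eq_add_neg, ← h]
  exact G.quadL_add_le ω u (-v)

/-- `(L_x v, v)` depends only on the values at `x` and its neighbours. -/
lemma nodeL_congr {u v : G.VHat} {x : G.nodes} (h : u x = v x)
    (h' : ∀ y, G.graph.Adj x y → u y = v y) : G.nodeL u x = G.nodeL v x := by
  unfold nodeL
  congr 1
  exact sumOver_congr fun y hy => by rw [h, h' y hy]

lemma nodeL_zero (x : G.nodes) : G.nodeL 0 x = 0 := by
  unfold nodeL
  rw [sumOver_eq_zero fun y _ => by simp, mul_zero]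

variable {G}

/-- `K_ω` as a bilinear form. -/
noncomputable def LocalOperator.bilinOn (K : G.LocalOperator)
    (ω : Set (EuclideanSpace ℝ (Fin d))) : LinearMap.BilinForm ℝ G.VHat :=
  LinearMap.mk₂ ℝ (K.formOn ω)
    (fun u u' v => by
      simp only [formOn, ← sumOver_add]
      exact sumOver_congr fun x _ => by rw [Matrix.mulVec_add, add_dotProduct])
    (fun c u v => by
      simp only [formOn, smul_eq_mul, mul_sumOver]
      exact sumOver_congr fun x _ => by rw [Matrix.mulVec_smul, smul_dotProduct, smul_eq_mul])
    (fun u v v' => by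
      simp only [formOn, ← sumOver_add]
      exact sumOver_congr fun x _ => by rw [dotProduct_add])
    (fun c u v => by
      simp only [formOn, smul_eq_mul, mul_sumOver]
      exact sumOver_congr fun x _ => by rw [dotProduct_smul, smul_eq_mul])

/-- `K` as a bilinear form. -/
noncomputable abbrev LocalOperator.bilin (K : G.LocalOperator) : LinearMap.BilinForm ℝ G.VHat :=
  K.bilinOn (unitCube d)

lemma LocalOperator.bilinOn_apply (K : G.LocalOperator) (ω : Set (EuclideanSpace ℝ (Fin d)))
    (u v : G.VHat) : K.bilinOn ω u v = K.formOn ω u v := rfl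

lemma LocalOperator.bilin_apply (K : G.LocalOperator) (u v : G.VHat) :
    K.bilin u v = K.form u v := rfl

lemma LocalOperator.node_nonneg (K : G.LocalOperator) (x : G.nodes) (v : G.VHat) :
    0 ≤ dotProduct ((K.mat x).mulVec v) v := by
  have := (K.posSemidef x).dotProduct_mulVec_nonneg v
  rwa [star_trivial, dotProduct_comm] at this

lemma LocalOperator.isPSDForm_bilinOn (K : G.LocalOperator)
    (ω : Set (EuclideanSpace ℝ (Fin d))) : IsPSDForm (K.bilinOn ω) where
  symm u v := by
    refine sumOver_congr fun x _ => ?_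
    have h : (K.mat x).transpose = K.mat x := by
      have := (K.posSemidef x).isHermitian
      rwa [Matrix.IsHermitian, Matrix.conjTranspose_eq_transpose_of_trivial] at this
    calc dotProduct ((K.mat x).mulVec u) v = dotProduct v ((K.mat x).mulVec u) :=
          dotProduct_comm _ _
      _ = dotProduct (Matrix.vecMul v (K.mat x)) u := Matrix.dotProduct_mulVec _ _ _
      _ = dotProduct ((K.mat x).mulVec v) u := by rw [← Matrix.mulVec_transpose, h]
  nonneg u := sumOver_nonneg fun x _ => K.node_nonneg x u

lemma LocalOperator.isPSDForm_bilin (K : G.LocalOperator) : IsPSDForm K.bilin :=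
  K.isPSDForm_bilinOn _

lemma LocalOperator.norm_eq (K : G.LocalOperator) (v : G.VHat) :
    K.norm v = energyNorm K.bilin v := rfl

/-- The forms `K_x` couple only values at `x` and its neighbours. -/
lemma LocalOperator.node_eq_zero (K : G.LocalOperator) (x : G.nodes) {u v : G.VHat}
    (h : ∀ y z, (y = x ∨ G.graph.Adj x y) → (z = x ∨ G.graph.Adj x z) → u y = 0 ∨ v z = 0) :
    dotProduct ((K.mat x).mulVec u) v = 0 := by
  simp only [dotProduct, Matrix.mulVec, Finset.sum_mul]
  refine Finset.sum_eq_zero fun z _ => Finset.sum_eq_zero fun y _ => ?_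
  by_cases hK : K.mat x z y = 0
  · simp [hK]
  · obtain ⟨hz, hy⟩ := K.isLocal x z y hK
    rcases h y z hy hz with h0 | h0 <;> simp [h0]

lemma LocalOperator.formOn_mono (K : G.LocalOperator) (ω : Set (EuclideanSpace ℝ (Fin d)))
    (v : G.VHat) : K.formOn ω v v ≤ K.form v v :=
  sumOver_mono (fun x _ => G.nodes_subset x x.2) fun x _ => K.node_nonneg x v

end SpatialNetwork

/-! ### The supremum distance and the mesh -/

/-- The distance of two points in the supremum norm. -/
noncomputable def supDist {d : ℕ} (x y : EuclideanSpace ℝ (Fin d)) : ℝ :=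
  dist x.ofLp y.ofLp

section SupDist

variable {d : ℕ}

lemma supDist_nonneg (x y : EuclideanSpace ℝ (Fin d)) : 0 ≤ supDist x y := dist_nonneg

lemma supDist_comm (x y : EuclideanSpace ℝ (Fin d)) : supDist x y = supDist y x := dist_comm _ _

lemma supDist_triangle (x y z : EuclideanSpace ℝ (Fin d)) :
    supDist x z ≤ supDist x y + supDist y z := dist_triangle _ _ _

lemma supDist_le_iff {x y : EuclideanSpace ℝ (Fin d)} {r : ℝ} (hr : 0 ≤ r) :
    supDist x y ≤ r ↔ ∀ m, |x m - y m| ≤ r := by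
  simp [supDist, dist_pi_le_iff hr, Real.dist_eq]

lemma supDist_lt_iff {x y : EuclideanSpace ℝ (Fin d)} {r : ℝ} (hr : 0 < r) :
    supDist x y < r ↔ ∀ m, |x m - y m| < r := by
  simp [supDist, dist_pi_lt_iff hr, Real.dist_eq]

lemma abs_apply_sub_le_supDist (x y : EuclideanSpace ℝ (Fin d)) (m : Fin d) :
    |x m - y m| ≤ supDist x y := (supDist_le_iff (supDist_nonneg x y)).1 le_rfl m

lemma abs_apply_sub_le_dist (x y : EuclideanSpace ℝ (Fin d)) (m : Fin d) :
    |x m - y m| ≤ dist x y := by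
  rw [dist_eq_norm]
  simpa using PiLp.norm_apply_le (x - y) m

lemma supDist_le_dist (x y : EuclideanSpace ℝ (Fin d)) : supDist x y ≤ dist x y :=
  (supDist_le_iff dist_nonneg).2 (abs_apply_sub_le_dist x y)

lemma continuous_supDist_left (c : EuclideanSpace ℝ (Fin d)) :
    Continuous fun x => supDist x c :=
  (PiLp.continuous_ofLp 2 _).dist continuous_const

end SupDist

/-! ### The mesh size, the elements and their patches. -/

lemma meshSize_pos (i : ℕ) : 0 < meshSize i := by unfold meshSize; positivity

lemma two_pow_mul_meshSize (i : ℕ) : (2 : ℝ) ^ i * meshSize i = 1 := by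
  unfold meshSize; field_simp

lemma meshSize_le_one (i : ℕ) : meshSize i ≤ 1 := by
  unfold meshSize
  exact inv_le_one_of_one_le₀ (one_le_pow₀ (by norm_num))

lemma coe_mul_meshSize_le_one {i : ℕ} (j : Fin (2 ^ i + 1)) : ((j : ℕ) : ℝ) * meshSize i ≤ 1 := by
  have h : ((j : ℕ) : ℝ) ≤ 2 ^ i := by exact_mod_cast Nat.lt_succ_iff.1 j.2
  calc _ ≤ 2 ^ i * meshSize i := mul_le_mul_of_nonneg_right h (meshSize_pos i).le
    _ = 1 := two_pow_mul_meshSize i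

lemma coe_add_one_mul_meshSize_le_one {i : ℕ} (t : Fin (2 ^ i)) :
    (((t : ℕ) : ℝ) + 1) * meshSize i ≤ 1 := by
  have h : ((t : ℕ) : ℝ) + 1 ≤ 2 ^ i := by exact_mod_cast t.2
  calc _ ≤ 2 ^ i * meshSize i := mul_le_mul_of_nonneg_right h (meshSize_pos i).le
    _ = 1 := two_pow_mul_meshSize i

/-- The centre of an element. -/
noncomputable def elementCenter {d : ℕ} (i : ℕ) (t : Fin d → Fin (2 ^ i)) :
    EuclideanSpace ℝ (Fin d) :=
  WithLp.toLp 2 fun m => ((t m : ℕ) + 1 / 2 : ℝ) * meshSize i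

section Mesh

variable {d i : ℕ}

lemma elementCenter_apply (t : Fin d → Fin (2 ^ i)) (m : Fin d) :
    elementCenter i t m = ((t m : ℕ) + 1 / 2 : ℝ) * meshSize i := rfl

lemma meshNode_apply (j : Fin d → Fin (2 ^ i + 1)) (m : Fin d) :
    meshNode i j m = ((j m : ℕ) : ℝ) * meshSize i := rfl

lemma boxInside_elementCenter (t : Fin d → Fin (2 ^ i)) :
    BoxInside (meshSize i / 2) (elementCenter i t) := by
  intro m
  have h := coe_add_one_mul_meshSize_le_one (t m)
  have hH := meshSize_pos i
  rw [elementCenter_apply]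
  constructor
  · have : 0 ≤ ((t m : ℕ) : ℝ) * meshSize i := by positivity
    linarith
  · linarith

lemma box_subset_unitCube (R : ℝ) (x : EuclideanSpace ℝ (Fin d)) : box R x ⊆ unitCube d :=
  fun _ hz => hz.1

lemma element_subset_unitCube (t : Fin d → Fin (2 ^ i)) : element i t ⊆ unitCube d :=
  box_subset_unitCube _ _

lemma supDist_le_of_mem_box {R : ℝ} (hR : 0 ≤ R) {x z : EuclideanSpace ℝ (Fin d)}
    (hz : z ∈ box R x) : supDist z x ≤ R := by
  refine (supDist_le_iff hR).2 fun m => ?_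
  obtain ⟨h1, h2⟩ := hz.2 m
  rw [abs_le]
  constructor
  · linarith
  · rcases h2 with h | h <;> linarith [h]

lemma supDist_le_of_mem_element {t : Fin d → Fin (2 ^ i)} {z : EuclideanSpace ℝ (Fin d)}
    (hz : z ∈ element i t) : supDist z (elementCenter i t) ≤ meshSize i / 2 :=
  supDist_le_of_mem_box (half_pos (meshSize_pos i)).le hz

lemma meshNode_mem_unitCube (j : Fin d → Fin (2 ^ i + 1)) : meshNode i j ∈ unitCube d := by
  intro m
  rw [meshNode_apply]
  exact ⟨mul_nonneg (Nat.cast_nonneg _) (meshSize_pos i).le, coe_mul_meshSize_le_one _⟩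

/-- The index of the element that contains a given point of `Ω`. -/
noncomputable def elementIndex (i : ℕ) (x : EuclideanSpace ℝ (Fin d)) : Fin d → Fin (2 ^ i) :=
  -- The minimum sends points with x_m = 1 to the last element, in agreement with the closed upper
  -- face of the boxes there.
  fun m => ⟨min ⌊x m * 2 ^ i⌋₊ (2 ^ i - 1),
    (min_le_right _ _).trans_lt (Nat.sub_lt (by positivity) one_pos)⟩

/-- One coordinate of the partition, with y = 2^i x_m and n = 2^i. The alternative y = n is the
closed upper face of Ω and corresponds to the truncation of the floor at n - 1. -/
lemma min_floor_eq_iff {y : ℝ} {n t : ℕ} (h0 : 0 ≤ y) (hn : y ≤ n) (ht : t < n) :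
    ((t : ℝ) ≤ y ∧ (y < t + 1 ∨ (y = n ∧ y ≤ t + 1))) ↔ min ⌊y⌋₊ (n - 1) = t := by
  constructor
  · rintro ⟨h1, h2 | ⟨h2, h3⟩⟩
    · have : ⌊y⌋₊ = t := (Nat.floor_eq_iff h0).2 ⟨h1, h2⟩
      omega
    · rw [h2, Nat.floor_natCast]
      have : n ≤ t + 1 := by rw [h2] at h3; exact_mod_cast h3
      omega
  · intro h
    have h1 : (⌊y⌋₊ : ℝ) ≤ y := Nat.floor_le h0
    have h2 : y < ⌊y⌋₊ + 1 := Nat.lt_floor_add_one y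
    rcases le_or_gt ⌊y⌋₊ (n - 1) with h3 | h3
    · rw [min_eq_left h3] at h
      rw [h] at h1 h2
      exact ⟨h1, Or.inl h2⟩
    · rw [min_eq_right h3.le] at h
      have h4 : n ≤ ⌊y⌋₊ := by omega
      have h5 : (n : ℝ) ≤ y := le_trans (by exact_mod_cast h4) h1
      have h6 : n = t + 1 := by omega
      have h7 : y = n := le_antisymm hn h5
      have h8 : (n : ℝ) = t + 1 := by exact_mod_cast h6
      exact ⟨by linarith, Or.inr ⟨h7, by linarith⟩⟩

/-- After rescaling by 2^i each coordinate is `min_floor_eq_iff`. The elements are thus the fibres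
of `elementIndex`, so they partition Ω and sums over nodes split into sums over elements. -/
lemma mem_element_iff {x : EuclideanSpace ℝ (Fin d)} (hx : x ∈ unitCube d)
    (t : Fin d → Fin (2 ^ i)) : x ∈ element i t ↔ elementIndex i x = t := by
  have hH := meshSize_pos i
  have hn := two_pow_mul_meshSize i
  have key : ∀ m, (elementCenter i t m - meshSize i / 2 ≤ x m ∧
      (x m < elementCenter i t m + meshSize i / 2 ∨
        (x m = 1 ∧ x m ≤ elementCenter i t m + meshSize i / 2))) ↔
      elementIndex i x m = t m := by
    intro m
    have hp : (0 : ℝ) < 2 ^ i := by positivity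
    have e0 : x m = x m * 2 ^ i * meshSize i := by rw [mul_assoc, hn, mul_one]
    rw [Fin.ext_iff]
    change _ ↔ min ⌊x m * 2 ^ i⌋₊ (2 ^ i - 1) = (t m : ℕ)
    rw [← min_floor_eq_iff (mul_nonneg (hx m).1 hp.le)
      (by push_cast; exact mul_le_of_le_one_left hp.le (hx m).2) (t m).2]
    rw [elementCenter_apply]
    have e1 : (((t m : ℕ) : ℝ) + 1 / 2) * meshSize i - meshSize i / 2 = (t m : ℕ) * meshSize i := by
      ring
    have e2 : (((t m : ℕ) : ℝ) + 1 / 2) * meshSize i + meshSize i / 2 =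
      ((t m : ℕ) + 1) * meshSize i := by ring
    have e3 : (x m = 1) ↔ x m * 2 ^ i = ((2 ^ i : ℕ) : ℝ) := by
      push_cast
      constructor
      · intro h; rw [h, one_mul]
      · intro h; exact mul_right_cancel₀ hp.ne' (by rw [h, one_mul])
    rw [e1, e2, e3]
    generalize x m * 2 ^ i = y at e0 ⊢
    rw [e0, mul_le_mul_iff_left₀ hH, mul_le_mul_iff_left₀ hH, mul_lt_mul_iff_left₀ hH]
  rw [funext_iff]
  constructor
  · intro h m
    exact (key m).1 (h.2 m)
  · intro h
    exact ⟨hx, fun m => (key m).2 (h m)⟩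

lemma mem_element_elementIndex {x : EuclideanSpace ℝ (Fin d)} (hx : x ∈ unitCube d) :
    x ∈ element i (elementIndex i x) := (mem_element_iff hx _).2 rfl

/-- z is the limit of c + s(z - c) as s tends to 1 from below, and these points lie strictly inside
the cube, where the half-open convention plays no role. -/
lemma mem_closure_element {t : Fin d → Fin (2 ^ i)} {z : EuclideanSpace ℝ (Fin d)}
    (hz : ∀ m, |z m - elementCenter i t m| ≤ meshSize i / 2) : z ∈ closure (element i t) := by
  set c := elementCenter i t with hc
  have hH := meshSize_pos i
  have hcont : Continuous fun s : ℝ => c + s • (z - c) := by fun_prop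
  have h1 : (1 : ℝ) ∈ closure (Set.Ico (0 : ℝ) 1) := by
    rw [closure_Ico (by norm_num)]
    exact ⟨by norm_num, le_rfl⟩
  have h2 : c + (1 : ℝ) • (z - c) = z := by simp
  have h3 := map_mem_closure hcont h1 (t := element i t) ?_
  · simpa [h2] using h3
  · intro s hs
    have hb : ∀ m, |s * (z m - c m)| < meshSize i / 2 := by
      intro m
      rw [abs_mul, abs_of_nonneg hs.1]
      have := hz m
      have h5 := abs_nonneg (z m - c m)
      rcases eq_or_lt_of_le h5 with h6 | h6
      · rw [← h6]; simpa using hH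
      · nlinarith [hs.2]
    have hin := boxInside_elementCenter t
    refine ⟨fun m => ?_, fun m => ?_⟩
    · have := abs_lt.1 (hb m)
      have h4 := hin m
      simp only [PiLp.add_apply, PiLp.smul_apply, PiLp.sub_apply, smul_eq_mul]
      rw [← hc] at h4
      constructor <;> linarith [this.1, this.2, h4.1, h4.2]
    · have := abs_lt.1 (hb m)
      change c m - meshSize i / 2 ≤ (c + s • (z - c)) m ∧ ((c + s • (z - c)) m <
        c m + meshSize i / 2 ∨ (_ = 1 ∧ _ ≤ c m + meshSize i / 2))
      simp only [PiLp.add_apply, PiLp.smul_apply, PiLp.sub_apply, smul_eq_mul]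
      exact ⟨by linarith [this.1], Or.inl (by linarith [this.2])⟩

lemma mem_closure_element_iff {t : Fin d → Fin (2 ^ i)} {z : EuclideanSpace ℝ (Fin d)} :
    z ∈ closure (element i t) ↔ ∀ m, |z m - elementCenter i t m| ≤ meshSize i / 2 := by
  refine ⟨fun h => ?_, mem_closure_element⟩
  have hcl : IsClosed {z : EuclideanSpace ℝ (Fin d) |
      supDist z (elementCenter i t) ≤ meshSize i / 2} :=
    isClosed_le (continuous_supDist_left _) continuous_const
  have := closure_minimal (fun z hz => supDist_le_of_mem_element hz) hcl h
  exact (supDist_le_iff (half_pos (meshSize_pos i)).le).1 this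

/-- Induction on the number of layers: moving t' one step towards t in every coordinate where they
differ gives t'', one layer closer. The closures of t' and t'' share the point with coordinates
max(t'_m, t''_m) H, which is a vertex of both. -/
lemma element_subset_patchIter (t : Fin d → Fin (2 ^ i)) (k : ℕ) :
    ∀ t' : Fin d → Fin (2 ^ i), (∀ m, (t m : ℕ) ≤ t' m + k ∧ (t' m : ℕ) ≤ t m + k) →
      element i t' ⊆ patchIter i k (element i t) := by
  induction k with
  | zero =>
    intro t' h
    have : t' = t := funext fun m => Fin.ext (by have := h m; omega)
    subst this
    exact subset_rfl
  | succ k ih =>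
    intro t' h x hx
    let t'' : Fin d → Fin (2 ^ i) := fun m =>
      if hlt : (t' m : ℕ) < t m then ⟨t' m + 1, by have := (t m).2; omega⟩
      else if (t m : ℕ) < t' m then ⟨t' m - 1, by have := (t' m).2; omega⟩ else t' m
    have hv : ∀ m, (t'' m : ℕ) = if (t' m : ℕ) < t m then (t' m : ℕ) + 1
        else if (t m : ℕ) < t' m then (t' m : ℕ) - 1 else t' m := by
      intro m
      simp only [t'']
      split_ifs <;> rfl
    have h1 : ∀ m, (t m : ℕ) ≤ t'' m + k ∧ (t'' m : ℕ) ≤ t m + k := by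
      intro m
      have := h m
      rw [hv m]
      split_ifs <;> omega
    have h2 : ∀ m, (t' m : ℕ) ≤ t'' m + 1 ∧ (t'' m : ℕ) ≤ t' m + 1 := by
      intro m
      rw [hv m]
      split_ifs <;> omega
    unfold patchIter
    rw [Function.iterate_succ_apply']
    have hH := meshSize_pos i
    refine ⟨t', hx, WithLp.toLp 2 (fun m => ((max (t' m : ℕ) (t'' m) : ℕ) : ℝ) * meshSize i),
      mem_closure_element fun m => ?_, closure_mono (ih t'' h1) (mem_closure_element fun m => ?_)⟩
    · rw [elementCenter_apply, ← sub_mul, abs_mul, abs_of_pos hH,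
        show meshSize i / 2 = 1 / 2 * meshSize i by ring]
      refine mul_le_mul_of_nonneg_right ?_ hH.le
      have a1 := Nat.le_max_left (t' m : ℕ) (t'' m)
      have a2 : max (t' m : ℕ) (t'' m) ≤ t' m + 1 := by have := h2 m; omega
      have b1 : ((t' m : ℕ) : ℝ) ≤ (max (t' m : ℕ) (t'' m) : ℕ) := by exact_mod_cast a1
      have b2 : ((max (t' m : ℕ) (t'' m) : ℕ) : ℝ) ≤ (t' m : ℕ) + 1 := by exact_mod_cast a2
      rw [abs_le]
      constructor <;> linarith
    · rw [elementCenter_apply, ← sub_mul, abs_mul, abs_of_pos hH,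
        show meshSize i / 2 = 1 / 2 * meshSize i by ring]
      refine mul_le_mul_of_nonneg_right ?_ hH.le
      have a1 := Nat.le_max_right (t' m : ℕ) (t'' m)
      have a2 : max (t' m : ℕ) (t'' m) ≤ t'' m + 1 := by have := h2 m; omega
      have b1 : ((t'' m : ℕ) : ℝ) ≤ (max (t' m : ℕ) (t'' m) : ℕ) := by exact_mod_cast a1
      have b2 : ((max (t' m : ℕ) (t'' m) : ℕ) : ℝ) ≤ (t'' m : ℕ) + 1 := by exact_mod_cast a2
      rw [abs_le]
      constructor <;> linarith

/-- A point at distance at most `kH` from the centre of an element lies in the `k`-th patch. -/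
lemma mem_patchIter_of_supDist_le {t : Fin d → Fin (2 ^ i)} {k : ℕ}
    {x : EuclideanSpace ℝ (Fin d)} (hx : x ∈ unitCube d)
    (h : supDist x (elementCenter i t) ≤ k * meshSize i) :
    x ∈ patchIter i k (element i t) := by
  have hH := meshSize_pos i
  refine element_subset_patchIter t k (elementIndex i x) (fun m => ?_)
    (mem_element_elementIndex hx)
  have h1 := abs_le.1 ((abs_apply_sub_le_supDist x _ m).trans h)
  have h2 := abs_le.1 ((abs_apply_sub_le_supDist x _ m).trans
    (supDist_le_of_mem_element (mem_element_elementIndex (i := i) hx)))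
  rw [elementCenter_apply] at h1 h2
  constructor
  · have : ((t m : ℕ) : ℝ) < (elementIndex i x m : ℕ) + k + 1 := by
      by_contra hc
      push Not at hc
      nlinarith
    have h3 : (t m : ℕ) < (elementIndex i x m : ℕ) + k + 1 := by exact_mod_cast this
    omega
  · have : ((elementIndex i x m : ℕ) : ℝ) < (t m : ℕ) + k + 1 := by
      by_contra hc
      push Not at hc
      nlinarith
    have h3 : (elementIndex i x m : ℕ) < (t m : ℕ) + k + 1 := by exact_mod_cast this
    omega

/-- Every point of `Ω` has a cube of controlled size inside `Ω` around it, shifted inwards where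
necessary. -/
lemma exists_boxInside {p : EuclideanSpace ℝ (Fin d)} (hp : p ∈ unitCube d) {r : ℝ}
    (hr : 0 < r) : ∃ c : EuclideanSpace ℝ (Fin d), BoxInside (min r (1 / 2)) c ∧
      supDist c p ≤ min r (1 / 2) ∧
      ∀ z ∈ unitCube d, supDist z p < r → z ∈ box (min r (1 / 2)) c := by
  set R := min r (1 / 2) with hR
  have hR0 : 0 < R := lt_min hr (by norm_num)
  have hR1 : R ≤ 1 / 2 := min_le_right _ _
  -- The centre is p clamped to [R, 1 - R] in every coordinate. If r ≥ 1/2 then R = 1/2 and the box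
  -- is all of Ω.
  refine ⟨WithLp.toLp 2 fun m => max R (min (1 - R) (p m)), fun m => ?_,
    (supDist_le_iff hR0.le).2 fun m => ?_, fun z hz hzp => ⟨hz, fun m => ?_⟩⟩
  · change 0 ≤ max R (min (1 - R) (p m)) - R ∧ max R (min (1 - R) (p m)) + R ≤ 1
    constructor
    · linarith [le_max_left R (min (1 - R) (p m))]
    · have : max R (min (1 - R) (p m)) ≤ 1 - R :=
        max_le (by linarith) (min_le_left _ _)
      linarith
  · change |max R (min (1 - R) (p m)) - p m| ≤ R
    have := hp m
    rw [abs_le]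
    rcases max_cases R (min (1 - R) (p m)) with ⟨h1, h1'⟩ | ⟨h1, h1'⟩ <;>
      rcases min_cases (1 - R) (p m) with ⟨h2, h2'⟩ | ⟨h2, h2'⟩ <;>
      constructor <;> linarith
  · have hzm := hz m
    have hpm := hp m
    have h := abs_lt.1 ((supDist_lt_iff hr).1 hzp m)
    change max R (min (1 - R) (p m)) - R ≤ z m ∧ (z m < max R (min (1 - R) (p m)) + R ∨
      (z m = 1 ∧ z m ≤ max R (min (1 - R) (p m)) + R))
    rcases le_total r (1 / 2) with hc | hc
    · have hRr : R = r := min_eq_left hc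
      rw [hRr] at hR0 hR1 ⊢
      constructor
      · rw [sub_le_iff_le_add]
        exact max_le (by linarith) ((min_le_right _ _).trans (by linarith))
      · rcases le_total (1 - r) (p m) with h2 | h2
        · have : max r (min (1 - r) (p m)) = 1 - r := by
            rw [min_eq_left h2, max_eq_right (by linarith)]
          rw [this]
          rcases eq_or_lt_of_le hzm.2 with h3 | h3
          · exact Or.inr ⟨h3, by linarith⟩
          · exact Or.inl (by linarith)
        · left
          rw [min_eq_right h2]
          linarith [le_max_right r (p m)]
    · have hRr : R = 1 / 2 := min_eq_right hc
      rw [hRr]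
      have : max (1 / 2 : ℝ) (min (1 - 1 / 2) (p m)) = 1 / 2 :=
        max_eq_left ((min_le_left _ _).trans (by norm_num))
      rw [this]
      constructor
      · linarith
      · rcases eq_or_lt_of_le hzm.2 with h3 | h3
        · exact Or.inr ⟨h3, by linarith⟩
        · exact Or.inl (by linarith)

/-- There are ⌊a+r⌋ - ⌈a-r⌉ + 1 integers in [a-r, a+r], and ⌊a⌋ ≤ ⌈a⌉. This count bounds every
overlap of mesh neighbourhoods below. -/
lemma card_filter_abs_sub_le (n r : ℕ) (a : ℝ) :
    (Finset.univ.filter fun j : Fin n => |a - (j : ℕ)| ≤ r).card ≤ 2 * r + 1 := by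
  calc _ ≤ (Finset.Icc ⌈a - r⌉ ⌊a + r⌋).card := by
        refine Finset.card_le_card_of_injOn (fun j => ((j : ℕ) : ℤ)) ?_ ?_
        · intro j hj
          have h := abs_le.1 (Finset.mem_filter.1 hj).2
          rw [Finset.coe_Icc, Set.mem_Icc, Int.ceil_le, Int.le_floor]
          push_cast
          constructor <;> linarith
        · intro j _ j' _ h
          exact Fin.ext (by simpa using h)
    _ ≤ 2 * r + 1 := by
        rw [Int.card_Icc, Int.floor_add_natCast, Int.ceil_sub_natCast]
        have := Int.floor_le_ceil a
        omega

/-- A box of radius `r` contains at most `(2r+1)^d` multi-indices. -/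
lemma card_multiIndex_le {n : ℕ} (r : ℕ) (a : Fin d → ℝ) (s : Finset (Fin d → Fin n))
    (h : ∀ j ∈ s, ∀ m, |a m - (j m : ℕ)| ≤ r) : (s.card : ℝ) ≤ (2 * r + 1) ^ d := by
  have h1 : s ⊆ Fintype.piFinset fun m => Finset.univ.filter fun j : Fin n =>
      |a m - (j : ℕ)| ≤ r := by
    intro j hj
    simpa using h j hj
  have h2 : s.card ≤ (2 * r + 1) ^ d := by
    refine (Finset.card_le_card h1).trans ?_
    rw [Fintype.card_piFinset]
    calc _ ≤ ∏ _m : Fin d, (2 * r + 1) :=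
          Finset.prod_le_prod' fun m _ => card_filter_abs_sub_le n r (a m)
      _ = _ := by simp
  exact_mod_cast h2

/-! ### The Lagrange basis -/

lemma lagrange_nonneg (j : Fin d → Fin (2 ^ i + 1)) (z : EuclideanSpace ℝ (Fin d)) :
    0 ≤ lagrange i j z := Finset.prod_nonneg fun _ _ => le_max_left _ _

lemma hat_le_one (a : ℝ) : max 0 (1 - |a| / meshSize i) ≤ 1 :=
  max_le zero_le_one (sub_le_self _ (div_nonneg (abs_nonneg _) (meshSize_pos i).le))

lemma supDist_lt_of_lagrange_ne_zero {j : Fin d → Fin (2 ^ i + 1)}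
    {z : EuclideanSpace ℝ (Fin d)} (h : lagrange i j z ≠ 0) :
    supDist z (meshNode i j) < meshSize i := by
  refine (supDist_lt_iff (meshSize_pos i)).2 fun m => ?_
  by_contra hc
  push Not at hc
  refine h (Finset.prod_eq_zero (Finset.mem_univ m) (max_eq_left ?_))
  rw [sub_nonpos, le_div_iff₀ (meshSize_pos i), one_mul]
  exact hc

/-- Only the hats at ⌊y⌋ and ⌊y⌋ + 1 survive, and their values add up to 1. The end point y = n is
separate because ⌊y⌋ + 1 is then out of range. -/
lemma sum_hat_eq_one {n : ℕ} {y : ℝ} (h0 : 0 ≤ y) (hn : y ≤ n) :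
    ∑ s : Fin (n + 1), max 0 (1 - |y - (s : ℕ)|) = 1 := by
  rw [Fin.sum_univ_eq_sum_range (fun s : ℕ => max 0 (1 - |y - (s : ℝ)|))]
  rcases eq_or_lt_of_le hn with h | h
  · rw [Finset.sum_eq_single_of_mem n (by simp)]
    · rw [h]; simp
    · intro s hs hne
      have h1 : s + 1 ≤ n := by have := Finset.mem_range.1 hs; omega
      have h2 : (s : ℝ) + 1 ≤ n := by exact_mod_cast h1
      rw [h, abs_of_nonneg (by linarith)]
      exact max_eq_left (by linarith)
  · set f := ⌊y⌋₊
    have h1 : (f : ℝ) ≤ y := Nat.floor_le h0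
    have h2 : y < f + 1 := Nat.lt_floor_add_one y
    have h3 : f < n := by
      have : (f : ℝ) < n := by linarith
      exact_mod_cast this
    rw [← Finset.sum_subset (s₁ := {f, f + 1})]
    · rw [Finset.sum_pair (by omega)]
      push_cast
      rw [abs_of_nonneg (by linarith), abs_of_nonpos (by linarith),
        max_eq_right (by linarith), max_eq_right (by linarith)]
      ring
    · intro s hs
      simp only [Finset.mem_insert, Finset.mem_singleton] at hs
      rw [Finset.mem_range]
      omega
    · intro s _ hs
      simp only [Finset.mem_insert, Finset.mem_singleton, not_or] at hs
      apply max_eq_left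
      rcases lt_or_gt_of_ne hs.1 with h4 | h4
      · have h5 : (s : ℝ) + 1 ≤ f := by exact_mod_cast h4
        rw [abs_of_nonneg (by linarith)]
        linarith
      · have h5 : f + 2 ≤ s := by omega
        have h6 : (f : ℝ) + 2 ≤ s := by exact_mod_cast h5
        rw [abs_of_nonpos (by linarith)]
        linarith

lemma sum_lagrange {z : EuclideanSpace ℝ (Fin d)} (hz : z ∈ unitCube d) :
    ∑ j : Fin d → Fin (2 ^ i + 1), lagrange i j z = 1 := by
  have hH := meshSize_pos i
  have hn := two_pow_mul_meshSize i
  have h1 : ∀ (m : Fin d) (s : Fin (2 ^ i + 1)),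
      max 0 (1 - |z m - ((s : ℕ) : ℝ) * meshSize i| / meshSize i) =
      max 0 (1 - |z m * 2 ^ i - (s : ℕ)|) := by
    intro m s
    have : z m - ((s : ℕ) : ℝ) * meshSize i = (z m * 2 ^ i - (s : ℕ)) * meshSize i := by
      rw [sub_mul, mul_assoc, hn, mul_one]
    rw [this, abs_mul, abs_of_pos hH, mul_div_cancel_right₀ _ hH.ne']
  unfold lagrange
  simp only [meshNode_apply, h1]
  rw [← Fintype.prod_sum fun (m : Fin d) (s : Fin (2 ^ i + 1)) =>
    max 0 (1 - |z m * 2 ^ i - (s : ℕ)|)]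
  refine Finset.prod_eq_one fun m _ => sum_hat_eq_one ?_ ?_
  · exact mul_nonneg (hz m).1 (by positivity)
  · push_cast
    exact mul_le_of_le_one_left (by positivity) (hz m).2

/-- Telescoping: exchange one factor at a time, all the others being at most 1. It gives the product
hats the slope d/H. -/
lemma abs_prod_sub_prod_le {ι : Type*} (s : Finset ι) (f g : ι → ℝ)
    (hf : ∀ x ∈ s, 0 ≤ f x ∧ f x ≤ 1) (hg : ∀ x ∈ s, 0 ≤ g x ∧ g x ≤ 1) :
    |∏ x ∈ s, f x - ∏ x ∈ s, g x| ≤ ∑ x ∈ s, |f x - g x| := by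
  classical
  induction s using Finset.induction_on with
  | empty => simp
  | insert a s ha ih =>
    have hf' := fun x hx => hf x (Finset.mem_insert_of_mem hx)
    have hg' := fun x hx => hg x (Finset.mem_insert_of_mem hx)
    have ih := ih hf' hg'
    have hfa := hf a (Finset.mem_insert_self a s)
    have hpg : 0 ≤ ∏ x ∈ s, g x := Finset.prod_nonneg fun x hx => (hg' x hx).1
    have hpg1 : ∏ x ∈ s, g x ≤ 1 :=
      Finset.prod_le_one (fun x hx => (hg' x hx).1) fun x hx => (hg' x hx).2
    rw [Finset.prod_insert ha, Finset.prod_insert ha, Finset.sum_insert ha]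
    have e : f a * ∏ x ∈ s, f x - g a * ∏ x ∈ s, g x =
        (f a - g a) * ∏ x ∈ s, g x + f a * (∏ x ∈ s, f x - ∏ x ∈ s, g x) := by ring
    rw [e]
    refine (abs_add_le _ _).trans (add_le_add ?_ ?_)
    · rw [abs_mul, abs_of_nonneg hpg]
      exact mul_le_of_le_one_right (abs_nonneg _) hpg1
    · rw [abs_mul, abs_of_nonneg hfa.1]
      exact (mul_le_of_le_one_left (abs_nonneg _) hfa.2).trans ih

lemma abs_lagrange_sub_le (j : Fin d → Fin (2 ^ i + 1)) (x y : EuclideanSpace ℝ (Fin d)) :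
    |lagrange i j x - lagrange i j y| ≤ d * supDist x y / meshSize i := by
  have hH := meshSize_pos i
  refine (abs_prod_sub_prod_le _ _ _ (fun m _ => ⟨le_max_left _ _, hat_le_one _⟩)
    (fun m _ => ⟨le_max_left _ _, hat_le_one _⟩)).trans ?_
  calc _ ≤ ∑ _m : Fin d, supDist x y / meshSize i := by
        refine Finset.sum_le_sum fun m _ => ?_
        rw [max_comm 0, max_comm 0]
        refine (abs_max_sub_max_le_abs _ _ _).trans (le_trans ?_
          (div_le_div_of_nonneg_right (abs_apply_sub_le_supDist x y m) hH.le))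
        rw [sub_sub_sub_cancel_left, ← sub_div, abs_div, abs_of_pos hH]
        refine div_le_div_of_nonneg_right ((abs_abs_sub_abs_le_abs_sub _ _).trans ?_) hH.le
        rw [sub_sub_sub_cancel_right, abs_sub_comm]
    _ = _ := by simp [mul_div_assoc]

/-- The value is 1 at the node and the slope is at most d/H. It is applied within distance H/(4d) of
the node, where it yields 3/4. -/
lemma one_sub_le_lagrange (j : Fin d → Fin (2 ^ i + 1)) (z : EuclideanSpace ℝ (Fin d)) :
    1 - d * supDist z (meshNode i j) / meshSize i ≤ lagrange i j z := by
  have h := abs_lagrange_sub_le j (meshNode i j) z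
  have h1 : lagrange i j (meshNode i j) = 1 := by
    refine Finset.prod_eq_one fun m _ => ?_
    simp
  rw [h1, supDist_comm] at h
  linarith [le_abs_self (1 - lagrange i j z)]

/-- If a basis function does not vanish somewhere on a closed interval of the mesh then its node
is an end point of the interval. -/
lemma mesh_interval_endpoint {t j : ℕ} {h z : ℝ} (hh : 0 < h)
    (h1 : |z - ((t : ℝ) + 1 / 2) * h| ≤ h / 2) (h2 : |z - (j : ℝ) * h| < h) :
    j = t ∨ j = t + 1 := by
  rw [abs_le] at h1
  rw [abs_lt] at h2
  have h3 : (j : ℝ) < t + 2 := by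
    by_contra hc
    push Not at hc
    nlinarith
  have h4 : (t : ℝ) < j + 1 := by
    by_contra hc
    push Not at hc
    nlinarith
  have h5 : j < t + 2 := by exact_mod_cast h3
  have h6 : t < j + 1 := by exact_mod_cast h4
  omega

lemma endpoint_of_lagrange_ne_zero {t : Fin d → Fin (2 ^ i)} {j : Fin d → Fin (2 ^ i + 1)}
    {z : EuclideanSpace ℝ (Fin d)} (hz : z ∈ closure (element i t)) (h : lagrange i j z ≠ 0)
    (m : Fin d) : (j m : ℕ) = t m ∨ (j m : ℕ) = t m + 1 := by
  have h1 := mem_closure_element_iff.1 hz m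
  have h2 := (abs_apply_sub_le_supDist z _ m).trans_lt (supDist_lt_of_lagrange_ne_zero h)
  exact mesh_interval_endpoint (meshSize_pos i) h1 h2

lemma abs_meshNode_sub_center {t : Fin d → Fin (2 ^ i)} {j : Fin d → Fin (2 ^ i + 1)} {m : Fin d}
    (h : (j m : ℕ) = t m ∨ (j m : ℕ) = t m + 1) :
    |meshNode i j m - elementCenter i t m| = meshSize i / 2 := by
  have hH := meshSize_pos i
  rw [meshNode_apply, elementCenter_apply]
  rcases h with h | h
  · rw [h, abs_of_nonpos (by linarith)]
    ring
  · rw [h]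
    push_cast
    rw [abs_of_nonneg (by linarith)]
    ring

/-- A basis function whose node is not on `Γ` vanishes on `Γ`. -/
lemma lagrange_eq_zero_of_mem {Γ : Set (EuclideanSpace ℝ (Fin d))}
    (hΓ : IsUnionOfBoundaryFaces i Γ) {j : Fin d → Fin (2 ^ i + 1)} (hj : meshNode i j ∉ Γ)
    {z : EuclideanSpace ℝ (Fin d)} (hz : z ∈ Γ) : lagrange i j z = 0 := by
  by_contra hne
  obtain ⟨t, l, b, hb, ⟨hzt, hzl⟩, hsub⟩ := hΓ z hz
  have hH := meshSize_pos i
  have hn := two_pow_mul_meshSize i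
  -- If φ_j were nonzero at z, then y_j would be a vertex of the element t, and on the same face:
  -- z_l is a multiple of H, and the l-th hat of φ_j is nonzero there only if it is centred there.
  -- So y_j would lie in Γ.
  refine hj (hsub ⟨mem_closure_element fun m =>
    (abs_meshNode_sub_center (endpoint_of_lagrange_ne_zero hzt hne m)).le, ?_⟩)
  have h2 := abs_lt.1 ((abs_apply_sub_le_supDist z _ l).trans_lt
    (supDist_lt_of_lagrange_ne_zero hne))
  rw [meshNode_apply, hzl] at h2
  rw [meshNode_apply]
  have h3 : ((j l : ℕ) : ℝ) ≤ 2 ^ i := by exact_mod_cast Nat.lt_succ_iff.1 (j l).2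
  rcases hb with hb | hb
  · have : ((j l : ℕ) : ℝ) < 1 := by
      by_contra hc
      push Not at hc
      nlinarith
    have h4 : (j l : ℕ) = 0 := by
      have : (j l : ℕ) < 1 := by exact_mod_cast this
      omega
    rw [h4, hb]; simp
  · have : (2 : ℝ) ^ i < (j l : ℕ) + 1 := by
      by_contra hc
      push Not at hc
      nlinarith
    have h4 : (j l : ℕ) = 2 ^ i := by
      have h5 : 2 ^ i < (j l : ℕ) + 1 := by exact_mod_cast this
      have := (j l).2
      omega
    rw [h4, hb]
    push_cast
    exact hn

lemma nodeElement_eq (j : Fin d → Fin (2 ^ i + 1)) :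
    nodeElement i j = element i (elementIndex i (meshNode i j)) := by
  ext z
  constructor
  · rintro ⟨t, h1, h2⟩
    rwa [(mem_element_iff (meshNode_mem_unitCube j) t).1 h1]
  · intro h
    exact ⟨_, mem_element_elementIndex (meshNode_mem_unitCube j), h⟩

lemma supDist_meshNode_le_of_mem {j : Fin d → Fin (2 ^ i + 1)} {z : EuclideanSpace ℝ (Fin d)}
    (hz : z ∈ nodeElement i j) : supDist z (meshNode i j) ≤ meshSize i := by
  rw [nodeElement_eq] at hz
  have h1 := supDist_le_of_mem_element hz
  have h2 := supDist_le_of_mem_element (mem_element_elementIndex (i := i) (meshNode_mem_unitCube j))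
  have h3 := supDist_triangle z (elementCenter i (elementIndex i (meshNode i j))) (meshNode i j)
  rw [supDist_comm] at h2
  linarith

/-- At every vertex of an element there is a small box that lies in the element. -/
lemma exists_corner_box {t : Fin d → Fin (2 ^ i)} {j : Fin d → Fin (2 ^ i + 1)}
    (hj : ∀ m, (j m : ℕ) = t m ∨ (j m : ℕ) = t m + 1) {R : ℝ} (hR : 0 ≤ R)
    (hRH : R ≤ meshSize i / 2) :
    ∃ x : EuclideanSpace ℝ (Fin d), BoxInside R x ∧ box R x ⊆ element i t ∧
      ∀ z ∈ box R x, supDist z (meshNode i j) ≤ 2 * R := by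
  classical
  -- The centre is the vertex shifted by R into the element in every coordinate.
  let x : EuclideanSpace ℝ (Fin d) := WithLp.toLp 2 fun m =>
    if (j m : ℕ) = t m then meshNode i j m + R else meshNode i j m - R
  have hin := boxInside_elementCenter t
  have key : ∀ m, elementCenter i t m - meshSize i / 2 ≤ x m - R ∧
      x m + R ≤ elementCenter i t m + meshSize i / 2 := by
    intro m
    change elementCenter i t m - meshSize i / 2 ≤
        (if (j m : ℕ) = t m then meshNode i j m + R else meshNode i j m - R) - R ∧
      (if (j m : ℕ) = t m then meshNode i j m + R else meshNode i j m - R) + R ≤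
        elementCenter i t m + meshSize i / 2
    rw [meshNode_apply, elementCenter_apply]
    split_ifs with h
    · rw [h]; constructor <;> linarith
    · rw [(hj m).resolve_left h]
      push_cast
      constructor <;> linarith
  have hxy : ∀ m, |x m - meshNode i j m| ≤ R := by
    intro m
    change |(if (j m : ℕ) = t m then meshNode i j m + R else meshNode i j m - R) -
      meshNode i j m| ≤ R
    split_ifs <;> simp [abs_of_nonneg hR]
  refine ⟨x, fun m => ?_, fun z hz => ⟨hz.1, fun m => ?_⟩, fun z hz => ?_⟩
  · have h1 := key m
    have h2 := hin m
    constructor <;> linarith [h1.1, h1.2, h2.1, h2.2]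
  · have h1 := key m
    obtain ⟨h2, h3⟩ := hz.2 m
    change elementCenter i t m - meshSize i / 2 ≤ z m ∧
      (z m < elementCenter i t m + meshSize i / 2 ∨
        (z m = 1 ∧ z m ≤ elementCenter i t m + meshSize i / 2))
    refine ⟨by linarith [h1.1], ?_⟩
    rcases h3 with h3 | ⟨h3, h4⟩
    · exact Or.inl (by linarith [h1.2])
    · exact Or.inr ⟨h3, by linarith [h1.2]⟩
  · have h1 := supDist_le_of_mem_box hR hz
    have h2 := (supDist_le_iff hR).2 hxy
    linarith [supDist_triangle z x (meshNode i j)]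

end Mesh

/-! ### The Poincaré-type constant -/

/-- A function on a connected finite graph whose jumps along edges are at most `e` varies by at
most `e` times the number of vertices. -/
lemma SimpleGraph.Connected.abs_sub_le {α : Type*} [Fintype α] {Gr : SimpleGraph α}
    (h : Gr.Connected) {v : α → ℝ} {e : ℝ} (he : 0 ≤ e)
    (hv : ∀ a b, Gr.Adj a b → |v a - v b| ≤ e) (a b : α) :
    |v a - v b| ≤ Fintype.card α * e := by
  have hw : ∀ a b (p : Gr.Walk a b), |v a - v b| ≤ p.length * e := by
    intro a b p
    induction p with
    | nil => simp
    | cons hadj p ih =>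
      rw [SimpleGraph.Walk.length_cons]
      push_cast
      have := hv _ _ hadj
      exact (_root_.abs_sub_le _ _ _).trans (by linarith)
  obtain ⟨p, hp⟩ := (h a b).exists_isPath
  refine (hw a b p).trans (mul_le_mul_of_nonneg_right ?_ he)
  exact_mod_cast hp.length_lt.le

namespace SpatialNetwork

variable {d : ℕ} {G : SpatialNetwork d} {Γ : Set (EuclideanSpace ℝ (Fin d))} {R₀ ρ σ μ : ℝ}

lemma normMOn_le_of_abs_le {ω : Set (EuclideanSpace ℝ (Fin d))} {v : G.VHat} {b : ℝ}
    (hb : 0 ≤ b) (h : ∀ x : G.nodes, (x : EuclideanSpace ℝ (Fin d)) ∈ ω → |v x| ≤ b) :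
    G.normMOn ω v ≤ b * G.normMOn ω 1 := by
  unfold normMOn
  rw [← Real.sqrt_sq hb, ← Real.sqrt_mul (sq_nonneg b)]
  refine Real.sqrt_le_sqrt ?_
  rw [formM_eq, formM_eq, mul_sumOver]
  refine sumOver_le_sumOver fun x hx => ?_
  have h1 := sq_le_sq' (by linarith [abs_nonneg (v x), neg_abs_le (v x), h x hx])
    ((le_abs_self _).trans (h x hx))
  have h2 := G.mass_nonneg x
  simp only [Pi.one_apply]
  nlinarith

lemma le_normMOn_of_le_abs {ω : Set (EuclideanSpace ℝ (Fin d))} {v : G.VHat} {b : ℝ}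
    (hb : 0 ≤ b) (h : ∀ x : G.nodes, (x : EuclideanSpace ℝ (Fin d)) ∈ ω → b ≤ |v x|) :
    b * G.normMOn ω 1 ≤ G.normMOn ω v := by
  unfold normMOn
  rw [← Real.sqrt_sq hb, ← Real.sqrt_mul (sq_nonneg b)]
  refine Real.sqrt_le_sqrt ?_
  rw [formM_eq, formM_eq, mul_sumOver]
  refine sumOver_le_sumOver fun x hx => ?_
  have h1 : b ^ 2 ≤ v x ^ 2 := by
    rw [← sq_abs (v x)]
    exact pow_le_pow_left₀ hb (h x hx) 2
  have h2 := G.mass_nonneg x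
  simp only [Pi.one_apply]
  nlinarith

lemma boxInside_half : BoxInside (1 / 2) (WithLp.toLp 2 fun _ : Fin d => (1 / 2 : ℝ)) :=
  fun _ => ⟨by norm_num, by norm_num⟩

/-- The box of radius 1/2 is Ω, so homogeneity gives positive total mass and hence some edge; a
connected graph with at least two nodes has no isolated node. -/
lemma NetworkProperties.exists_adj (hG : G.NetworkProperties Γ R₀ ρ σ) (hR₀ : R₀ ≤ 1 / 2)
    (x : G.nodes) : ∃ y, G.graph.Adj x y := by
  have h := (hG.homogeneity (1 / 2) _ hR₀ boxInside_half).1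
  have hpos : 0 < G.formM (box (1 / 2) (WithLp.toLp 2 fun _ : Fin d => (1 / 2 : ℝ))) 1 1 := by
    rw [← normMOn_sq]
    have := hG.ρ_pos.trans_le h
    norm_num at this
    exact this
  have : ∃ a b, G.graph.Adj a b := by
    by_contra hc
    push Not at hc
    refine hpos.ne' ?_
    rw [formM_eq]
    refine sumOver_eq_zero fun a _ => ?_
    have : G.mass a = 0 := by
      unfold mass
      rw [sumOver_eq_zero fun y hy => absurd hy (hc a y), mul_zero]
    rw [this, zero_mul]
  obtain ⟨a, b, hab⟩ := this
  have : Nontrivial G.nodes := ⟨a, b, hab.ne⟩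
  exact G.connected.preconnected.exists_adj_of_nontrivial x

lemma dist_pos_of_adj {x y : G.nodes} (h : G.graph.Adj x y) :
    0 < dist (x : EuclideanSpace ℝ (Fin d)) y :=
  dist_pos.2 fun hxy => h.ne (Subtype.ext hxy)

lemma NetworkProperties.mass_pos (hG : G.NetworkProperties Γ R₀ ρ σ) (hR₀ : R₀ ≤ 1 / 2)
    (x : G.nodes) : 0 < G.mass x := by
  obtain ⟨y, hy⟩ := hG.exists_adj hR₀ x
  have := single_le_sumOver (p := fun y => G.graph.Adj x y)
    (F := fun y => dist (x : EuclideanSpace ℝ (Fin d)) y) (fun _ _ => dist_nonneg) hy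
  have h2 := dist_pos_of_adj hy
  unfold mass
  linarith

/-- A single term of the energy at a already gives (v(a) - v(b))² ≤ 2|a-b| (L_a v, v); edges are
shorter than R₀. -/
lemma NetworkProperties.abs_sub_le_of_adj (hG : G.NetworkProperties Γ R₀ ρ σ)
    {ω : Set (EuclideanSpace ℝ (Fin d))} (v : G.VHat) {a b : G.nodes} (hab : G.graph.Adj a b)
    (ha : (a : EuclideanSpace ℝ (Fin d)) ∈ ω) :
    |v a - v b| ≤ √(2 * R₀) * G.normLOn ω v := by
  have h1 : G.nodeL v a ≤ G.quadL ω v :=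
    single_le_sumOver (p := fun x : G.nodes => (x : EuclideanSpace ℝ (Fin d)) ∈ ω)
      (fun x _ => G.nodeL_nonneg v x) ha
  have h2 : (v a - v b) ^ 2 / dist (a : EuclideanSpace ℝ (Fin d)) b ≤ 2 * G.nodeL v a := by
    have := single_le_sumOver (p := fun y => G.graph.Adj a y)
      (F := fun y => (v a - v y) ^ 2 / dist (a : EuclideanSpace ℝ (Fin d)) y)
      (fun _ _ => div_nonneg (sq_nonneg _) dist_nonneg) hab
    unfold nodeL
    linarith
  have h3 := dist_pos_of_adj hab
  have h4 := hG.locality a b hab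
  unfold normLOn
  rw [← Real.sqrt_mul (by linarith [hG.R₀_pos])]
  refine Real.abs_le_sqrt ?_
  rw [div_le_iff₀ h3] at h2
  have h5 := G.nodeL_nonneg v a
  have h6 := hG.R₀_pos
  nlinarith

lemma abs_sub_le_of_subgraph {S : G.graph.Subgraph} (hS : S.Connected) {v : G.VHat} {e : ℝ}
    (he : 0 ≤ e) (hv : ∀ a b, S.Adj a b → |v a - v b| ≤ e) {a b : G.nodes}
    (ha : a ∈ S.verts) (hb : b ∈ S.verts) : |v a - v b| ≤ Fintype.card G.nodes * e := by
  classical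
  have h := hS.coe.abs_sub_le (v := fun x => v x) he
    (fun a b hab => hv a b hab) ⟨a, ha⟩ ⟨b, hb⟩
  refine h.trans (mul_le_mul_of_nonneg_right ?_ he)
  exact_mod_cast Fintype.card_le_of_injective _ Subtype.val_injective

/-- The point is the centre of a face of the box on ∂Ω, so boundary density puts a node of Γ into
the box. The half-open convention does no harm: in directions other than l the inequalities are
strict, and in direction l the upper face that may be touched belongs to Ω and is closed. -/
lemma mem_box_of_dist_center_face {R : ℝ} {x z : EuclideanSpace ℝ (Fin d)} (hx : BoxInside R x)
    (hR₀ : R₀ ≤ R) {l : Fin d} {b : ℝ} (hb : b = 0 ∨ b = 1) (hbl : |b - x l| ≤ R)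
    (hz : z ∈ unitCube d) (hd : dist z (WithLp.toLp 2 (Function.update x.ofLp l b)) < R₀) :
    z ∈ box R x := by
  refine ⟨hz, fun m => ?_⟩
  have h1 := abs_lt.1 ((abs_apply_sub_le_dist z _ m).trans_lt hd)
  have h2 := hx m
  have h3 := hz m
  by_cases hm : m = l
  · subst hm
    simp only [Function.update_self] at h1
    rw [abs_le] at hbl
    rcases hb with rfl | rfl
    · exact ⟨by linarith, Or.inl (by linarith)⟩
    · refine ⟨by linarith, ?_⟩
      rcases eq_or_lt_of_le h3.2 with h4 | h4
      · exact Or.inr ⟨h4, by linarith⟩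
      · exact Or.inl (by linarith)
  · simp only [Function.update_of_ne hm] at h1
    exact ⟨by linarith, Or.inl (by linarith)⟩

/-- The set of admissible Poincaré constants of a network is not empty. -/
lemma NetworkProperties.exists_isPoincareBound (hG : G.NetworkProperties Γ R₀ ρ σ)
    (hR₀ : R₀ ≤ 1 / 2) (hΓ : Γ.Nonempty) : ∃ ν, 0 ≤ ν ∧ G.IsPoincareBound Γ R₀ ν := by
  have hR₀p := hG.R₀_pos
  set n : ℝ := (Fintype.card G.nodes : ℝ) with hn
  -- A crude constant that depends on the network: two values of v on a connected subgraph differ by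
  -- at most the number of nodes times √(2R₀) times the local energy norm. Only existence matters,
  -- because the real infimum of an empty set is 0 and would make a bound on `poincareConst`
  -- meaningless.
  set κ : ℝ := n * √(2 * R₀) * G.normM 1 with hκ
  have hM0 : 0 ≤ G.normM 1 := Real.sqrt_nonneg _
  have hκ0 : 0 ≤ κ := by positivity
  have hbox : ∀ (R : ℝ) (x : EuclideanSpace ℝ (Fin d)), R₀ ≤ R → BoxInside R x →
      ∀ (v : G.VHat), ∃ S : Set G.nodes, S.Nonempty ∧
        (∀ a : G.nodes, (a : EuclideanSpace ℝ (Fin d)) ∈ box R x → a ∈ S) ∧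
        ∀ a ∈ S, G.normMOn (box R x) (fun y => v y - v a) ≤
          κ / R₀ * R * G.normLOn (box (R + R₀) x) v := by
    intro R x hR hx v
    obtain ⟨S, hS, hS1, hS2⟩ := hG.connectivity R x hR hx
    set e := √(2 * R₀) * G.normLOn (box (R + R₀) x) v with he
    have he0 : 0 ≤ e := mul_nonneg (Real.sqrt_nonneg _) (Real.sqrt_nonneg _)
    have hmem : ∀ a : G.nodes, (a : EuclideanSpace ℝ (Fin d)) ∈ box R x → a ∈ S.verts := by
      intro a ha
      obtain ⟨b, hab⟩ := hG.exists_adj hR₀ a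
      exact (hS1 a b hab (Or.inl ha)).fst_mem
    refine ⟨S.verts, hS.nonempty, hmem, fun a ha => ?_⟩
    have h1 : ∀ y : G.nodes, (y : EuclideanSpace ℝ (Fin d)) ∈ box R x →
        |v y - v a| ≤ n * e := fun y hy =>
      abs_sub_le_of_subgraph hS he0
        (fun p q hpq => hG.abs_sub_le_of_adj v hpq.adj_sub (hS2 p q hpq).1) (hmem y hy) ha
    calc G.normMOn (box R x) (fun y => v y - v a) ≤ n * e * G.normMOn (box R x) 1 :=
          normMOn_le_of_abs_le (by positivity) h1
      _ ≤ n * e * G.normM 1 :=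
          mul_le_mul_of_nonneg_left (G.normMOn_mono (box_subset_unitCube _ _) 1) (by positivity)
      _ = κ * G.normLOn (box (R + R₀) x) v := by rw [he, hκ]; ring
      _ ≤ κ / R₀ * R * G.normLOn (box (R + R₀) x) v := by
          refine mul_le_mul_of_nonneg_right ?_ (Real.sqrt_nonneg _)
          rw [div_mul_eq_mul_div, le_div_iff₀ hR₀p]
          exact mul_le_mul_of_nonneg_left hR hκ0
  have hle : κ / R₀ ≤ κ / R₀ + κ := by linarith
  have hmono : ∀ (R : ℝ) (x : EuclideanSpace ℝ (Fin d)) (v : G.VHat), R₀ ≤ R →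
      κ / R₀ * R * G.normLOn (box (R + R₀) x) v ≤
        (κ / R₀ + κ) * R * G.normLOn (box (R + R₀) x) v := by
    intro R x v hR
    exact mul_le_mul_of_nonneg_right (mul_le_mul_of_nonneg_right hle (by linarith))
      (Real.sqrt_nonneg _)
  -- The summand κ/R₀ serves the boxes, where the right-hand side carries a factor R ≥ R₀; the
  -- summand κ serves the global Friedrichs inequality.
  refine ⟨κ / R₀ + κ, by positivity, ?_, ?_, ?_⟩
  · intro R x hR hx v
    obtain ⟨S, ⟨a, ha⟩, -, h⟩ := hbox R x hR hx v
    exact ⟨v a, (h a ha).trans (hmono R x v hR)⟩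
  · rintro R x hR hx ⟨l, b, hb, hbl, hsub⟩ v hv
    obtain ⟨S, -, hS, h⟩ := hbox R x hR hx v
    have hy : (WithLp.toLp 2 (Function.update x.ofLp l b) : EuclideanSpace ℝ (Fin d)) ∈ Γ := by
      refine hsub ⟨fun m => ?_, by simp⟩
      by_cases hm : m = l
      · subst hm; simpa using hbl
      · simp [Function.update_of_ne hm]; linarith
    obtain ⟨z, hzΓ, hz⟩ := hG.boundary_density _ hy
    have hzb := mem_box_of_dist_center_face hx hR hb hbl (G.nodes_subset z z.2) hz
    have := h z (hS z hzb)
    rw [hv z hzΓ] at this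
    simp only [sub_zero] at this
    exact this.trans (hmono R x v hR)
  · intro v hv
    obtain ⟨y, hy⟩ := hΓ
    obtain ⟨z, hzΓ, -⟩ := hG.boundary_density y hy
    set e := √(2 * R₀) * G.normL v with he
    have he0 : 0 ≤ e := mul_nonneg (Real.sqrt_nonneg _) (Real.sqrt_nonneg _)
    have h1 : ∀ x : G.nodes, |v x| ≤ n * e := by
      intro x
      have := G.connected.abs_sub_le (v := v) he0
        (fun a b hab => hG.abs_sub_le_of_adj v hab (G.nodes_subset a a.2)) x z
      rwa [hv z hzΓ, sub_zero] at this
    calc G.normM v ≤ n * e * G.normM 1 := normMOn_le_of_abs_le (by positivity) fun x _ => h1 x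
      _ = κ * G.normL v := by rw [he, hκ]; ring
      _ ≤ (κ / R₀ + κ) * G.normL v :=
          mul_le_mul_of_nonneg_right (by linarith [div_nonneg hκ0 hR₀p.le]) (Real.sqrt_nonneg _)

lemma IsPoincareBound.mono {ν : ℝ} (h : G.IsPoincareBound Γ R₀ ν) (hR₀ : 0 < R₀) (hνμ : ν ≤ μ) :
    G.IsPoincareBound Γ R₀ μ := by
  have hmono : ∀ (R : ℝ) (x : EuclideanSpace ℝ (Fin d)) (v : G.VHat), R₀ ≤ R →
      ν * R * G.normLOn (box (R + R₀) x) v ≤ μ * R * G.normLOn (box (R + R₀) x) v := by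
    intro R x v hR
    exact mul_le_mul_of_nonneg_right (mul_le_mul_of_nonneg_right hνμ (by linarith))
      (Real.sqrt_nonneg _)
  refine ⟨fun R x hR hx v => ?_, fun R x hR hx hf v hv => ?_, fun v hv => ?_⟩
  · obtain ⟨c, hc⟩ := h.1 R x hR hx v
    exact ⟨c, hc.trans (hmono R x v hR)⟩
  · exact (h.2.1 R x hR hx hf v hv).trans (hmono R x v hR)
  · exact (h.2.2 v hv).trans (mul_le_mul_of_nonneg_right hνμ (Real.sqrt_nonneg _))

/-- |μ| + 1 lies strictly above the infimum, so some admissible constant is below it and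
admissibility is monotone. This avoids asking whether the infimum is attained. -/
lemma NetworkProperties.isPoincareBound (hG : G.NetworkProperties Γ R₀ ρ σ)
    (hR₀ : R₀ ≤ 1 / 2) (hΓ : Γ.Nonempty) (hμ : G.poincareConst Γ R₀ ≤ μ) :
    G.IsPoincareBound Γ R₀ (|μ| + 1) := by
  obtain ⟨ν, hν, hlt⟩ := exists_lt_of_csInf_lt (hG.exists_isPoincareBound hR₀ hΓ)
    (lt_of_le_of_lt (hμ.trans (le_abs_self μ)) (lt_add_one |μ|))
  exact hν.2.mono hG.R₀_pos hlt.le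

end SpatialNetwork

namespace SpatialNetwork

variable {d : ℕ}

/-- A network with the network properties and Poincaré constant at most `ν`, together with a mesh
that resolves the Dirichlet boundary and is not finer than the network. -/
structure IsAdmissible (G : SpatialNetwork d) (Γ : Set (EuclideanSpace ℝ (Fin d)))
    (R₀ ρ σ ν : ℝ) (i : ℕ) : Prop where
  one_le_dim : 1 ≤ d
  props : G.NetworkProperties Γ R₀ ρ σ
  poincare : G.IsPoincareBound Γ R₀ ν
  nonneg : 0 ≤ ν
  faces : IsUnionOfBoundaryFaces i Γ
  mesh : 8 * d * R₀ ≤ meshSize i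

variable {G : SpatialNetwork d} {Γ : Set (EuclideanSpace ℝ (Fin d))} {R₀ ρ σ ν : ℝ} {i : ℕ}

namespace IsAdmissible

lemma one_le_cast (h : G.IsAdmissible Γ R₀ ρ σ ν i) : (1 : ℝ) ≤ d := by
  exact_mod_cast h.one_le_dim

lemma R₀_le (h : G.IsAdmissible Γ R₀ ρ σ ν i) : R₀ ≤ meshSize i / 8 := by
  have h1 := h.mesh
  have h2 := h.one_le_cast
  have h3 := h.props.R₀_pos
  nlinarith

lemma R₀_le_half (h : G.IsAdmissible Γ R₀ ρ σ ν i) : R₀ ≤ 1 / 2 := by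
  have := h.R₀_le
  have := meshSize_le_one i
  linarith

lemma supDist_lt_of_adj (h : G.IsAdmissible Γ R₀ ρ σ ν i) {x y : G.nodes}
    (hxy : G.graph.Adj x y) :
    supDist (x : EuclideanSpace ℝ (Fin d)) y < meshSize i / 8 :=
  ((supDist_le_dist _ _).trans_lt (h.props.locality x y hxy)).trans_le h.R₀_le

lemma mass_pos (h : G.IsAdmissible Γ R₀ ρ σ ν i) (x : G.nodes) : 0 < G.mass x :=
  h.props.mass_pos h.R₀_le_half x

lemma one_le_σ (h : G.IsAdmissible Γ R₀ ρ σ ν i) : 1 ≤ σ := by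
  obtain ⟨h1, h2⟩ := h.props.homogeneity (1 / 2) _ h.R₀_le_half boxInside_half
  have h3 := h1.trans h2
  have h4 := h.props.ρ_pos
  nlinarith

end IsAdmissible

/-! ### The dual basis -/

/-- The mesh node `j` is a vertex of the element `t`. -/
def IsVertex (t : Fin d → Fin (2 ^ i)) (j : Fin d → Fin (2 ^ i + 1)) : Prop :=
  ∀ m, (j m : ℕ) = t m ∨ (j m : ℕ) = t m + 1

/-- The lower bound `ρ (H / (4d))^d` of the mass of a box at the vertex of an element. -/
noncomputable def cornerMass (d : ℕ) (ρ : ℝ) (i : ℕ) : ℝ := ρ * (meshSize i / (4 * d)) ^ d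

lemma isVertex_of_lagrange_ne_zero {t : Fin d → Fin (2 ^ i)} {j : Fin d → Fin (2 ^ i + 1)}
    {z : EuclideanSpace ℝ (Fin d)} (hz : z ∈ element i t) (h : lagrange i j z ≠ 0) :
    IsVertex t j := endpoint_of_lagrange_ne_zero (subset_closure hz) h

lemma isVertex_elementIndex (j : Fin d → Fin (2 ^ i + 1)) :
    IsVertex (elementIndex i (meshNode i j)) j := by
  refine isVertex_of_lagrange_ne_zero (mem_element_elementIndex (meshNode_mem_unitCube j)) ?_
  have := one_sub_le_lagrange j (meshNode i j)
  have h0 : supDist (meshNode i j) (meshNode i j) = 0 := dist_self _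
  rw [h0] at this
  simp only [mul_zero, zero_div, sub_zero] at this
  linarith

/-- The coarse function with given nodal values. -/
noncomputable def coarse (G : SpatialNetwork d) (i : ℕ) :
    ((Fin d → Fin (2 ^ i + 1)) → ℝ) →ₗ[ℝ] G.VHat :=
  Fintype.linearCombination ℝ (G.basisFun i)

lemma coarse_apply (a : (Fin d → Fin (2 ^ i + 1)) → ℝ) (x : G.nodes) :
    G.coarse i a x = ∑ j, a j * lagrange i j (x : EuclideanSpace ℝ (Fin d)) := by
  simp [coarse, Fintype.linearCombination_apply, basisFun]

lemma coarse_single (j : Fin d → Fin (2 ^ i + 1)) [DecidableEq (Fin d → Fin (2 ^ i + 1))] :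
    G.coarse i (Pi.single j 1) = G.basisFun i j := by
  simp [coarse]

lemma sum_lagrange_node (x : G.nodes) :
    ∑ j, lagrange i j (x : EuclideanSpace ℝ (Fin d)) = 1 := sum_lagrange (G.nodes_subset x x.2)

lemma coarse_sub_const (a : (Fin d → Fin (2 ^ i + 1)) → ℝ) (c : ℝ) (x : G.nodes) :
    G.coarse i a x - c = ∑ j, (a j - c) * lagrange i j (x : EuclideanSpace ℝ (Fin d)) := by
  simp only [sub_mul, Finset.sum_sub_distrib, ← Finset.mul_sum, sum_lagrange_node, mul_one,
    coarse_apply]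

namespace IsAdmissible

lemma cornerMass_pos (h : G.IsAdmissible Γ R₀ ρ σ ν i) : 0 < cornerMass d ρ i := by
  have h1 := h.one_le_cast
  have h2 := meshSize_pos i
  have h3 := h.props.ρ_pos
  unfold cornerMass
  positivity

/-- Coarse functions are controlled by their nodal values on an element. -/
lemma coarse_lower_bound (h : G.IsAdmissible Γ R₀ ρ σ ν i) {t : Fin d → Fin (2 ^ i)}
    (a : (Fin d → Fin (2 ^ i + 1)) → ℝ) {l : Fin d → Fin (2 ^ i + 1)} (hl : IsVertex t l)
    (hmax : ∀ j, IsVertex t j → |a j| ≤ |a l|) :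
    |a l| / 2 * √(cornerMass d ρ i) ≤ G.normMOn (element i t) (G.coarse i a) := by
  have hd := h.one_le_cast
  have hH := meshSize_pos i
  have hd0 : (0 : ℝ) < d := by linarith
  -- R ≥ R₀ by the mesh condition, so homogeneity applies to the corner box. Its points are within
  -- 2R of the vertex, so φ_l ≥ 1 - d·2R/H = 3/4 on it.
  set R := meshSize i / (8 * d) with hR
  have hR0 : 0 < R := by positivity
  have hRle : R₀ ≤ R := by
    rw [hR, le_div_iff₀ (by positivity)]
    linarith [h.mesh]
  have hRH : R ≤ meshSize i / 2 := by
    rw [hR]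
    exact div_le_div_of_nonneg_left hH.le (by norm_num) (by linarith)
  obtain ⟨x, hx, hsub, hdist⟩ := exists_corner_box hl hR0.le hRH
  have hmass : √(cornerMass d ρ i) ≤ G.normMOn (box R x) 1 := by
    refine Real.sqrt_le_iff.2 ⟨Real.sqrt_nonneg _, ?_⟩
    have h1 := (h.props.homogeneity R x hRle hx).1
    rw [le_div_iff₀ (by positivity)] at h1
    have h2 : 2 * R = meshSize i / (4 * d) := by rw [hR]; field_simp; ring
    rw [h2] at h1
    exact h1
  have hval : ∀ z : G.nodes, (z : EuclideanSpace ℝ (Fin d)) ∈ box R x →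
      |a l| / 2 ≤ |G.coarse i a z| := by
    intro z hz
    have hφ : 3 / 4 ≤ lagrange i l z := by
      have h1 := one_sub_le_lagrange l (z : EuclideanSpace ℝ (Fin d))
      have h2 : d * supDist (z : EuclideanSpace ℝ (Fin d)) (meshNode i l) / meshSize i ≤ 1 / 4 := by
        rw [div_le_iff₀ hH]
        have h3 := mul_le_mul_of_nonneg_left (hdist z hz) hd0.le
        have h4 : (d : ℝ) * (2 * R) = 1 / 4 * meshSize i := by rw [hR]; field_simp; ring
        linarith
      linarith
    -- The deviation from a_l is an average with total weight 1 - φ_l ≤ 1/4 of differences a_j -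
    -- a_l, each at most 2|a_l| by maximality among the vertices.
    have h1 : |G.coarse i a z - a l| ≤ |a l| / 2 := by
      rw [coarse_sub_const]
      calc |∑ j, (a j - a l) * lagrange i j (z : EuclideanSpace ℝ (Fin d))|
          ≤ ∑ j, |(a j - a l) * lagrange i j (z : EuclideanSpace ℝ (Fin d))| :=
            Finset.abs_sum_le_sum_abs _ _
        _ ≤ ∑ j, (2 * |a l| * lagrange i j (z : EuclideanSpace ℝ (Fin d)) -
              if j = l then 2 * |a l| * lagrange i l (z : EuclideanSpace ℝ (Fin d)) else 0) := by
            refine Finset.sum_le_sum fun j _ => ?_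
            split_ifs with hj
            · subst hj; simp
            · rw [sub_zero, abs_mul, abs_of_nonneg (lagrange_nonneg j _)]
              by_cases h0 : lagrange i j (z : EuclideanSpace ℝ (Fin d)) = 0
              · simp [h0]
              · refine mul_le_mul_of_nonneg_right ?_ (lagrange_nonneg j _)
                have := hmax j (isVertex_of_lagrange_ne_zero (hsub hz) h0)
                have h3 := abs_sub (a j) (a l)
                linarith
        _ = 2 * |a l| * (1 - lagrange i l (z : EuclideanSpace ℝ (Fin d))) := by
            rw [Finset.sum_sub_distrib, ← Finset.mul_sum, sum_lagrange_node]
            simp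
            ring
        _ ≤ |a l| / 2 := by nlinarith [abs_nonneg (a l)]
    have h2 := abs_sub_abs_le_abs_sub (a l) (G.coarse i a z)
    rw [abs_sub_comm] at h2
    linarith
  calc |a l| / 2 * √(cornerMass d ρ i) ≤ |a l| / 2 * G.normMOn (box R x) 1 :=
        mul_le_mul_of_nonneg_left hmass (by positivity)
    _ ≤ G.normMOn (box R x) (G.coarse i a) := le_normMOn_of_le_abs (by positivity) hval
    _ ≤ _ := G.normMOn_mono hsub _

lemma exists_max_vertex (a : (Fin d → Fin (2 ^ i + 1)) → ℝ) (t : Fin d → Fin (2 ^ i)) :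
    ∃ l, IsVertex t l ∧ ∀ j, IsVertex t j → |a j| ≤ |a l| := by
  classical
  have hne : (Finset.univ.filter (IsVertex t)).Nonempty := by
    refine ⟨fun m => (t m).castSucc, ?_⟩
    simp [IsVertex]
  obtain ⟨l, hl, hmax⟩ := Finset.exists_max_image _ (fun j => |a j|) hne
  exact ⟨l, (Finset.mem_filter.1 hl).2, fun j hj => hmax j (by simp [hj])⟩

lemma basisFun_eq_zero_of_not_isVertex {t : Fin d → Fin (2 ^ i)} {j : Fin d → Fin (2 ^ i + 1)}
    (hj : ¬ IsVertex t j) {x : G.nodes} (hx : (x : EuclideanSpace ℝ (Fin d)) ∈ element i t) :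
    G.basisFun i j x = 0 := by
  by_contra hne
  exact hj (isVertex_of_lagrange_ne_zero hx hne)

-- The dual function is chosen by `epsilon`, so a witness is needed. By `coarse_lower_bound` the
-- mass form of T_j is definite on nodal values supported at the vertices of T_j; solving there for
-- the functional a ↦ a_j gives it. The other basis functions vanish on T_j, so their conditions
-- hold automatically.
open scoped Classical in
lemma dualFun_spec (h : G.IsAdmissible Γ R₀ ρ σ ν i) (j : Fin d → Fin (2 ^ i + 1)) :
    G.dualFun i j ∈ G.VHatH i ∧
      ∀ l, G.formM (nodeElement i j) (G.dualFun i j) (G.basisFun i l) = if j = l then 1 else 0 := by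
  refine Classical.epsilon_spec (p := fun ψ => ψ ∈ G.VHatH i ∧
    ∀ l, G.formM (nodeElement i j) ψ (G.basisFun i l) = if j = l then 1 else 0) ?_
  set t := elementIndex i (meshNode i j) with ht
  let S : Submodule ℝ ((Fin d → Fin (2 ^ i + 1)) → ℝ) :=
    { carrier := {a | ∀ l, ¬ IsVertex t l → a l = 0}
      add_mem' := fun ha hb l hl => by simp [ha l hl, hb l hl]
      zero_mem' := fun l _ => rfl
      smul_mem' := fun c a ha l hl => by simp [ha l hl] }
  obtain ⟨r, -, hr⟩ := IsPSDForm.exists_solution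
    ((G.bilinM (element i t)).compl₁₂ (G.coarse i) (G.coarse i)) S (by
      intro a ha h0
      obtain ⟨l, hl, hmax⟩ := exists_max_vertex a t
      have h1 := h.coarse_lower_bound a hl hmax
      have h2 : G.normMOn (element i t) (G.coarse i a) = 0 := by
        rw [normMOn, Real.sqrt_eq_zero (G.formM_self_nonneg _ _)]
        exact h0
      have h3 : |a l| = 0 := by
        have := Real.sqrt_pos.2 h.cornerMass_pos
        have h4 := abs_nonneg (a l)
        rw [h2] at h1
        nlinarith
      funext j
      by_cases hj : IsVertex t j
      · have := hmax j hj
        rw [h3] at this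
        exact abs_eq_zero.1 (le_antisymm this (abs_nonneg _))
      · exact ha j hj) (LinearMap.proj j)
  refine ⟨G.coarse i r, ?_, fun l => ?_⟩
  · rw [coarse, Fintype.linearCombination_apply]
    exact Submodule.sum_mem _ fun l _ => Submodule.smul_mem _ _
      (Submodule.subset_span (Set.mem_range_self l))
  · rw [nodeElement_eq, ← ht]
    by_cases hl : IsVertex t l
    · have := hr (Pi.single l 1) (by
        intro l' hl'
        exact Pi.single_eq_of_ne (fun he : l' = l => hl' (by rw [he]; exact hl)) _)
      rw [LinearMap.compl₁₂_apply, coarse_single, bilinM_apply] at this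
      rw [this, LinearMap.proj_apply, Pi.single_apply]
    · rw [if_neg, formM_eq]
      · refine sumOver_eq_zero fun x hx => ?_
        rw [basisFun_eq_zero_of_not_isVertex hl hx]
        ring
      · rintro rfl
        exact hl (isVertex_elementIndex j)

end IsAdmissible

/-- The dual functional `v ↦ (M_{T_j} ψ_j, v)`. -/
noncomputable def dualCoeff (G : SpatialNetwork d) (i : ℕ) (j : Fin d → Fin (2 ^ i + 1)) :
    G.VHat →ₗ[ℝ] ℝ := G.bilinM (nodeElement i j) (G.dualFun i j)

lemma dualCoeff_apply (j : Fin d → Fin (2 ^ i + 1)) (v : G.VHat) :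
    G.dualCoeff i j v = G.formM (nodeElement i j) (G.dualFun i j) v := rfl

lemma dualCoeff_congr {j : Fin d → Fin (2 ^ i + 1)} {u v : G.VHat}
    (h : ∀ x : G.nodes, (x : EuclideanSpace ℝ (Fin d)) ∈ nodeElement i j → u x = v x) :
    G.dualCoeff i j u = G.dualCoeff i j v := by
  rw [dualCoeff_apply, dualCoeff_apply, formM_eq, formM_eq]
  exact sumOver_congr fun x hx => by rw [h x hx]

namespace IsAdmissible

open scoped Classical in
lemma dualCoeff_basisFun (h : G.IsAdmissible Γ R₀ ρ σ ν i) (j l : Fin d → Fin (2 ^ i + 1)) :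
    G.dualCoeff i j (G.basisFun i l) = if j = l then 1 else 0 := (h.dualFun_spec j).2 l

lemma dualCoeff_coarse (h : G.IsAdmissible Γ R₀ ρ σ ν i) (j : Fin d → Fin (2 ^ i + 1))
    (a : (Fin d → Fin (2 ^ i + 1)) → ℝ) : G.dualCoeff i j (G.coarse i a) = a j := by
  classical
  rw [coarse, Fintype.linearCombination_apply, map_sum]
  simp only [map_smul, h.dualCoeff_basisFun, smul_eq_mul, mul_ite, mul_one, mul_zero,
    Finset.sum_ite_eq, Finset.mem_univ, if_true]

lemma dualCoeff_const (h : G.IsAdmissible Γ R₀ ρ σ ν i) (j : Fin d → Fin (2 ^ i + 1)) (c : ℝ) :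
    G.dualCoeff i j (fun _ => c) = c := by
  have : (fun _ => c : G.VHat) = G.coarse i fun _ => c := by
    funext x
    rw [coarse_apply, ← Finset.mul_sum, sum_lagrange_node, mul_one]
  rw [this, h.dualCoeff_coarse]

/-- If ψ_j = Σ a_l φ_l, duality gives |ψ_j|² = a_j on T_j. The largest vertex value of ψ_j is at
most 2|ψ_j|/√`cornerMass`, so one factor |ψ_j| cancels. -/
lemma normMOn_dualFun_le (h : G.IsAdmissible Γ R₀ ρ σ ν i) (j : Fin d → Fin (2 ^ i + 1)) :
    G.normMOn (nodeElement i j) (G.dualFun i j) ≤ 2 / √(cornerMass d ρ i) := by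
  classical
  obtain ⟨a, ha⟩ := (Submodule.mem_span_range_iff_exists_fun ℝ).1 (h.dualFun_spec j).1
  have ha' : G.dualFun i j = G.coarse i a := by
    rw [coarse, Fintype.linearCombination_apply, ha]
  have hpos := Real.sqrt_pos.2 h.cornerMass_pos
  have h1 : G.formM (nodeElement i j) (G.dualFun i j) (G.dualFun i j) = a j := by
    rw [← dualCoeff_apply]
    conv_lhs => rw [ha']
    exact h.dualCoeff_coarse j a
  refine (G.isPSDForm_bilinM (nodeElement i j)).energyNorm_le_of_apply_le (by positivity) ?_
  rw [bilinM_apply, h1, ← normMOn_eq]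
  obtain ⟨l, hl, hmax⟩ := IsAdmissible.exists_max_vertex a (elementIndex i (meshNode i j))
  have h2 := h.coarse_lower_bound a hl hmax
  rw [← nodeElement_eq, ← ha'] at h2
  have h3 := (le_abs_self (a j)).trans (hmax j (isVertex_elementIndex j))
  rw [div_mul_eq_mul_div, le_div_iff₀ hpos]
  nlinarith

lemma abs_dualCoeff_le (h : G.IsAdmissible Γ R₀ ρ σ ν i) (j : Fin d → Fin (2 ^ i + 1))
    (v : G.VHat) : |G.dualCoeff i j v| ≤
      2 / √(cornerMass d ρ i) * G.normMOn (nodeElement i j) v :=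
  ((G.isPSDForm_bilinM (nodeElement i j)).abs_apply_le _ _).trans
    (mul_le_mul_of_nonneg_right (h.normMOn_dualFun_le j) (Real.sqrt_nonneg _))

end IsAdmissible

/-! ### The interpolation operator -/

open scoped Classical in
/-- The nodal values of the interpolant. -/
noncomputable def interpCoeff (G : SpatialNetwork d) (Γ : Set (EuclideanSpace ℝ (Fin d))) (i : ℕ)
    (v : G.VHat) (j : Fin d → Fin (2 ^ i + 1)) : ℝ :=
  if meshNode i j ∈ Γ then 0 else G.dualCoeff i j v

lemma interp_eq_coarse (v : G.VHat) : G.interp Γ i v = G.coarse i (G.interpCoeff Γ i v) := by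
  classical
  rw [interp, coarse, Fintype.linearCombination_apply, Finset.sum_filter]
  refine Finset.sum_congr rfl fun j _ => ?_
  unfold interpCoeff
  split_ifs <;> simp_all [dualCoeff_apply]

/-- The interpolation operator as a linear map. -/
noncomputable def interpLin (G : SpatialNetwork d) (Γ : Set (EuclideanSpace ℝ (Fin d))) (i : ℕ) :
    G.VHat →ₗ[ℝ] G.VHat where
  toFun := G.interp Γ i
  map_add' u v := by
    rw [interp_eq_coarse, interp_eq_coarse, interp_eq_coarse, ← map_add]
    congr 1
    funext j
    simp only [interpCoeff, Pi.add_apply, map_add]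
    split_ifs <;> simp
  map_smul' c v := by
    rw [interp_eq_coarse, interp_eq_coarse, RingHom.id_apply, ← map_smul]
    congr 1
    funext j
    simp only [interpCoeff, Pi.smul_apply, map_smul]
    split_ifs <;> simp

lemma interpLin_apply (v : G.VHat) : G.interpLin Γ i v = G.interp Γ i v := rfl

lemma interp_mem_VH (v : G.VHat) : G.interp Γ i v ∈ G.VH Γ i := by
  classical
  refine Submodule.sum_mem _ fun j hj => Submodule.smul_mem _ _ (Submodule.subset_span ?_)
  exact ⟨j, (Finset.mem_filter.1 hj).2, rfl⟩

namespace IsAdmissible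

lemma VH_le_V (h : G.IsAdmissible Γ R₀ ρ σ ν i) : G.VH Γ i ≤ G.V Γ := by
  refine Submodule.span_le.2 ?_
  rintro _ ⟨j, hj, rfl⟩ x hx
  exact lagrange_eq_zero_of_mem h.faces hj hx

lemma interp_mem_V (h : G.IsAdmissible Γ R₀ ρ σ ν i) (v : G.VHat) : G.interp Γ i v ∈ G.V Γ :=
  h.VH_le_V (interp_mem_VH v)

/-- Biorthogonality, checked on the basis functions off Γ. So I is a projection onto V_H, which is
what puts v - Iv into W for every v in V. -/
lemma interp_of_mem_VH (h : G.IsAdmissible Γ R₀ ρ σ ν i) {v : G.VHat} (hv : v ∈ G.VH Γ i) :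
    G.interp Γ i v = v := by
  classical
  rw [← interpLin_apply]
  have : G.VH Γ i ≤ LinearMap.eqLocus (G.interpLin Γ i) LinearMap.id := by
    refine Submodule.span_le.2 ?_
    rintro _ ⟨j, hj, rfl⟩
    rw [SetLike.mem_coe, LinearMap.mem_eqLocus, LinearMap.id_apply, interpLin_apply,
      interp_eq_coarse, ← coarse_single]
    congr 1
    funext l
    unfold interpCoeff
    rw [coarse_single, h.dualCoeff_basisFun, Pi.single_apply]
    split_ifs with h1 h2 <;> simp_all
  exact this hv

lemma dualCoeff_interp (h : G.IsAdmissible Γ R₀ ρ σ ν i) (v : G.VHat)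
    {j : Fin d → Fin (2 ^ i + 1)} (hj : meshNode i j ∉ Γ) :
    G.dualCoeff i j (G.interp Γ i v) = G.dualCoeff i j v := by
  rw [interp_eq_coarse, h.dualCoeff_coarse, interpCoeff, if_neg hj]

/-- The dual functionals recover the coefficients of a coarse function, so Iv = 0 forces every
single coefficient to vanish; this makes membership in W usable locally. -/
lemma interpCoeff_eq_zero (h : G.IsAdmissible Γ R₀ ρ σ ν i) {v : G.VHat}
    (hv : G.interp Γ i v = 0) (j : Fin d → Fin (2 ^ i + 1)) : G.interpCoeff Γ i v j = 0 := by
  unfold interpCoeff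
  split_ifs with hj
  · rfl
  · rw [← h.dualCoeff_interp v hj, hv, map_zero]

end IsAdmissible

end SpatialNetwork

namespace SpatialNetwork

variable {d : ℕ} {G : SpatialNetwork d} {Γ : Set (EuclideanSpace ℝ (Fin d))} {R₀ ρ σ ν : ℝ} {i : ℕ}

/-! ### Local interpolation estimates -/

/-- The neighbourhood of an element on which the local estimates take place. -/
def nearElement (i : ℕ) (t : Fin d → Fin (2 ^ i)) : Set (EuclideanSpace ℝ (Fin d)) :=
  {z | supDist z (elementCenter i t) ≤ 7 * meshSize i}

/-- The constant of the local interpolation estimates. -/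
noncomputable def interpConst (d : ℕ) (σ ν : ℝ) : ℝ :=
  -- The first square comes from the M-estimate in `interp_local`, the other term from the energy
  -- estimate; the sum serves both.
  (3 * ν + 7 * ν * √(σ * (4 * d) ^ d)) ^ 2 + (7 * ν * (5 ^ d * d)) ^ 2 * (σ * (4 * d) ^ d)

lemma elementCenter_mem_unitCube (t : Fin d → Fin (2 ^ i)) : elementCenter i t ∈ unitCube d := by
  intro m
  have h := boxInside_elementCenter t m
  have := meshSize_pos i
  constructor <;> linarith [h.1, h.2]

namespace IsAdmissible

lemma interpConst_nonneg (h : G.IsAdmissible Γ R₀ ρ σ ν i) : 0 ≤ interpConst d σ ν := by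
  have h1 := h.one_le_σ
  have h2 := h.one_le_cast
  unfold interpConst
  positivity

lemma sqrt_cornerMass_le_element (h : G.IsAdmissible Γ R₀ ρ σ ν i) (t : Fin d → Fin (2 ^ i)) :
    √(cornerMass d ρ i) ≤ G.normMOn (element i t) 1 := by
  have hH := meshSize_pos i
  have hd := h.one_le_cast
  refine Real.sqrt_le_iff.2 ⟨Real.sqrt_nonneg _, ?_⟩
  have h1 := (h.props.homogeneity (meshSize i / 2) (elementCenter i t)
    (by linarith [h.R₀_le]) (boxInside_elementCenter t)).1
  rw [le_div_iff₀ (by positivity), mul_div_cancel₀ _ two_ne_zero] at h1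
  refine le_trans ?_ h1
  refine mul_le_mul_of_nonneg_left ?_ h.props.ρ_pos.le
  exact pow_le_pow_left₀ (by positivity) (div_le_self hH.le (by linarith)) d

lemma normMOn_one_element_sq_le (h : G.IsAdmissible Γ R₀ ρ σ ν i) (t : Fin d → Fin (2 ^ i)) :
    G.normMOn (element i t) 1 ^ 2 ≤ σ * (4 * d) ^ d * cornerMass d ρ i := by
  have hH := meshSize_pos i
  have hd := h.one_le_cast
  have h1 := (h.props.homogeneity (meshSize i / 2) (elementCenter i t)
    (by linarith [h.R₀_le]) (boxInside_elementCenter t)).2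
  rw [div_le_iff₀ (by positivity), mul_div_cancel₀ _ two_ne_zero] at h1
  refine h1.trans (le_of_eq ?_)
  unfold cornerMass
  rw [div_pow]
  field_simp

/-- The nodal values of the interpolant near an element are close to a constant. -/
lemma exists_const_near (h : G.IsAdmissible Γ R₀ ρ σ ν i) {v : G.VHat} (hv : v ∈ G.V Γ)
    (t : Fin d → Fin (2 ^ i)) :
    ∃ c : ℝ, G.normMOn (element i t) (fun x => v x - c) ≤
        3 * ν * meshSize i * G.normLOn (nearElement i t) v ∧
      ∀ j, supDist (meshNode i j) (elementCenter i t) ≤ 7 / 4 * meshSize i →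
        |G.interpCoeff Γ i v j - c| ≤ 7 * ν / √(cornerMass d ρ i) * meshSize i *
          G.normLOn (nearElement i t) v := by
  have hH := meshSize_pos i
  have hH1 := meshSize_le_one i
  have hR₀ := h.R₀_le
  have hν := h.nonneg
  set p := elementCenter i t with hp
  set X := G.normLOn (nearElement i t) v with hX
  have hX0 : 0 ≤ X := Real.sqrt_nonneg _
  have hκ := Real.sqrt_pos.2 h.cornerMass_pos
  obtain ⟨x, hx, hxp, hsub⟩ := exists_boxInside (elementCenter_mem_unitCube t)
    (show (0 : ℝ) < 3 * meshSize i by linarith)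
  rw [← hp] at hxp hsub
  set R := min (3 * meshSize i) (1 / 2) with hR
  have hR3 : R ≤ 3 * meshSize i := min_le_left _ _
  have hR0 : R₀ ≤ R := le_min (by linarith) h.R₀_le_half
  have hR0' : 0 ≤ R := h.props.R₀_pos.le.trans hR0
  obtain ⟨c, hc⟩ := h.poincare.1 R x hR0 hx v
  -- Centre shift at most 3H, radius at most 3H + R₀ and R₀ ≤ H/8: hence the radius 7H of
  -- `nearElement`.
  have hbig : box (R + R₀) x ⊆ nearElement i t := by
    intro z hz
    have h1 := supDist_le_of_mem_box (by linarith [h.props.R₀_pos]) hz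
    have h2 := supDist_triangle z x p
    change supDist z p ≤ _
    linarith
  have hc' : G.normMOn (box R x) (fun y => v y - c) ≤ 3 * ν * meshSize i * X := by
    refine hc.trans ?_
    calc ν * R * G.normLOn (box (R + R₀) x) v ≤ ν * R * X :=
          mul_le_mul_of_nonneg_left (G.normLOn_mono hbig v) (by positivity)
      _ ≤ 3 * ν * meshSize i * X := by
          refine mul_le_mul_of_nonneg_right ?_ hX0
          nlinarith
  have hclose : ∀ ω : Set (EuclideanSpace ℝ (Fin d)), ω ⊆ unitCube d →
      (∀ z ∈ ω, supDist z p < 3 * meshSize i) →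
      G.normMOn ω (fun y => v y - c) ≤ 3 * ν * meshSize i * X := by
    intro ω hω hz
    exact (G.normMOn_mono (fun z hzω => hsub z (hω hzω) (hz z hzω)) _).trans hc'
  refine ⟨c, hclose _ (element_subset_unitCube t) fun z hz => ?_, fun j hj => ?_⟩
  · have := supDist_le_of_mem_element hz
    rw [← hp] at this
    linarith
  · unfold interpCoeff
    split_ifs with hjΓ
    -- On Γ the coefficient is 0, so the constant c itself has to be small. The node lies on a face
    -- in Γ of an element t', where Friedrichs bounds v and Poincaré bounds v - c, hence also c.
    · obtain ⟨t', l, b, hb, ⟨hyt, hyl⟩, hface⟩ := h.faces _ hjΓ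
      have hyt' := mem_closure_element_iff.1 hyt
      have hyd : supDist (meshNode i j) (elementCenter i t') ≤ meshSize i / 2 :=
        (supDist_le_iff (by linarith)).2 hyt'
      have hR' : R₀ ≤ meshSize i / 2 := by linarith
      have hF := h.poincare.2.1 (meshSize i / 2) (elementCenter i t') hR'
        (boxInside_elementCenter t') ⟨l, b, hb, by rw [← hyl]; exact hyt' l, fun z hz =>
          hface ⟨mem_closure_element hz.1, hz.2⟩⟩ v hv
      have hbig' : box (meshSize i / 2 + R₀) (elementCenter i t') ⊆ nearElement i t := by
        intro z hz
        have h1 := supDist_le_of_mem_box (by linarith [h.props.R₀_pos]) hz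
        have h2 := supDist_triangle z (elementCenter i t') p
        have h3 := supDist_triangle (elementCenter i t') (meshNode i j) p
        rw [supDist_comm] at hyd
        change supDist z p ≤ _
        linarith
      have hF' : G.normMOn (element i t') v ≤ ν * (meshSize i / 2) * X :=
        hF.trans (mul_le_mul_of_nonneg_left (G.normLOn_mono hbig' v) (by positivity))
      have hC := hclose _ (element_subset_unitCube t') fun z hz => by
        have h1 := supDist_le_of_mem_element hz
        have h2 := supDist_triangle z (elementCenter i t') p
        have h3 := supDist_triangle (elementCenter i t') (meshNode i j) p
        rw [supDist_comm] at hyd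
        linarith
      have hconst : |c| * G.normMOn (element i t') 1 ≤
          G.normMOn (element i t') v + G.normMOn (element i t') (fun y => v y - c) := by
        refine (le_normMOn_of_le_abs (v := fun _ => c) (abs_nonneg c) fun _ _ => le_rfl).trans ?_
        have := (G.isPSDForm_bilinM (element i t')).energyNorm_sub_le v (fun y => v y - c)
        have e : v - (fun y => v y - c) = fun _ => c := by funext y; simp
        rw [e] at this
        exact this
      have hm := h.sqrt_cornerMass_le_element t'
      rw [zero_sub, abs_neg]
      have e : 7 * ν / √(cornerMass d ρ i) * meshSize i * X =
        7 * ν * meshSize i * X / √(cornerMass d ρ i) := by ring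
      rw [e, le_div_iff₀ hκ]
      have h1 := mul_le_mul_of_nonneg_left hm (abs_nonneg c)
      have h2 : 0 ≤ ν * meshSize i * X := by positivity
      nlinarith
    -- Off Γ the functional reproduces constants, so only v - c enters.
    · have e : G.dualCoeff i j v - c = G.dualCoeff i j (fun y => v y - c) := by
        have : (fun y => v y - c) = v - fun _ => c := rfl
        rw [this, map_sub, h.dualCoeff_const]
      rw [e]
      refine (h.abs_dualCoeff_le j _).trans ?_
      have hC := hclose (nodeElement i j)
        (by rw [nodeElement_eq]; exact element_subset_unitCube _) fun z hz => by
          have h1 := supDist_meshNode_le_of_mem hz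
          have h2 := supDist_triangle z (meshNode i j) p
          linarith
      calc 2 / √(cornerMass d ρ i) * G.normMOn (nodeElement i j) (fun y => v y - c)
          ≤ 2 / √(cornerMass d ρ i) * (3 * ν * meshSize i * X) :=
            mul_le_mul_of_nonneg_left hC (by positivity)
        _ = 6 * (ν / √(cornerMass d ρ i) * meshSize i * X) := by ring
        _ ≤ 7 * (ν / √(cornerMass d ρ i) * meshSize i * X) :=
            mul_le_mul_of_nonneg_right (by norm_num) (by positivity)
        _ = _ := by ring

/-- The two local interpolation estimates. -/
lemma interp_local (h : G.IsAdmissible Γ R₀ ρ σ ν i) {v : G.VHat} (hv : v ∈ G.V Γ)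
    (t : Fin d → Fin (2 ^ i)) :
    G.formM (element i t) (v - G.interp Γ i v) (v - G.interp Γ i v) ≤
        interpConst d σ ν * meshSize i ^ 2 * G.quadL (nearElement i t) v ∧
      G.quadL (element i t) (G.interp Γ i v) ≤
        interpConst d σ ν * G.quadL (nearElement i t) v := by
  obtain ⟨c, hc, hcoef⟩ := h.exists_const_near hv t
  have hH := meshSize_pos i
  have hν := h.nonneg
  have hσ := h.one_le_σ
  have hd := h.one_le_cast
  set X := G.normLOn (nearElement i t) v with hX
  have hX0 : 0 ≤ X := Real.sqrt_nonneg _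
  have hX2 : X ^ 2 = G.quadL (nearElement i t) v := G.normLOn_sq _ v
  have hκ := Real.sqrt_pos.2 h.cornerMass_pos
  have hκ2 := Real.sq_sqrt h.cornerMass_pos.le
  set κ := √(cornerMass d ρ i) with hκdef
  set E := 7 * ν / κ * meshSize i * X with hE
  have hE0 : 0 ≤ E := by positivity
  set s := σ * (4 * d) ^ d with hs
  have hs0 : 0 ≤ s := by positivity
  have hm2 := h.normMOn_one_element_sq_le t
  rw [← hs, ← hκ2] at hm2
  have hm1 : G.normMOn (element i t) 1 ≤ √s * κ := by
    refine abs_le_of_sq_le_sq' ?_ (by positivity) |>.2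
    rw [mul_pow, Real.sq_sqrt hs0]
    exact hm2
  have hEm : E * (√s * κ) = 7 * ν * √s * meshSize i * X := by
    rw [hE]; field_simp
  constructor
  -- Both v and Iv are compared with c; by the partition of unity, Iv - c is a convex combination of
  -- the numbers bounded by E.
  · have h1 : G.normMOn (element i t) (fun x => G.interp Γ i v x - c) ≤
        E * G.normMOn (element i t) 1 := by
      refine normMOn_le_of_abs_le hE0 fun x hx => ?_
      rw [interp_eq_coarse, coarse_sub_const]
      calc |∑ j, (G.interpCoeff Γ i v j - c) * lagrange i j (x : EuclideanSpace ℝ (Fin d))|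
          ≤ ∑ j, |(G.interpCoeff Γ i v j - c) * lagrange i j (x : EuclideanSpace ℝ (Fin d))| :=
            Finset.abs_sum_le_sum_abs _ _
        _ ≤ ∑ j, E * lagrange i j (x : EuclideanSpace ℝ (Fin d)) := by
            refine Finset.sum_le_sum fun j _ => ?_
            rw [abs_mul, abs_of_nonneg (lagrange_nonneg j _)]
            by_cases h0 : lagrange i j (x : EuclideanSpace ℝ (Fin d)) = 0
            · simp [h0]
            · refine mul_le_mul_of_nonneg_right (hcoef j ?_) (lagrange_nonneg j _)
              have h1 := supDist_lt_of_lagrange_ne_zero h0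
              have h2 := supDist_le_of_mem_element hx
              have h3 := supDist_triangle (meshNode i j) x (elementCenter i t)
              rw [supDist_comm] at h1
              linarith
        _ = E := by rw [← Finset.mul_sum, sum_lagrange_node, mul_one]
    have h2 : G.normMOn (element i t) (v - G.interp Γ i v) ≤
        (3 * ν + 7 * ν * √s) * meshSize i * X := by
      have h3 := (G.isPSDForm_bilinM (element i t)).energyNorm_sub_le (fun x => v x - c)
        (fun x => G.interp Γ i v x - c)
      have e : (fun x => v x - c) - (fun x => G.interp Γ i v x - c) = v - G.interp Γ i v := by
        funext x; simp
      rw [e] at h3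
      refine h3.trans ?_
      have h4 := mul_le_mul_of_nonneg_left hm1 hE0
      rw [hEm] at h4
      have h5 := h1.trans h4
      rw [normMOn_eq] at h5 hc
      linarith
    rw [← normMOn_sq, ← hX2]
    calc G.normMOn (element i t) (v - G.interp Γ i v) ^ 2
        ≤ ((3 * ν + 7 * ν * √s) * meshSize i * X) ^ 2 :=
          pow_le_pow_left₀ (Real.sqrt_nonneg _) h2 2
      _ = (3 * ν + 7 * ν * √s) ^ 2 * (meshSize i ^ 2 * X ^ 2) := by ring
      _ ≤ interpConst d σ ν * (meshSize i ^ 2 * X ^ 2) := by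
          refine mul_le_mul_of_nonneg_right ?_ (by positivity)
          unfold interpConst
          rw [← hs]
          have : 0 ≤ (7 * ν * (5 ^ d * d)) ^ 2 * s := by positivity
          linarith
      _ = _ := by ring
  · set D := E * (5 ^ d * d) / meshSize i with hD
    have hjump : ∀ x : G.nodes, (x : EuclideanSpace ℝ (Fin d)) ∈ element i t → ∀ y,
        G.graph.Adj x y → |G.interp Γ i v x - G.interp Γ i v y| ≤
          D * dist (x : EuclideanSpace ℝ (Fin d)) y := by
      intro x hx y hxy
      classical
      -- The indices whose basis function may differ at the ends of the edge: support radius H,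
      -- element radius H/2 and edge length below H/8 stay within 7H/4. There are at most 5^d of
      -- them, each of slope d/H; constants cancel, so the coefficients may be taken relative to c.
      let s' : Finset (Fin d → Fin (2 ^ i + 1)) := Finset.univ.filter fun j =>
        supDist (meshNode i j) (elementCenter i t) ≤ 7 / 4 * meshSize i
      have hcard : (s'.card : ℝ) ≤ 5 ^ d := by
        have := card_multiIndex_le 2 (fun m => elementCenter i t m / meshSize i) s' (by
          intro j hj m
          have h1 := (abs_apply_sub_le_supDist _ _ m).trans (Finset.mem_filter.1 hj).2
          rw [meshNode_apply, abs_sub_comm] at h1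
          have e : elementCenter i t m / meshSize i - (j m : ℕ) =
            (elementCenter i t m - (j m : ℕ) * meshSize i) / meshSize i := by
            field_simp
          rw [e, abs_div, abs_of_pos hH, div_le_iff₀ hH]
          push_cast
          linarith)
        norm_num at this
        exact this
      have e : G.interp Γ i v x - G.interp Γ i v y = ∑ j, (G.interpCoeff Γ i v j - c) *
          (lagrange i j (x : EuclideanSpace ℝ (Fin d)) - lagrange i j (y : EuclideanSpace ℝ (Fin d))) := by
        simp only [mul_sub, Finset.sum_sub_distrib]
        rw [← coarse_sub_const, ← coarse_sub_const, interp_eq_coarse]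
        ring
      have hx' := supDist_le_of_mem_element hx
      have hxy' := h.supDist_lt_of_adj hxy
      have hdl := supDist_le_dist (x : EuclideanSpace ℝ (Fin d)) y
      rw [e]
      calc _ ≤ ∑ j, |(G.interpCoeff Γ i v j - c) * (lagrange i j (x : EuclideanSpace ℝ (Fin d)) -
              lagrange i j (y : EuclideanSpace ℝ (Fin d)))| := Finset.abs_sum_le_sum_abs _ _
        _ = ∑ j ∈ s', |(G.interpCoeff Γ i v j - c) *
              (lagrange i j (x : EuclideanSpace ℝ (Fin d)) -
              lagrange i j (y : EuclideanSpace ℝ (Fin d)))| := by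
            symm
            refine Finset.sum_subset (Finset.subset_univ _) fun j _ hj => ?_
            have hj' : ¬ supDist (meshNode i j) (elementCenter i t) ≤ 7 / 4 * meshSize i :=
              fun h' => hj (Finset.mem_filter.2 ⟨Finset.mem_univ _, h'⟩)
            have hjx : lagrange i j (x : EuclideanSpace ℝ (Fin d)) = 0 := by
              by_contra h0
              have h1 := supDist_lt_of_lagrange_ne_zero h0
              have h3 := supDist_triangle (meshNode i j) x (elementCenter i t)
              rw [supDist_comm] at h1
              exact hj' (by linarith)
            have hjy : lagrange i j (y : EuclideanSpace ℝ (Fin d)) = 0 := by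
              by_contra h0
              have h1 := supDist_lt_of_lagrange_ne_zero h0
              have h3 := supDist_triangle (meshNode i j) y (elementCenter i t)
              have h4 := supDist_triangle (y : EuclideanSpace ℝ (Fin d)) x (elementCenter i t)
              rw [supDist_comm] at h1 hxy'
              exact hj' (by linarith)
            rw [hjx, hjy]; simp
        _ ≤ ∑ _j ∈ s', E * (d * dist (x : EuclideanSpace ℝ (Fin d)) y / meshSize i) := by
            refine Finset.sum_le_sum fun j hj => ?_
            rw [abs_mul]
            refine mul_le_mul (hcoef j (Finset.mem_filter.1 hj).2) ?_ (abs_nonneg _) hE0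
            refine (abs_lagrange_sub_le j _ _).trans ?_
            exact div_le_div_of_nonneg_right (mul_le_mul_of_nonneg_left hdl (by linarith)) hH.le
        _ = s'.card * (E * (d * dist (x : EuclideanSpace ℝ (Fin d)) y / meshSize i)) := by
            rw [Finset.sum_const, nsmul_eq_mul]
        _ ≤ 5 ^ d * (E * (d * dist (x : EuclideanSpace ℝ (Fin d)) y / meshSize i)) :=
            mul_le_mul_of_nonneg_right hcard (by positivity)
        _ = _ := by rw [hD]; ring
    have hD0 : 0 ≤ D := by positivity
    have hnode : ∀ x : G.nodes, (x : EuclideanSpace ℝ (Fin d)) ∈ element i t →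
        G.nodeL (G.interp Γ i v) x ≤ D ^ 2 * (G.mass x * ((1 : G.VHat) x * (1 : G.VHat) x)) := by
      intro x hx
      simp only [Pi.one_apply, mul_one]
      unfold nodeL mass
      rw [mul_left_comm, mul_sumOver (fun y => G.graph.Adj x y) (D ^ 2)]
      refine mul_le_mul_of_nonneg_left (sumOver_le_sumOver fun y hxy => ?_) (by norm_num)
      have h1 := hjump x hx y hxy
      have h2 := dist_pos_of_adj hxy
      rw [div_le_iff₀ h2]
      have h3 := pow_le_pow_left₀ (abs_nonneg _) h1 2
      rw [sq_abs] at h3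
      linarith
    have h1 : G.quadL (element i t) (G.interp Γ i v) ≤ D ^ 2 * G.normMOn (element i t) 1 ^ 2 := by
      rw [normMOn_sq, formM_eq, mul_sumOver]
      exact sumOver_le_sumOver hnode
    calc _ ≤ D ^ 2 * (s * κ ^ 2) := h1.trans (mul_le_mul_of_nonneg_left hm2 (by positivity))
      _ = (7 * ν * (5 ^ d * d)) ^ 2 * s * X ^ 2 := by
          rw [hD, hE]; field_simp
      _ ≤ interpConst d σ ν * X ^ 2 := by
          refine mul_le_mul_of_nonneg_right ?_ (by positivity)
          unfold interpConst
          rw [← hs]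
          have : 0 ≤ (3 * ν + 7 * ν * √s) ^ 2 := by positivity
          linarith
      _ = _ := by rw [hX2]

end IsAdmissible

/-- Summation of local estimates over the elements that meet a set. -/
lemma sumOver_le_quadL_of_local {F : G.nodes → ℝ} (hF : ∀ x, 0 ≤ F x) {D : ℝ} (hD : 0 ≤ D)
    {v : G.VHat} {A B : Set (EuclideanSpace ℝ (Fin d))}
    (hloc : ∀ t : Fin d → Fin (2 ^ i),
      sumOver (fun x : G.nodes => (x : EuclideanSpace ℝ (Fin d)) ∈ element i t) F ≤
        D * G.quadL (nearElement i t) v)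
    (hAB : ∀ z ∈ A, ∀ x : G.nodes, supDist (x : EuclideanSpace ℝ (Fin d)) z ≤ 8 * meshSize i →
      (x : EuclideanSpace ℝ (Fin d)) ∈ B) :
    sumOver (fun x : G.nodes => (x : EuclideanSpace ℝ (Fin d)) ∈ A) F ≤
      15 ^ d * D * G.quadL B v := by
  classical
  have hH := meshSize_pos i
  let s : Finset (Fin d → Fin (2 ^ i)) := Finset.univ.filter fun t =>
    ∃ x : G.nodes, (x : EuclideanSpace ℝ (Fin d)) ∈ A ∧
      elementIndex i (x : EuclideanSpace ℝ (Fin d)) = t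
  rw [sumOver_eq_sum_fiber fun x : G.nodes => elementIndex i (x : EuclideanSpace ℝ (Fin d))]
  calc _ = ∑ t ∈ s, sumOver (fun x : G.nodes => (x : EuclideanSpace ℝ (Fin d)) ∈ A ∧
            elementIndex i (x : EuclideanSpace ℝ (Fin d)) = t) F := by
        symm
        refine Finset.sum_subset (Finset.subset_univ _) fun t _ ht => ?_
        refine sumOver_eq_zero fun x hx => absurd ?_ ht
        exact Finset.mem_filter.2 ⟨Finset.mem_univ _, x, hx⟩
    _ ≤ ∑ t ∈ s, D * G.quadL (nearElement i t) v := by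
        refine Finset.sum_le_sum fun t _ => (sumOver_mono (fun x hx => ?_) fun x _ => hF x).trans
          (hloc t)
        exact (mem_element_iff (G.nodes_subset x x.2) t).2 hx.2
    _ = D * ∑ t ∈ s, G.quadL (nearElement i t) v := by rw [Finset.mul_sum]
    -- A node is within 7H of the centres of at most (2·7 + 1)^d elements, and 7H + H/2 ≤ 8H
    -- accounts for the passage from A to B.
    _ ≤ D * (15 ^ d * G.quadL B v) := by
        refine mul_le_mul_of_nonneg_left ?_ hD
        refine sum_sumOver_le s _ _ (G.nodeL_nonneg v) ?_ ?_
        · intro t ht x hx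
          obtain ⟨z, hzA, hzt⟩ := (Finset.mem_filter.1 ht).2
          refine hAB z hzA x ?_
          have h1 := supDist_le_of_mem_element
            ((mem_element_iff (G.nodes_subset z z.2) t).2 hzt)
          have h2 : supDist (x : EuclideanSpace ℝ (Fin d)) (elementCenter i t) ≤
            7 * meshSize i := hx
          have h3 := supDist_triangle (x : EuclideanSpace ℝ (Fin d)) (elementCenter i t) z
          rw [supDist_comm] at h1
          linarith
        · intro x t' ht'
          have := card_multiIndex_le 7
            (fun m => (x : EuclideanSpace ℝ (Fin d)) m / meshSize i - 1 / 2) t' (by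
            intro t ht m
            have h1 := (abs_apply_sub_le_supDist _ _ m).trans
              (show supDist (x : EuclideanSpace ℝ (Fin d)) (elementCenter i t) ≤
                7 * meshSize i from ht' t ht)
            rw [elementCenter_apply] at h1
            have e : (x : EuclideanSpace ℝ (Fin d)) m / meshSize i - 1 / 2 - (t m : ℕ) =
              ((x : EuclideanSpace ℝ (Fin d)) m - ((t m : ℕ) + 1 / 2) * meshSize i) /
                meshSize i := by
              field_simp
              ring
            rw [e, abs_div, abs_of_pos hH, div_le_iff₀ hH]
            push_cast
            exact h1)
          norm_num at this
          exact this
    _ = _ := by ring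

namespace IsAdmissible

lemma formM_sub_interp_le (h : G.IsAdmissible Γ R₀ ρ σ ν i) {v : G.VHat} (hv : v ∈ G.V Γ)
    {A B : Set (EuclideanSpace ℝ (Fin d))}
    (hAB : ∀ z ∈ A, ∀ x : G.nodes, supDist (x : EuclideanSpace ℝ (Fin d)) z ≤ 8 * meshSize i →
      (x : EuclideanSpace ℝ (Fin d)) ∈ B) :
    G.formM A (v - G.interp Γ i v) (v - G.interp Γ i v) ≤
      15 ^ d * interpConst d σ ν * meshSize i ^ 2 * G.quadL B v := by
  rw [formM_eq, mul_assoc (15 ^ d)]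
  refine sumOver_le_quadL_of_local
    (fun x => mul_nonneg (G.mass_nonneg x) (mul_self_nonneg _))
    (mul_nonneg h.interpConst_nonneg (sq_nonneg _)) (fun t => ?_) hAB
  rw [← formM_eq]
  exact (h.interp_local hv t).1

lemma quadL_interp_le_of_near (h : G.IsAdmissible Γ R₀ ρ σ ν i) {v : G.VHat} (hv : v ∈ G.V Γ)
    {A B : Set (EuclideanSpace ℝ (Fin d))}
    (hAB : ∀ z ∈ A, ∀ x : G.nodes, supDist (x : EuclideanSpace ℝ (Fin d)) z ≤ 8 * meshSize i →
      (x : EuclideanSpace ℝ (Fin d)) ∈ B) :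
    G.quadL A (G.interp Γ i v) ≤ 15 ^ d * interpConst d σ ν * G.quadL B v :=
  sumOver_le_quadL_of_local (G.nodeL_nonneg _) h.interpConst_nonneg
    (fun t => (h.interp_local hv t).2) hAB

lemma quadL_interp_le (h : G.IsAdmissible Γ R₀ ρ σ ν i) {v : G.VHat} (hv : v ∈ G.V Γ) :
    G.quadL (unitCube d) (G.interp Γ i v) ≤
      15 ^ d * interpConst d σ ν * G.quadL (unitCube d) v :=
  h.quadL_interp_le_of_near hv fun _ _ x _ => G.nodes_subset x x.2

end IsAdmissible

end SpatialNetwork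

/-- The piecewise linear function that rises from `0` to `1` on `[0,1]`. -/
noncomputable def ramp (s : ℝ) : ℝ := max 0 (min 1 s)

lemma ramp_nonneg (s : ℝ) : 0 ≤ ramp s := le_max_left _ _

lemma ramp_le_one (s : ℝ) : ramp s ≤ 1 := max_le zero_le_one (min_le_left _ _)

lemma ramp_of_nonpos {s : ℝ} (hs : s ≤ 0) : ramp s = 0 :=
  max_eq_left ((min_le_right _ _).trans hs)

lemma ramp_of_one_le {s : ℝ} (hs : 1 ≤ s) : ramp s = 1 := by
  rw [ramp, min_eq_left hs]; exact max_eq_right zero_le_one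

lemma abs_ramp_sub_le (s s' : ℝ) : |ramp s - ramp s'| ≤ |s - s'| := by
  unfold ramp
  rw [max_comm 0, max_comm 0]
  refine (abs_max_sub_max_le_abs _ _ _).trans ((abs_min_sub_min_le_max _ _ _ _).trans ?_)
  simp

namespace SpatialNetwork

variable {d : ℕ} {G : SpatialNetwork d} {Γ : Set (EuclideanSpace ℝ (Fin d))} {R₀ ρ σ ν : ℝ} {i : ℕ}

/-! ### Fine-scale spaces and solvability -/

/-- The fine-scale space as a submodule. -/
noncomputable def fineSub (G : SpatialNetwork d) (Γ : Set (EuclideanSpace ℝ (Fin d))) (i : ℕ) :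
    Submodule ℝ G.VHat := G.V Γ ⊓ LinearMap.ker (G.interpLin Γ i)

/-- The localized fine-scale space as a submodule. -/
noncomputable def fineSubOn (G : SpatialNetwork d) (Γ : Set (EuclideanSpace ℝ (Fin d))) (i k : ℕ)
    (ω : Set (EuclideanSpace ℝ (Fin d))) : Submodule ℝ G.VHat :=
  G.fineSub Γ i ⊓ G.V (patchIter i k ω)ᶜ

lemma mem_fineSub {v : G.VHat} : v ∈ G.fineSub Γ i ↔ v ∈ G.V Γ ∧ G.interp Γ i v = 0 := Iff.rfl

lemma coe_fineSubOn (k : ℕ) (ω : Set (EuclideanSpace ℝ (Fin d))) :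
    (G.fineSubOn Γ i k ω : Set G.VHat) = G.fineSpaceOn Γ i k ω := by
  ext v
  refine and_congr Iff.rfl (forall_congr' fun x => ?_)
  rw [Set.mem_compl_iff, ← not_imp_not, not_not]

lemma fineSubOn_le (k : ℕ) (ω : Set (EuclideanSpace ℝ (Fin d))) :
    G.fineSubOn Γ i k ω ≤ G.fineSub Γ i := inf_le_left

lemma fineSub_le_V : G.fineSub Γ i ≤ G.V Γ := inf_le_left

lemma mul_mem_V (η : G.VHat) {v : G.VHat} (hv : v ∈ G.V Γ) : η * v ∈ G.V Γ :=
  fun x hx => by simp [hv x hx]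

/-- Coercivity kills the L-energy, the global Friedrichs inequality then kills the M-norm, and all
masses are positive. So K is an inner product on V, and every problem posed through `solveIn` has a
unique solution. -/
lemma IsAdmissible.eq_zero_of_form_eq_zero (h : G.IsAdmissible Γ R₀ ρ σ ν i)
    {K : G.LocalOperator} {α β : ℝ} (hα : 0 < α) (hK : K.IsBoundedCoercive Γ α β)
    {v : G.VHat} (hv : v ∈ G.V Γ) (h0 : K.form v v = 0) : v = 0 := by
  have h1 := (hK v hv).1
  rw [h0] at h1
  have h2 : G.quadL (unitCube d) v = 0 := by
    have := G.quadL_nonneg (unitCube d) v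
    nlinarith
  have h3 := h.poincare.2.2 v hv
  have h4 : G.normL v = 0 := by
    rw [normL, normLOn, h2, Real.sqrt_zero]
  rw [h4, mul_zero] at h3
  have h5 : G.formM (unitCube d) v v ≤ 0 := Real.sqrt_eq_zero'.1
    (le_antisymm h3 (Real.sqrt_nonneg _))
  funext x
  have h6 := single_le_sumOver (p := fun x : G.nodes => (x : EuclideanSpace ℝ (Fin d)) ∈ unitCube d)
    (F := fun x => G.mass x * (v x * v x))
    (fun x _ => mul_nonneg (G.mass_nonneg x) (mul_self_nonneg _)) (G.nodes_subset x x.2)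
  rw [← formM_eq] at h6
  have h7 := h.mass_pos x
  have h8 : v x * v x = 0 := by
    have := mul_self_nonneg (v x)
    nlinarith
  simpa using h8

lemma IsAdmissible.solveIn_spec (h : G.IsAdmissible Γ R₀ ρ σ ν i)
    {K : G.LocalOperator} {α β : ℝ} (hα : 0 < α) (hK : K.IsBoundedCoercive Γ α β)
    {S : Submodule ℝ G.VHat} (hS : S ≤ G.V Γ) (ℓ : G.VHat →ₗ[ℝ] ℝ) :
    K.solveIn S ℓ ∈ S ∧ ∀ w ∈ S, K.form (K.solveIn S ℓ) w = ℓ w := by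
  refine Classical.epsilon_spec (p := fun r => r ∈ (S : Set G.VHat) ∧
    ∀ w ∈ (S : Set G.VHat), K.form r w = ℓ w) ?_
  obtain ⟨r, hr, hw⟩ := IsPSDForm.exists_solution K.bilin S
    (fun v hv h0 => h.eq_zero_of_form_eq_zero hα hK (hS hv) h0) ℓ
  exact ⟨r, hr, hw⟩

lemma IsAdmissible.eq_of_forall_form_eq (h : G.IsAdmissible Γ R₀ ρ σ ν i)
    {K : G.LocalOperator} {α β : ℝ} (hα : 0 < α) (hK : K.IsBoundedCoercive Γ α β)
    {S : Submodule ℝ G.VHat} (hS : S ≤ G.V Γ) {u v : G.VHat} (hu : u ∈ S) (hv : v ∈ S)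
    (huv : ∀ w ∈ S, K.form u w = K.form v w) : u = v := by
  refine sub_eq_zero.1 (h.eq_zero_of_form_eq_zero hα hK (hS (S.sub_mem hu hv)) ?_)
  have := huv _ (S.sub_mem hu hv)
  rw [← K.bilin_apply] at this ⊢
  rw [LinearMap.map_sub₂, this, ← K.bilin_apply, sub_self]

/-! ### Cut-off functions -/

/-- The distance to the centre of an element in units of the mesh size. -/
noncomputable def relDist (i : ℕ) (t : Fin d → Fin (2 ^ i)) (x : EuclideanSpace ℝ (Fin d)) : ℝ :=
  supDist x (elementCenter i t) / meshSize i

lemma relDist_nonneg (t : Fin d → Fin (2 ^ i)) (x : EuclideanSpace ℝ (Fin d)) :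
    0 ≤ relDist i t x := div_nonneg (supDist_nonneg _ _) (meshSize_pos i).le

lemma relDist_le_add (t : Fin d → Fin (2 ^ i)) {x y : EuclideanSpace ℝ (Fin d)} {r : ℝ}
    (hxy : supDist x y ≤ r * meshSize i) : relDist i t x ≤ relDist i t y + r := by
  have hH := meshSize_pos i
  unfold relDist
  rw [div_add' _ _ _ hH.ne']
  refine div_le_div_of_nonneg_right ?_ hH.le
  have := supDist_triangle x y (elementCenter i t)
  linarith

lemma abs_relDist_sub_le (t : Fin d → Fin (2 ^ i)) (x y : EuclideanSpace ℝ (Fin d)) :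
    |relDist i t x - relDist i t y| ≤ dist x y / meshSize i := by
  have hH := meshSize_pos i
  unfold relDist
  rw [← sub_div, abs_div, abs_of_pos hH]
  refine div_le_div_of_nonneg_right (le_trans ?_ (supDist_le_dist x y)) hH.le
  exact abs_dist_sub_le _ _ _

/-- Multiplication by a cut-off function. -/
lemma nodeL_mul_le {η q : G.VHat} {e : ℝ} {x : G.nodes} (hη : ∀ y, |η y| ≤ 1)
    (hlip : ∀ y, G.graph.Adj x y → |η x - η y| ≤ e * dist (x : EuclideanSpace ℝ (Fin d)) y) :
    G.nodeL (η * q) x ≤ 2 * G.nodeL q x + 2 * e ^ 2 * (G.mass x * (q x * q x)) := by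
  have : sumOver (fun y => G.graph.Adj x y) (fun y =>
      ((η * q) x - (η * q) y) ^ 2 / dist (x : EuclideanSpace ℝ (Fin d)) y) ≤
      2 * sumOver (fun y => G.graph.Adj x y) (fun y =>
        (q x - q y) ^ 2 / dist (x : EuclideanSpace ℝ (Fin d)) y) +
      2 * e ^ 2 * (q x * q x) * sumOver (fun y => G.graph.Adj x y) (fun y =>
        dist (x : EuclideanSpace ℝ (Fin d)) y) := by
    rw [mul_sumOver, mul_sumOver, ← sumOver_add]
    refine sumOver_le_sumOver fun y hxy => ?_
    have hpos := dist_pos_of_adj hxy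
    set D := dist (x : EuclideanSpace ℝ (Fin d)) y
    rw [mul_div_assoc', div_add' _ _ _ hpos.ne']
    refine div_le_div_of_nonneg_right ?_ hpos.le
    simp only [Pi.mul_apply]
    have e1 : η x * q x - η y * q y = η y * (q x - q y) + (η x - η y) * q x := by ring
    have h1 : η y ^ 2 ≤ 1 := by
      rw [← sq_abs]
      exact pow_le_one₀ (abs_nonneg _) (hη y)
    have h2 : (η x - η y) ^ 2 ≤ (e * D) ^ 2 := by
      rw [← sq_abs]
      exact pow_le_pow_left₀ (abs_nonneg _) (hlip y hxy) 2
    have h3 := mul_le_mul_of_nonneg_right h1 (sq_nonneg (q x - q y))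
    have h4 := mul_le_mul_of_nonneg_right h2 (sq_nonneg (q x))
    rw [e1]
    nlinarith [sq_nonneg (η y * (q x - q y) - (η x - η y) * q x)]
  unfold nodeL mass
  linarith

/-- The constant of the cut-off estimate. -/
noncomputable def cutConst (d : ℕ) (σ ν : ℝ) : ℝ := 2 + 8 * (15 ^ d * interpConst d σ ν)

/-- A cut-off function relative to the mesh: values in `[0,1]` and slope at most `2 / H`. -/
structure IsCutoff (i : ℕ) (η : G.VHat) : Prop where
  nonneg : ∀ x, 0 ≤ η x
  le_one : ∀ x, η x ≤ 1
  lip : ∀ x y, |η x - η y| ≤ 2 / meshSize i * dist (x : EuclideanSpace ℝ (Fin d)) y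

namespace IsAdmissible

lemma cutConst_pos (h : G.IsAdmissible Γ R₀ ρ σ ν i) : 0 < cutConst d σ ν := by
  have := h.interpConst_nonneg
  unfold cutConst
  positivity

/-- The product rule costs (2/H)²|q|_M². Since q = q - Iq on W, the interpolation estimate bounds
|q|_M² locally by C H² times the energy, and the powers of H cancel. -/
lemma quadL_mul_le (h : G.IsAdmissible Γ R₀ ρ σ ν i) {η q : G.VHat} (hη : IsCutoff i η)
    (hq : q ∈ G.fineSub Γ i) {A B : Set (EuclideanSpace ℝ (Fin d))}
    (hAB : ∀ z ∈ A, ∀ x : G.nodes, supDist (x : EuclideanSpace ℝ (Fin d)) z ≤ 8 * meshSize i →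
      (x : EuclideanSpace ℝ (Fin d)) ∈ B) :
    G.quadL A (η * q) ≤ cutConst d σ ν * G.quadL B q := by
  have hH := meshSize_pos i
  have hq' := mem_fineSub.1 hq
  have h1 : G.quadL A (η * q) ≤ 2 * G.quadL A q +
      2 * (2 / meshSize i) ^ 2 * G.formM A q q := by
    rw [quadL_eq, quadL_eq, formM_eq, mul_sumOver, mul_sumOver, ← sumOver_add]
    exact sumOver_le_sumOver fun x _ => nodeL_mul_le
      (fun y => by rw [abs_of_nonneg (hη.nonneg y)]; exact hη.le_one y) fun y _ => hη.lip x y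
  have h2 := h.formM_sub_interp_le hq'.1 hAB
  rw [hq'.2, sub_zero] at h2
  have h3 : G.quadL A q ≤ G.quadL B q :=
    sumOver_mono (fun x hx => hAB x hx x (by
      have : supDist (x : EuclideanSpace ℝ (Fin d)) x = 0 := dist_self _
      rw [this]; positivity)) fun x _ => G.nodeL_nonneg q x
  have h4 : 2 * (2 / meshSize i) ^ 2 * G.formM A q q ≤
      8 * (15 ^ d * interpConst d σ ν) * G.quadL B q := by
    calc _ ≤ 2 * (2 / meshSize i) ^ 2 *
          (15 ^ d * interpConst d σ ν * meshSize i ^ 2 * G.quadL B q) :=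
          mul_le_mul_of_nonneg_left h2 (by positivity)
      _ = _ := by field_simp; ring
  unfold cutConst
  linarith

end IsAdmissible

/-- (L_x v, v) sees only x and its neighbours, so nodes that neither belong to the support nor are
adjacent to it contribute nothing. -/
lemma quadL_unitCube_eq_of_support {v : G.VHat} {A : Set (EuclideanSpace ℝ (Fin d))}
    (hA : ∀ x y : G.nodes, (y = x ∨ G.graph.Adj x y) → v y ≠ 0 →
      (x : EuclideanSpace ℝ (Fin d)) ∈ A) :
    G.quadL (unitCube d) v ≤ G.quadL A v := by
  classical
  rw [quadL_eq, quadL_eq, sumOver_eq_sum_ite, sumOver_eq_sum_ite]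
  refine Finset.sum_le_sum fun x _ => ?_
  rw [if_pos (G.nodes_subset x x.2)]
  split_ifs with hx
  · exact le_rfl
  · rw [← G.nodeL_zero x]
    refine le_of_eq (G.nodeL_congr ?_ fun y hy => ?_)
    · by_contra h0
      exact hx (hA x x (Or.inl rfl) h0)
    · by_contra h0
      exact hx (hA x y (Or.inr hy) h0)

/-- Each K_x couples x with its neighbours only, and edges are shorter than H/8, so coupled nodes
have relative distances that differ by at most 1/4. -/
lemma IsAdmissible.form_eq_zero_of_separated (h : G.IsAdmissible Γ R₀ ρ σ ν i)
    (K : G.LocalOperator) (t : Fin d → Fin (2 ^ i)) {u v : G.VHat}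
    (huv : ∀ y z : G.nodes, u y ≠ 0 → v z ≠ 0 →
      relDist i t (y : EuclideanSpace ℝ (Fin d)) + 1 ≤ relDist i t z ∨
      relDist i t (z : EuclideanSpace ℝ (Fin d)) + 1 ≤ relDist i t y) : K.form u v = 0 := by
  refine sumOver_eq_zero fun x _ => K.node_eq_zero x fun y z hy hz => ?_
  by_contra hc
  push Not at hc
  have hH := meshSize_pos i
  have near : ∀ w : G.nodes, (w = x ∨ G.graph.Adj x w) →
      supDist (x : EuclideanSpace ℝ (Fin d)) w ≤ 1 / 8 * meshSize i := by
    rintro w (rfl | hw)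
    · have : supDist (w : EuclideanSpace ℝ (Fin d)) w = 0 := dist_self _
      rw [this]; positivity
    · linarith [h.supDist_lt_of_adj hw]
  have hy' := near y hy
  have hz' := near z hz
  have h1 := relDist_le_add t hy'
  have h2 := relDist_le_add t hz'
  rw [supDist_comm] at hy' hz'
  have h3 := relDist_le_add t hy'
  have h4 := relDist_le_add t hz'
  rcases huv y z hc.1 hc.2 with h5 | h5 <;> linarith

/-- The cut-off function that rises from `0` to `1` between relative distances `m` and `m + 1`. -/
noncomputable def cut (G : SpatialNetwork d) (i : ℕ) (t : Fin d → Fin (2 ^ i)) (m : ℝ) : G.VHat :=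
  fun x => ramp (relDist i t x - m)

/-- The cut-off function of the strip between relative distances `m - 4` and `m + 5`. -/
noncomputable def stripCut (G : SpatialNetwork d) (i : ℕ) (t : Fin d → Fin (2 ^ i)) (m : ℝ) :
    G.VHat :=
  fun x => ramp (min (relDist i t x - (m - 4)) (m + 5 - relDist i t x))

lemma abs_cut_sub_le (t : Fin d → Fin (2 ^ i)) (m : ℝ) (x y : G.nodes) :
    |G.cut i t m x - G.cut i t m y| ≤ dist (x : EuclideanSpace ℝ (Fin d)) y / meshSize i := by
  refine (abs_ramp_sub_le _ _).trans ?_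
  rw [sub_sub_sub_cancel_right]
  exact abs_relDist_sub_le t _ _

lemma abs_stripCut_sub_le (t : Fin d → Fin (2 ^ i)) (m : ℝ) (x y : G.nodes) :
    |G.stripCut i t m x - G.stripCut i t m y| ≤
      dist (x : EuclideanSpace ℝ (Fin d)) y / meshSize i := by
  refine (abs_ramp_sub_le _ _).trans ((abs_min_sub_min_le_max _ _ _ _).trans (max_le ?_ ?_))
  · rw [sub_sub_sub_cancel_right]
    exact abs_relDist_sub_le t _ _
  · rw [sub_sub_sub_cancel_left, abs_sub_comm]
    exact abs_relDist_sub_le t _ _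

lemma isCutoff_of_lip {η : G.VHat} (h0 : ∀ x, 0 ≤ η x) (h1 : ∀ x, η x ≤ 1)
    (hl : ∀ x y, |η x - η y| ≤ dist (x : EuclideanSpace ℝ (Fin d)) y / meshSize i) :
    IsCutoff i η := by
  refine ⟨h0, h1, fun x y => (hl x y).trans ?_⟩
  have hH := meshSize_pos i
  have := div_nonneg (dist_nonneg (x := (x : EuclideanSpace ℝ (Fin d))) (y := y)) hH.le
  rw [div_mul_eq_mul_div, mul_div_assoc]
  linarith

/-- The slopes of two cut-offs with values in [0,1] add up, which is why `IsCutoff` allows 2/H. -/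
lemma isCutoff_mul {η χ : G.VHat} (h0 : ∀ x, 0 ≤ η x) (h1 : ∀ x, η x ≤ 1)
    (hl : ∀ x y, |η x - η y| ≤ dist (x : EuclideanSpace ℝ (Fin d)) y / meshSize i)
    (h0' : ∀ x, 0 ≤ χ x) (h1' : ∀ x, χ x ≤ 1)
    (hl' : ∀ x y, |χ x - χ y| ≤ dist (x : EuclideanSpace ℝ (Fin d)) y / meshSize i) :
    IsCutoff i (χ * η) := by
  refine ⟨fun x => mul_nonneg (h0' x) (h0 x), fun x => mul_le_one₀ (h1' x) (h0 x) (h1 x),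
    fun x y => ?_⟩
  simp only [Pi.mul_apply]
  have e : χ x * η x - χ y * η y = χ x * (η x - η y) + (χ x - χ y) * η y := by ring
  rw [e]
  refine (abs_add_le _ _).trans ?_
  rw [abs_mul, abs_mul, abs_of_nonneg (h0' x), abs_of_nonneg (h0 y), div_mul_eq_mul_div,
    mul_div_assoc]
  have a1 := mul_le_of_le_one_left (abs_nonneg (η x - η y)) (h1' x)
  have a2 := mul_le_of_le_one_right (abs_nonneg (χ x - χ y)) (h1 y)
  linarith [hl x y, hl' x y]

lemma isCutoff_cut (t : Fin d → Fin (2 ^ i)) (m : ℝ) : IsCutoff i (G.cut i t m) :=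
  isCutoff_of_lip (fun _ => ramp_nonneg _) (fun _ => ramp_le_one _) (abs_cut_sub_le t m)

lemma isCutoff_stripCut (t : Fin d → Fin (2 ^ i)) (m : ℝ) : IsCutoff i (G.stripCut i t m) :=
  isCutoff_of_lip (fun _ => ramp_nonneg _) (fun _ => ramp_le_one _) (abs_stripCut_sub_le t m)

lemma isCutoff_stripCut_mul_cut (t : Fin d → Fin (2 ^ i)) (m : ℝ) :
    IsCutoff i (G.stripCut i t m * G.cut i t m) :=
  isCutoff_mul (fun _ => ramp_nonneg _) (fun _ => ramp_le_one _) (abs_cut_sub_le t m)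
    (fun _ => ramp_nonneg _) (fun _ => ramp_le_one _) (abs_stripCut_sub_le t m)

lemma isCutoff_stripCut_mul_one_sub_cut (t : Fin d → Fin (2 ^ i)) (m : ℝ) :
    IsCutoff i (G.stripCut i t m * (1 - G.cut i t m)) :=
  isCutoff_mul (fun _ => sub_nonneg.2 (ramp_le_one _)) (fun _ => sub_le_self _ (ramp_nonneg _))
    (fun x y => by
      simp only [Pi.sub_apply, Pi.one_apply, sub_sub_sub_cancel_left]
      rw [abs_sub_comm]
      exact abs_cut_sub_le t m x y)
    (fun _ => ramp_nonneg _) (fun _ => ramp_le_one _) (abs_stripCut_sub_le t m)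

lemma lt_relDist_of_cut_ne_zero {t : Fin d → Fin (2 ^ i)} {m : ℝ} {x : G.nodes}
    (h : G.cut i t m x ≠ 0) : m < relDist i t x := by
  by_contra hc
  push Not at hc
  exact h (ramp_of_nonpos (by linarith))

lemma relDist_lt_of_cut_ne_one {t : Fin d → Fin (2 ^ i)} {m : ℝ} {x : G.nodes}
    (h : G.cut i t m x ≠ 1) : relDist i t x < m + 1 := by
  by_contra hc
  push Not at hc
  exact h (ramp_of_one_le (by linarith))

lemma relDist_of_stripCut_ne_zero {t : Fin d → Fin (2 ^ i)} {m : ℝ} {x : G.nodes}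
    (h : G.stripCut i t m x ≠ 0) : m - 4 < relDist i t x ∧ relDist i t x < m + 5 := by
  by_contra hc
  refine h (ramp_of_nonpos ?_)
  by_cases h1 : m - 4 < relDist i t x
  · have h2 : m + 5 ≤ relDist i t x := by
      by_contra h3
      push Not at h3
      exact hc ⟨h1, h3⟩
    exact (min_le_right _ _).trans (by linarith)
  · push Not at h1
    exact (min_le_left _ _).trans (by linarith)

lemma relDist_of_stripCut_ne_one {t : Fin d → Fin (2 ^ i)} {m : ℝ} {x : G.nodes}
    (h : G.stripCut i t m x ≠ 1) : relDist i t x < m - 3 ∨ m + 4 < relDist i t x := by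
  by_contra hc
  push Not at hc
  exact h (ramp_of_one_le (le_min (by linarith [hc.1]) (by linarith [hc.2])))

/-- The interpolant of `v` vanishes at `x` if the coefficients of `v` agree with those of a
function in the kernel in the elements around `x`. -/
lemma interp_apply_eq_zero {v : G.VHat} {x : G.nodes}
    (hv : ∀ j, supDist (x : EuclideanSpace ℝ (Fin d)) (meshNode i j) < meshSize i →
      G.interpCoeff Γ i v j = 0) : G.interp Γ i v x = 0 := by
  rw [interp_eq_coarse, coarse_apply]
  refine Finset.sum_eq_zero fun j _ => ?_
  by_cases h0 : lagrange i j (x : EuclideanSpace ℝ (Fin d)) = 0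
  · rw [h0, mul_zero]
  · rw [hv j (supDist_lt_of_lagrange_ne_zero h0), zero_mul]

lemma interpCoeff_congr {u v : G.VHat} {j : Fin d → Fin (2 ^ i + 1)}
    (h : ∀ x : G.nodes, (x : EuclideanSpace ℝ (Fin d)) ∈ nodeElement i j → u x = v x) :
    G.interpCoeff Γ i u j = G.interpCoeff Γ i v j := by
  unfold interpCoeff
  split_ifs
  · rfl
  · exact dualCoeff_congr h

/-- Nodes contributing at x are within H of x, and each dual functional only looks at an element
within H of its node. Hence u and v have the same contributing coefficients, and those of v vanish.
-/
lemma IsAdmissible.interp_apply_eq_zero_of_eq (h : G.IsAdmissible Γ R₀ ρ σ ν i) {u v : G.VHat}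
    (hv : G.interp Γ i v = 0) {x : G.nodes}
    (huv : ∀ z : G.nodes, supDist (x : EuclideanSpace ℝ (Fin d)) z ≤ 2 * meshSize i → u z = v z) :
    G.interp Γ i u x = 0 := by
  refine interp_apply_eq_zero fun j hj => ?_
  rw [interpCoeff_congr (v := v) fun z hz => huv z ?_, h.interpCoeff_eq_zero hv]
  have h1 := supDist_meshNode_le_of_mem hz
  have h2 := supDist_triangle (x : EuclideanSpace ℝ (Fin d)) (meshNode i j) z
  rw [supDist_comm] at h1
  linarith

end SpatialNetwork

namespace IsPSDForm

lemma abs_apply_le_half {E : Type*} [AddCommGroup E] [Module ℝ E] {B : LinearMap.BilinForm ℝ E}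
    (hB : IsPSDForm B) (u v : E) : |B u v| ≤ (B u u + B v v) / 2 := by
  have h := hB.abs_apply_le u v
  rw [← hB.energyNorm_sq u, ← hB.energyNorm_sq v]
  nlinarith [sq_nonneg (energyNorm B u - energyNorm B v)]

end IsPSDForm

namespace SpatialNetwork

variable {d : ℕ} {G : SpatialNetwork d} {Γ : Set (EuclideanSpace ℝ (Fin d))} {R₀ ρ σ ν : ℝ}
  {i : ℕ} {K : G.LocalOperator} {α β : ℝ}

/-! ### Exponential decay of the correctors -/

/-- The strip of points at relative distance in `[a, b)` from an element. -/
def strip (i : ℕ) (t : Fin d → Fin (2 ^ i)) (a b : ℝ) : Set (EuclideanSpace ℝ (Fin d)) :=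
  {z | a ≤ relDist i t z ∧ relDist i t z < b}

/-- The points at relative distance at least `r` from an element. -/
def outside (i : ℕ) (t : Fin d → Fin (2 ^ i)) (r : ℝ) : Set (EuclideanSpace ℝ (Fin d)) :=
  {z | r ≤ relDist i t z}

lemma strip_near {t : Fin d → Fin (2 ^ i)} {a b a' b' : ℝ} (ha : a' + 8 ≤ a) (hb : b + 8 ≤ b') :
    ∀ z ∈ strip i t a b, ∀ x : G.nodes,
      supDist (x : EuclideanSpace ℝ (Fin d)) z ≤ 8 * meshSize i →
      (x : EuclideanSpace ℝ (Fin d)) ∈ strip i t a' b' := by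
  intro z hz x hx
  have h1 := relDist_le_add t hx
  rw [supDist_comm] at hx
  have h2 := relDist_le_add t hx
  exact ⟨by linarith [hz.1], by linarith [hz.2]⟩

lemma IsAdmissible.abs_relDist_sub_le_of_adj (h : G.IsAdmissible Γ R₀ ρ σ ν i)
    (t : Fin d → Fin (2 ^ i)) {x y : G.nodes} (hxy : y = x ∨ G.graph.Adj x y) :
    relDist i t (x : EuclideanSpace ℝ (Fin d)) ≤ relDist i t y + 1 / 8 ∧
      relDist i t (y : EuclideanSpace ℝ (Fin d)) ≤ relDist i t x + 1 / 8 := by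
  rcases hxy with rfl | hxy
  · constructor <;> linarith
  · have h1 : supDist (x : EuclideanSpace ℝ (Fin d)) y ≤ 1 / 8 * meshSize i := by
      linarith [h.supDist_lt_of_adj hxy]
    have h2 := h1
    rw [supDist_comm] at h2
    exact ⟨relDist_le_add t h1, relDist_le_add t h2⟩

/-- The interpolant of a cut-off fine-scale function lives in the strip of the cut-off. -/
lemma IsAdmissible.relDist_of_interp_cut_ne_zero (h : G.IsAdmissible Γ R₀ ρ σ ν i)
    {t : Fin d → Fin (2 ^ i)} {m : ℝ} {q : G.VHat} (hq : G.interp Γ i q = 0) {x : G.nodes}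
    (hx : G.interp Γ i (G.cut i t m * q) x ≠ 0) :
    m - 2 ≤ relDist i t x ∧ relDist i t x ≤ m + 3 := by
  -- Far inside, the cut-off function is 0; far outside it equals q, which is in the kernel of I.
  -- The interpolant looks only 2H around a point, so it vanishes in both regions.
  constructor
  · by_contra hc
    push Not at hc
    refine hx (h.interp_apply_eq_zero_of_eq (v := 0) (map_zero (G.interpLin Γ i)) fun z hz => ?_)
    rw [supDist_comm] at hz
    have h1 := relDist_le_add t hz
    have h2 : G.cut i t m z = 0 := ramp_of_nonpos (by linarith)
    simp [h2]
  · by_contra hc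
    push Not at hc
    refine hx (h.interp_apply_eq_zero_of_eq (v := q) hq fun z hz => ?_)
    have h1 := relDist_le_add t hz
    have h2 : G.cut i t m z = 1 := ramp_of_one_le (by linarith)
    simp [h2]

/-- The constant of the decay step. -/
noncomputable def stepConst (d : ℕ) (σ ν α β : ℝ) : ℝ :=
  β / (2 * α) * (cutConst d σ ν * (3 + 15 ^ d * interpConst d σ ν))

lemma IsAdmissible.stepConst_pos (h : G.IsAdmissible Γ R₀ ρ σ ν i) (hα : 0 < α) (hαβ : α ≤ β) :
    0 < stepConst d σ ν α β := by
  have h1 := h.cutConst_pos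
  have h2 := h.interpConst_nonneg
  have h3 : 0 < β := hα.trans_le hαβ
  unfold stepConst
  positivity

/-- A Caccioppoli estimate. Write e = ηq, p = q - e and g = Ie. Then e - g lies in W and vanishes
near the element, so K(q,e) = K(q,g) and K(e,e) = K(q,g) - K(p,e). Here g lives in a strip, and p
interacts with e only in the strip where η varies. A second cut-off χ, equal to 1 around that strip,
is inserted because K is comparable with L only for whole functions of V, not locally: the energies
of χq, χp and χe are taken globally and still see only the strip. -/
lemma IsAdmissible.quadL_cut_le (h : G.IsAdmissible Γ R₀ ρ σ ν i) (hα : 0 < α) (hαβ : α ≤ β)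
    (hK : K.IsBoundedCoercive Γ α β) (t : Fin d → Fin (2 ^ i)) {q : G.VHat}
    (hq : q ∈ G.fineSub Γ i)
    (horth : ∀ w ∈ G.fineSub Γ i,
      (∀ x : G.nodes, relDist i t (x : EuclideanSpace ℝ (Fin d)) ≤ 1 → w x = 0) →
        K.form q w = 0) {m : ℝ} (hm : 4 ≤ m) :
    G.quadL (unitCube d) (G.cut i t m * q) ≤
      stepConst d σ ν α β * G.quadL (strip i t (m - 19) (m + 21)) q := by
  have hβ : 0 < β := hα.trans_le hαβ
  have hqV : q ∈ G.V Γ := fineSub_le_V hq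
  have hIq : G.interp Γ i q = 0 := (mem_fineSub.1 hq).2
  have hC := h.cutConst_pos
  have hCi := h.interpConst_nonneg
  set η := G.cut i t m with hη
  set χ := G.stripCut i t m with hχ
  set g := G.interp Γ i (η * q) with hg
  set p := (1 - η) * q with hp
  set e := η * q with he
  set X := G.quadL (strip i t (m - 19) (m + 21)) q with hX
  have heV : e ∈ G.V Γ := mul_mem_V η hqV
  have hpV : p ∈ G.V Γ := mul_mem_V _ hqV
  have hgV : g ∈ G.V Γ := h.interp_mem_V _
  have hgsupp : ∀ x : G.nodes, g x ≠ 0 → m - 2 ≤ relDist i t x ∧ relDist i t x ≤ m + 3 :=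
    fun x hx => h.relDist_of_interp_cut_ne_zero hIq hx
  have hesupp : ∀ x : G.nodes, e x ≠ 0 → m < relDist i t x := fun x hx =>
    lt_relDist_of_cut_ne_zero (left_ne_zero_of_mul hx)
  have hpsupp : ∀ x : G.nodes, p x ≠ 0 → relDist i t x < m + 1 := fun x hx =>
    relDist_lt_of_cut_ne_one fun h1 => left_ne_zero_of_mul hx (sub_eq_zero.2 h1.symm)
  have hχsupp : ∀ x : G.nodes, (1 - χ) x ≠ 0 →
      relDist i t x < m - 3 ∨ m + 4 < relDist i t x := fun x hx =>
    relDist_of_stripCut_ne_one fun h1 => hx (sub_eq_zero.2 h1.symm)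
  -- the four local bounds
  have hstrip : ∀ θ : G.VHat, IsCutoff i θ → (∀ x, θ x ≠ 0 → χ x ≠ 0) →
      G.quadL (unitCube d) (θ * q) ≤ cutConst d σ ν * X := by
    intro θ hθ hsupp
    refine (quadL_unitCube_eq_of_support (A := strip i t (m - 5) (m + 6)) ?_).trans
      ((h.quadL_mul_le hθ hq (strip_near (by linarith) (by linarith))))
    intro x y hxy hy
    have h1 := relDist_of_stripCut_ne_zero (hsupp y (left_ne_zero_of_mul hy))
    have h2 := h.abs_relDist_sub_le_of_adj t hxy
    exact ⟨by linarith [h1.1, h2.2], by linarith [h1.2, h2.1]⟩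
  have b1 : G.quadL (unitCube d) (χ * q) ≤ cutConst d σ ν * X :=
    hstrip χ (isCutoff_stripCut t m) fun _ hx => hx
  have b2 : G.quadL (unitCube d) (χ * e) ≤ cutConst d σ ν * X := by
    have := hstrip (χ * η) (isCutoff_stripCut_mul_cut t m) fun x hx => left_ne_zero_of_mul hx
    rwa [mul_assoc] at this
  have b3 : G.quadL (unitCube d) (χ * p) ≤ cutConst d σ ν * X := by
    have := hstrip (χ * (1 - η)) (isCutoff_stripCut_mul_one_sub_cut t m)
      fun x hx => left_ne_zero_of_mul hx
    rwa [mul_assoc] at this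
  -- Two enlargements by 8, for the interpolation and for the cut-off, lead from (m-3, m+4) to
  -- (m-11, m+12) and to at most (m-19, m+21), a strip of width 40.
  have b4 : G.quadL (unitCube d) g ≤ 15 ^ d * interpConst d σ ν * (cutConst d σ ν * X) := by
    refine (quadL_unitCube_eq_of_support (A := strip i t (m - 3) (m + 4)) ?_).trans
      ((h.quadL_interp_le_of_near heV
        (strip_near (a' := m - 11) (b' := m + 12) (by linarith) (by linarith))).trans
        (mul_le_mul_of_nonneg_left (h.quadL_mul_le (isCutoff_cut t m) hq
          (strip_near (by linarith) (by linarith))) (by positivity)))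
    intro x y hxy hy
    have h1 := hgsupp y hy
    have h2 := h.abs_relDist_sub_le_of_adj t hxy
    exact ⟨by linarith [h1.1, h2.2], by linarith [h1.2, h2.1]⟩
  -- the identity
  have z1 : K.bilin q (e - g) = 0 := by
    refine horth (e - g) (mem_fineSub.2 ⟨Submodule.sub_mem _ heV hgV, ?_⟩) fun x hx => ?_
    · rw [← interpLin_apply, map_sub, interpLin_apply, interpLin_apply,
        h.interp_of_mem_VH (interp_mem_VH _), ← hg, sub_self]
    · have h1 : e x = 0 := by
        by_contra h0
        linarith [hesupp x h0]
      have h2 : g x = 0 := by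
        by_contra h0
        linarith [(hgsupp x h0).1]
      simp [h1, h2]
  have z2 : K.bilin ((1 - χ) * q) g = 0 := by
    refine h.form_eq_zero_of_separated K t fun y z hy hz => ?_
    have h1 := hχsupp y (left_ne_zero_of_mul hy)
    have h2 := hgsupp z hz
    rcases h1 with h1 | h1
    · exact Or.inl (by linarith [h2.1])
    · exact Or.inr (by linarith [h2.2])
  have z3 : K.bilin (χ * p) ((1 - χ) * e) = 0 := by
    refine h.form_eq_zero_of_separated K t fun y z hy hz => ?_
    have h1 := hpsupp y (right_ne_zero_of_mul hy)
    have h2 := hχsupp z (left_ne_zero_of_mul hz)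
    have h3 := hesupp z (right_ne_zero_of_mul hz)
    left
    rcases h2 with h2 | h2 <;> linarith
  have z4 : K.bilin ((1 - χ) * p) e = 0 := by
    refine h.form_eq_zero_of_separated K t fun y z hy hz => ?_
    have h1 := hpsupp y (right_ne_zero_of_mul hy)
    have h2 := hχsupp y (left_ne_zero_of_mul hy)
    have h3 := hesupp z hz
    left
    rcases h2 with h2 | h2 <;> linarith
  have hid : K.bilin e e = K.bilin (χ * q) g - K.bilin (χ * p) (χ * e) := by
    have e1 : e = q - p := by rw [he, hp]; ring
    have e2 : χ * q = q - (1 - χ) * q := by ring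
    have e3 : χ * p = p - (1 - χ) * p := by ring
    have e4 : e = χ * e + (1 - χ) * e := by ring
    have s1 : K.bilin e e = K.bilin q e - K.bilin p e := by
      conv_lhs => rw [e1, LinearMap.map_sub₂, ← e1]
    have s2 : K.bilin q e = K.bilin q g := by
      rw [map_sub] at z1; linarith
    have s3 : K.bilin (χ * q) g = K.bilin q g := by
      rw [e2, LinearMap.map_sub₂, z2, sub_zero]
    have s4 : K.bilin p e = K.bilin (χ * p) e := by
      conv_rhs => rw [e3, LinearMap.map_sub₂, z4, sub_zero]
    have s5 : K.bilin (χ * p) e = K.bilin (χ * p) (χ * e) := by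
      conv_lhs => rw [e4, map_add, z3, add_zero]
    rw [s1, s2, s3, s4, s5]
  have hKPSD := K.isPSDForm_bilin
  have k1 := hKPSD.abs_apply_le_half (χ * q) g
  have k2 := hKPSD.abs_apply_le_half (χ * p) (χ * e)
  have k3 := (hK e heV).1
  have u1 := (hK _ (mul_mem_V χ hqV)).2
  have u2 := (hK _ hgV).2
  have u3 := (hK _ (mul_mem_V χ hpV)).2
  have u4 := (hK _ (mul_mem_V χ heV)).2
  rw [← K.bilin_apply] at k3 u1 u2 u3 u4
  have k4 := le_abs_self (K.bilin (χ * q) g)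
  have k5 := neg_abs_le (K.bilin (χ * p) (χ * e))
  have k6 : α * G.quadL (unitCube d) e ≤ β / 2 * (G.quadL (unitCube d) (χ * q) +
      G.quadL (unitCube d) g + G.quadL (unitCube d) (χ * p) + G.quadL (unitCube d) (χ * e)) := by
    linarith
  have k7 : α * G.quadL (unitCube d) e ≤
      β / 2 * (cutConst d σ ν * (3 + 15 ^ d * interpConst d σ ν) * X) := by
    refine k6.trans (mul_le_mul_of_nonneg_left ?_ (by positivity))
    linarith
  calc G.quadL (unitCube d) e ≤
        β / 2 * (cutConst d σ ν * (3 + 15 ^ d * interpConst d σ ν) * X) / α := by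
        rw [le_div_iff₀ hα]; linarith
    _ = stepConst d σ ν α β * X := by
        unfold stepConst; field_simp

/-- The decay rate. -/
noncomputable def decayRate (d : ℕ) (σ ν α β : ℝ) : ℝ :=
  stepConst d σ ν α β / (1 + stepConst d σ ν α β)

lemma quadL_outside_add (t : Fin d → Fin (2 ^ i)) {a b : ℝ} (hab : a ≤ b) (q : G.VHat) :
    G.quadL (outside i t a) q = G.quadL (strip i t a b) q + G.quadL (outside i t b) q := by
  classical
  simp only [quadL_eq, sumOver_eq_sum_ite]
  rw [← Finset.sum_add_distrib]
  refine Finset.sum_congr rfl fun x _ => ?_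
  by_cases h1 : (x : EuclideanSpace ℝ (Fin d)) ∈ outside i t b
  · have h2 : (x : EuclideanSpace ℝ (Fin d)) ∈ outside i t a := hab.trans h1
    have h3 : (x : EuclideanSpace ℝ (Fin d)) ∉ strip i t a b := fun h => h.2.not_ge h1
    rw [if_pos h1, if_pos h2, if_neg h3, zero_add]
  · rw [if_neg h1, add_zero]
    by_cases h2 : (x : EuclideanSpace ℝ (Fin d)) ∈ outside i t a
    · rw [if_pos h2, if_pos ⟨h2, lt_of_not_ge h1⟩]
    · rw [if_neg h2, if_neg fun h => h2 h.1]

/-- Hole filling. Cut at r + 19: beyond r + 40 the cut function agrees with q, also at the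
neighbours, so the energy E satisfies E(r+40) ≤ D (E(r) - E(r+40)). Moving the last term to the left
gives the rate D/(1+D) < 1. -/
lemma IsAdmissible.quadL_outside_step (h : G.IsAdmissible Γ R₀ ρ σ ν i) (hα : 0 < α) (hαβ : α ≤ β)
    (hK : K.IsBoundedCoercive Γ α β) (t : Fin d → Fin (2 ^ i)) {q : G.VHat}
    (hq : q ∈ G.fineSub Γ i)
    (horth : ∀ w ∈ G.fineSub Γ i,
      (∀ x : G.nodes, relDist i t (x : EuclideanSpace ℝ (Fin d)) ≤ 1 → w x = 0) →
        K.form q w = 0) {r : ℝ} (hr : 0 ≤ r) :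
    G.quadL (outside i t (r + 40)) q ≤
      decayRate d σ ν α β * G.quadL (outside i t r) q := by
  have h1 := h.quadL_cut_le hα hαβ hK t hq horth (m := r + 19) (by linarith)
  have hD := h.stepConst_pos hα hαβ
  set D := stepConst d σ ν α β with hDdef
  have e1 : r + 19 - 19 = r := by ring
  have e2 : r + 19 + 21 = r + 40 := by ring
  rw [e1, e2] at h1
  have h2 := quadL_outside_add (G := G) t (show r ≤ r + 40 by linarith) q
  have h3 : G.quadL (outside i t (r + 40)) q ≤
      G.quadL (unitCube d) (G.cut i t (r + 19) * q) := by
    have : G.quadL (outside i t (r + 40)) q =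
        G.quadL (outside i t (r + 40)) (G.cut i t (r + 19) * q) := by
      refine sumOver_congr fun x hx => ?_
      have hx' : r + 40 ≤ relDist i t (x : EuclideanSpace ℝ (Fin d)) := hx
      have hone : ∀ y : G.nodes, (y = x ∨ G.graph.Adj x y) → G.cut i t (r + 19) y = 1 := by
        intro y hy
        have := h.abs_relDist_sub_le_of_adj t hy
        exact ramp_of_one_le (by linarith [this.1])
      refine G.nodeL_congr ?_ fun y hy => ?_
      · simp [hone x (Or.inl rfl)]
      · simp [hone y (Or.inr hy)]
    rw [this]
    exact sumOver_mono (fun x _ => G.nodes_subset x x.2) fun x _ => G.nodeL_nonneg _ x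
  unfold decayRate
  rw [← hDdef, div_mul_eq_mul_div, le_div_iff₀ (by linarith)]
  nlinarith

lemma IsAdmissible.quadL_outside_le (h : G.IsAdmissible Γ R₀ ρ σ ν i) (hα : 0 < α) (hαβ : α ≤ β)
    (hK : K.IsBoundedCoercive Γ α β) (t : Fin d → Fin (2 ^ i)) {q : G.VHat}
    (hq : q ∈ G.fineSub Γ i)
    (horth : ∀ w ∈ G.fineSub Γ i,
      (∀ x : G.nodes, relDist i t (x : EuclideanSpace ℝ (Fin d)) ≤ 1 → w x = 0) →
        K.form q w = 0) (n : ℕ) :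
    G.quadL (outside i t (40 * n)) q ≤
      decayRate d σ ν α β ^ n * G.quadL (unitCube d) q := by
  have hD := h.stepConst_pos hα hαβ
  have hγ : 0 ≤ decayRate d σ ν α β := div_nonneg hD.le (by linarith)
  induction n with
  | zero =>
    rw [pow_zero, one_mul]
    exact sumOver_mono (fun x _ => G.nodes_subset x x.2) fun x _ => G.nodeL_nonneg _ x
  | succ n ih =>
    have h1 := h.quadL_outside_step hα hαβ hK t hq horth (r := 40 * n) (by positivity)
    have e : 40 * ((n + 1 : ℕ) : ℝ) = 40 * n + 40 := by push_cast; ring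
    rw [e, pow_succ']
    refine h1.trans ?_
    rw [mul_assoc]
    exact mul_le_mul_of_nonneg_left ih hγ

/-! ### Localization of the correctors -/

/-- The element corrector without localization. -/
noncomputable def LocalOperator.idealElementCorrector (K : G.LocalOperator)
    (Γ : Set (EuclideanSpace ℝ (Fin d))) (i : ℕ) (t : Fin d → Fin (2 ^ i)) (v : G.VHat) : G.VHat :=
  K.solveIn (G.fineSub Γ i) (K.bilinOn (element i t) v)

lemma IsAdmissible.idealElementCorrector_spec (h : G.IsAdmissible Γ R₀ ρ σ ν i) (hα : 0 < α)
    (hK : K.IsBoundedCoercive Γ α β) (t : Fin d → Fin (2 ^ i)) (v : G.VHat) :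
    K.idealElementCorrector Γ i t v ∈ G.fineSub Γ i ∧ ∀ w ∈ G.fineSub Γ i,
      K.form (K.idealElementCorrector Γ i t v) w = K.formOn (element i t) v w :=
  h.solveIn_spec hα hK fineSub_le_V _

lemma IsAdmissible.elementCorrector_spec (h : G.IsAdmissible Γ R₀ ρ σ ν i) (hα : 0 < α)
    (hK : K.IsBoundedCoercive Γ α β) (k : ℕ) (t : Fin d → Fin (2 ^ i)) (v : G.VHat) :
    K.elementCorrector Γ i k t v ∈ G.fineSubOn Γ i k (element i t) ∧
      ∀ w ∈ G.fineSubOn Γ i k (element i t),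
        K.form (K.elementCorrector Γ i k t v) w = K.formOn (element i t) v w := by
  have := h.solveIn_spec hα hK ((fineSubOn_le (i := i) k (element i t)).trans fineSub_le_V)
    (K.bilinOn (element i t) v)
  rw [coe_fineSubOn] at this
  exact this

/-- The constant of the localization estimate. -/
noncomputable def localConst (d : ℕ) (σ ν α β : ℝ) : ℝ :=
  β / α * ((2 + 2 * (15 ^ d * interpConst d σ ν)) * cutConst d σ ν)

lemma IsAdmissible.localConst_nonneg (h : G.IsAdmissible Γ R₀ ρ σ ν i) (hα : 0 < α)
    (hαβ : α ≤ β) : 0 ≤ localConst d σ ν α β := by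
  have h1 := h.cutConst_pos
  have h2 := h.interpConst_nonneg
  have h3 : 0 < β := hα.trans_le hαβ
  unfold localConst
  positivity

/-- The truncated corrector is the Galerkin approximation of the ideal one, so its error is at most
that of the ideal corrector cut off near relative distance k and put back into W. That competitor
differs from q only where q has decayed. The energy of q is at most (K_T v, v), by testing its own
equation and absorbing half of K(q,q). -/
lemma IsAdmissible.elementCorrector_error (h : G.IsAdmissible Γ R₀ ρ σ ν i) (hα : 0 < α)
    (hαβ : α ≤ β) (hK : K.IsBoundedCoercive Γ α β) (k : ℕ) (t : Fin d → Fin (2 ^ i))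
    (v : G.VHat) :
    K.norm (K.idealElementCorrector Γ i t v - K.elementCorrector Γ i k t v) ^ 2 ≤
      localConst d σ ν α β * decayRate d σ ν α β ^ ((k - 12) / 40) *
        K.formOn (element i t) v v := by
  have hβ : 0 < β := hα.trans_le hαβ
  have hH := meshSize_pos i
  have hCi := h.interpConst_nonneg
  have hC := h.cutConst_pos
  obtain ⟨hq, hqs⟩ := h.idealElementCorrector_spec hα hK t v
  obtain ⟨hqk, hqks⟩ := h.elementCorrector_spec hα hK k t v
  set q := K.idealElementCorrector Γ i t v with hqdef
  set qk := K.elementCorrector Γ i k t v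
  have hKPSD := K.isPSDForm_bilin
  have hqV : q ∈ G.V Γ := fineSub_le_V hq
  have hIq : G.interp Γ i q = 0 := (mem_fineSub.1 hq).2
  -- size of the ideal corrector
  have hsize : K.form q q ≤ K.formOn (element i t) v v := by
    have h1 := (K.isPSDForm_bilinOn (element i t)).abs_apply_le_half v q
    have h2 := K.formOn_mono (element i t) q
    have h3 := hqs q hq
    have h4 := le_abs_self (K.bilinOn (element i t) v q)
    rw [K.bilinOn_apply] at h1 h4
    rw [K.bilinOn_apply, K.bilinOn_apply] at h1
    linarith
  have horth : ∀ w ∈ G.fineSub Γ i,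
      (∀ x : G.nodes, relDist i t (x : EuclideanSpace ℝ (Fin d)) ≤ 1 → w x = 0) →
        K.form q w = 0 := by
    intro w hw hw0
    rw [hqs w hw]
    refine sumOver_eq_zero fun x hx => K.node_eq_zero x fun y z _ hz => Or.inr (hw0 z ?_)
    have h1 := (h.abs_relDist_sub_le_of_adj t hz).2
    have h2 : relDist i t (x : EuclideanSpace ℝ (Fin d)) ≤ 1 / 2 := by
      unfold relDist
      rw [div_le_iff₀ hH]
      linarith [supDist_le_of_mem_element hx]
    linarith
  -- the cut-off competitor
  set m : ℝ := k - 3 with hm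
  set η := G.cut i t m with hη
  set p := (1 - η) * q with hp
  set e := η * q with he
  have heV : e ∈ G.V Γ := mul_mem_V η hqV
  have hpV : p ∈ G.V Γ := mul_mem_V _ hqV
  have hpe : p = q - e := by rw [hp, he]; ring
  have hIp : G.interp Γ i p = -G.interp Γ i e := by
    rw [hpe, ← interpLin_apply, map_sub, interpLin_apply, interpLin_apply, hIq, zero_sub]
  -- Subtracting the interpolant restores membership in W but enlarges the support to relative
  -- distance m + 3 = k, which explains the choice m = k - 3.
  set w := p - G.interp Γ i p with hw
  have hwW : w ∈ G.fineSub Γ i := by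
    refine mem_fineSub.2 ⟨Submodule.sub_mem _ hpV (h.interp_mem_V _), ?_⟩
    rw [← interpLin_apply, map_sub, interpLin_apply, interpLin_apply,
      h.interp_of_mem_VH (interp_mem_VH _), sub_self]
  have hwk : w ∈ G.fineSubOn Γ i k (element i t) := by
    refine ⟨hwW, fun x hx => ?_⟩
    by_contra h0
    refine hx (mem_patchIter_of_supDist_le (G.nodes_subset x x.2) ?_)
    have hd : relDist i t (x : EuclideanSpace ℝ (Fin d)) ≤ k := by
      by_contra hc
      push Not at hc
      refine h0 ?_
      have h1 : p x = 0 := by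
        have : η x = 1 := ramp_of_one_le (by linarith)
        simp [hp, this]
      have h2 : G.interp Γ i p x = 0 := by
        rw [hIp, Pi.neg_apply, neg_eq_zero]
        by_contra h3
        linarith [(h.relDist_of_interp_cut_ne_zero hIq h3).2]
      simp [hw, h1, h2]
    unfold relDist at hd
    rwa [div_le_iff₀ hH] at hd
  have hqw : q - w = e - G.interp Γ i e := by
    rw [hw, hIp, hpe]; abel
  have hgal : K.norm (q - qk) ≤ K.norm (q - w) :=
    hKPSD.energyNorm_sub_le_of_orthogonal hqk
      (fun s hs => (hqks s hs).trans (hqs s (fineSubOn_le _ _ hs)).symm) hwk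
  have hb1 : G.quadL (unitCube d) (e - G.interp Γ i e) ≤
      (2 + 2 * (15 ^ d * interpConst d σ ν)) * G.quadL (unitCube d) e := by
    have h1 := G.quadL_sub_le (unitCube d) e (G.interp Γ i e)
    have h2 := h.quadL_interp_le heV
    linarith
  have hb2 : G.quadL (unitCube d) e ≤ cutConst d σ ν * G.quadL (outside i t (k - 12)) q := by
    refine (quadL_unitCube_eq_of_support (A := outside i t (k - 4)) ?_).trans
      (h.quadL_mul_le (isCutoff_cut t m) hq ?_)
    · intro x y hxy hy
      have h1 := lt_relDist_of_cut_ne_zero (left_ne_zero_of_mul hy)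
      have h2 := (h.abs_relDist_sub_le_of_adj t hxy).2
      change (k : ℝ) - 4 ≤ relDist i t (x : EuclideanSpace ℝ (Fin d))
      linarith
    · intro z hz x hx
      rw [supDist_comm] at hx
      have h1 := relDist_le_add t hx
      have hz' : (k : ℝ) - 4 ≤ relDist i t z := hz
      change (k : ℝ) - 12 ≤ relDist i t (x : EuclideanSpace ℝ (Fin d))
      linarith
  have hb3 : G.quadL (outside i t (k - 12)) q ≤
      decayRate d σ ν α β ^ ((k - 12) / 40) * G.quadL (unitCube d) q := by
    refine le_trans (sumOver_mono (fun x hx => ?_) fun x _ => G.nodeL_nonneg _ x)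
      (h.quadL_outside_le hα hαβ hK t hq horth ((k - 12) / 40))
    have hx' : (k : ℝ) - 12 ≤ relDist i t (x : EuclideanSpace ℝ (Fin d)) := hx
    change 40 * (((k - 12) / 40 : ℕ) : ℝ) ≤ relDist i t (x : EuclideanSpace ℝ (Fin d))
    -- For k < 12 the truncated subtraction makes the exponent 0, and the claim is the trivial bound
    -- by the full energy.
    rcases le_or_gt 12 k with hk | hk
    · have h1 : 40 * ((k - 12) / 40) + 12 ≤ k := by omega
      have h2 : 40 * (((k - 12) / 40 : ℕ) : ℝ) + 12 ≤ k := by exact_mod_cast h1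
      linarith
    · have h1 : (k - 12) / 40 = 0 := by omega
      rw [h1]
      simpa using relDist_nonneg t _
  have hL := (hK q hqV).1
  have hfin : K.norm (q - w) ^ 2 ≤ β * ((2 + 2 * (15 ^ d * interpConst d σ ν)) *
      (cutConst d σ ν * (decayRate d σ ν α β ^ ((k - 12) / 40) *
        (K.formOn (element i t) v v / α)))) := by
    have hD := h.stepConst_pos hα hαβ
    have hγ : 0 ≤ decayRate d σ ν α β := div_nonneg hD.le (by linarith)
    rw [K.norm_eq, hKPSD.energyNorm_sq, K.bilin_apply, hqw]
    refine ((hK _ (Submodule.sub_mem _ heV (h.interp_mem_V _))).2).trans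
      (mul_le_mul_of_nonneg_left (hb1.trans (mul_le_mul_of_nonneg_left (hb2.trans
        (mul_le_mul_of_nonneg_left (hb3.trans (mul_le_mul_of_nonneg_left ?_ (by positivity)))
          hC.le)) (by positivity))) hβ.le)
    rw [le_div_iff₀ hα]
    linarith
  calc K.norm (q - qk) ^ 2 ≤ K.norm (q - w) ^ 2 :=
        pow_le_pow_left₀ (Real.sqrt_nonneg _) hgal 2
    _ ≤ _ := hfin
    _ = _ := by unfold localConst; field_simp

end SpatialNetwork

namespace SpatialNetwork

variable {d : ℕ} {G : SpatialNetwork d} {Γ : Set (EuclideanSpace ℝ (Fin d))} {R₀ ρ σ ν : ℝ}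
  {i : ℕ} {K : G.LocalOperator} {α β : ℝ}

/-! ### The localized multiscale space and its Ritz projection -/

/-- The elements partition `Ω`, so the element forms add up to `K`. -/
lemma sum_formOn_element (K : G.LocalOperator) (i : ℕ) (u v : G.VHat) :
    ∑ t : Fin d → Fin (2 ^ i), K.formOn (element i t) u v = K.form u v := by
  unfold LocalOperator.form LocalOperator.formOn
  rw [sumOver_eq_sum_fiber fun x : G.nodes => elementIndex i (x : EuclideanSpace ℝ (Fin d))]
  refine Finset.sum_congr rfl fun t _ => ?_
  congr 1
  funext x
  have hx := G.nodes_subset x x.2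
  rw [mem_element_iff hx, eq_iff_iff]
  exact ⟨fun h => ⟨hx, h⟩, fun h => h.2⟩

/-- The sum of the element correctors without localization. -/
noncomputable def LocalOperator.idealCorrector (K : G.LocalOperator)
    (Γ : Set (EuclideanSpace ℝ (Fin d))) (i : ℕ) (v : G.VHat) : G.VHat :=
  ∑ t : Fin d → Fin (2 ^ i), K.idealElementCorrector Γ i t v

namespace IsAdmissible

lemma idealCorrector_mem (h : G.IsAdmissible Γ R₀ ρ σ ν i) (hα : 0 < α)
    (hK : K.IsBoundedCoercive Γ α β) (v : G.VHat) : K.idealCorrector Γ i v ∈ G.fineSub Γ i :=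
  Submodule.sum_mem _ fun t _ => (h.idealElementCorrector_spec hα hK t v).1

lemma form_idealCorrector (h : G.IsAdmissible Γ R₀ ρ σ ν i) (hα : 0 < α)
    (hK : K.IsBoundedCoercive Γ α β) (v : G.VHat) {w : G.VHat} (hw : w ∈ G.fineSub Γ i) :
    K.form (K.idealCorrector Γ i v) w = K.form v w := by
  rw [← sum_formOn_element K i v w, ← K.bilin_apply, LocalOperator.idealCorrector, map_sum,
    LinearMap.sum_apply]
  exact Finset.sum_congr rfl fun t _ => (h.idealElementCorrector_spec hα hK t v).2 w hw

lemma corrector_mem (h : G.IsAdmissible Γ R₀ ρ σ ν i) (hα : 0 < α)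
    (hK : K.IsBoundedCoercive Γ α β) (k : ℕ) (v : G.VHat) :
    K.corrector Γ i k v ∈ G.fineSub Γ i :=
  Submodule.sum_mem _ fun t _ => fineSubOn_le k _ (h.elementCorrector_spec hα hK k t v).1

lemma decayRate_nonneg (h : G.IsAdmissible Γ R₀ ρ σ ν i) (hα : 0 < α) (hαβ : α ≤ β) :
    0 ≤ decayRate d σ ν α β := by
  have hD := h.stepConst_pos hα hαβ
  exact div_nonneg hD.le (by linarith)

/-- The triangle inequality and Cauchy–Schwarz over all elements lose their number 2^{id} = H^{-d}.
This avoids any use of finite overlap, and the loss is harmless: the decay factor beats every power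
of H once k is a large multiple of log(1/H). -/
lemma corrector_error (h : G.IsAdmissible Γ R₀ ρ σ ν i) (hα : 0 < α) (hαβ : α ≤ β)
    (hK : K.IsBoundedCoercive Γ α β) (k : ℕ) (v : G.VHat) :
    K.norm (K.idealCorrector Γ i v - K.corrector Γ i k v) ^ 2 ≤
      localConst d σ ν α β * (decayRate d σ ν α β ^ ((k - 12) / 40) * ((2 : ℝ) ^ i) ^ d) *
        K.norm v ^ 2 := by
  have hKPSD := K.isPSDForm_bilin
  rw [LocalOperator.idealCorrector, LocalOperator.corrector, ← Finset.sum_sub_distrib]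
  calc _ ≤ (∑ t : Fin d → Fin (2 ^ i),
          K.norm (K.idealElementCorrector Γ i t v - K.elementCorrector Γ i k t v)) ^ 2 :=
        pow_le_pow_left₀ (Real.sqrt_nonneg _) (hKPSD.energyNorm_sum_le _ _) 2
    _ ≤ (Finset.univ : Finset (Fin d → Fin (2 ^ i))).card * ∑ t : Fin d → Fin (2 ^ i),
          K.norm (K.idealElementCorrector Γ i t v - K.elementCorrector Γ i k t v) ^ 2 :=
        sq_sum_le_card_mul_sum_sq
    _ ≤ ((2 : ℝ) ^ i) ^ d * ∑ t : Fin d → Fin (2 ^ i), localConst d σ ν α β *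
          decayRate d σ ν α β ^ ((k - 12) / 40) * K.formOn (element i t) v v := by
        have hc : ((Finset.univ : Finset (Fin d → Fin (2 ^ i))).card : ℝ) = ((2 : ℝ) ^ i) ^ d := by
          simp
        rw [hc]
        exact mul_le_mul_of_nonneg_left
          (Finset.sum_le_sum fun t _ => h.elementCorrector_error hα hαβ hK k t v) (by positivity)
    _ = _ := by
        rw [← Finset.mul_sum, sum_formOn_element, K.norm_eq, hKPSD.energyNorm_sq, K.bilin_apply]
        ring

/-- The corrector is an `epsilon` choice, so linearity has to be derived from uniqueness of the
Galerkin solution. -/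
lemma elementCorrector_add (h : G.IsAdmissible Γ R₀ ρ σ ν i) (hα : 0 < α)
    (hK : K.IsBoundedCoercive Γ α β) (k : ℕ) (t : Fin d → Fin (2 ^ i)) (u v : G.VHat) :
    K.elementCorrector Γ i k t (u + v) =
      K.elementCorrector Γ i k t u + K.elementCorrector Γ i k t v := by
  have hu := h.elementCorrector_spec hα hK k t u
  have hv := h.elementCorrector_spec hα hK k t v
  have huv := h.elementCorrector_spec hα hK k t (u + v)
  refine h.eq_of_forall_form_eq hα hK ((fineSubOn_le k (element i t)).trans fineSub_le_V) huv.1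
    (Submodule.add_mem _ hu.1 hv.1) fun w hw => ?_
  rw [huv.2 w hw, ← K.bilin_apply, LinearMap.map_add₂, K.bilin_apply, K.bilin_apply, hu.2 w hw,
    hv.2 w hw, ← K.bilinOn_apply, LinearMap.map_add₂]
  rfl

lemma elementCorrector_smul (h : G.IsAdmissible Γ R₀ ρ σ ν i) (hα : 0 < α)
    (hK : K.IsBoundedCoercive Γ α β) (k : ℕ) (t : Fin d → Fin (2 ^ i)) (c : ℝ) (v : G.VHat) :
    K.elementCorrector Γ i k t (c • v) = c • K.elementCorrector Γ i k t v := by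
  have hv := h.elementCorrector_spec hα hK k t v
  have hcv := h.elementCorrector_spec hα hK k t (c • v)
  refine h.eq_of_forall_form_eq hα hK ((fineSubOn_le k (element i t)).trans fineSub_le_V) hcv.1
    (Submodule.smul_mem _ c hv.1) fun w hw => ?_
  rw [hcv.2 w hw, ← K.bilin_apply, LinearMap.map_smul₂, K.bilin_apply, hv.2 w hw,
    ← K.bilinOn_apply, LinearMap.map_smul₂]
  rfl

/-- The map `v ↦ v - Q_k v` as a linear map. -/
noncomputable def msMap (h : G.IsAdmissible Γ R₀ ρ σ ν i) (hα : 0 < α)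
    (hK : K.IsBoundedCoercive Γ α β) (k : ℕ) : G.VHat →ₗ[ℝ] G.VHat where
  toFun v := v - K.corrector Γ i k v
  map_add' u v := by
    simp only [LocalOperator.corrector, h.elementCorrector_add hα hK, Finset.sum_add_distrib]
    abel
  map_smul' c v := by
    simp only [LocalOperator.corrector, h.elementCorrector_smul hα hK, ← Finset.smul_sum,
      RingHom.id_apply, smul_sub]

/-- The localized multiscale space as a submodule. -/
noncomputable def msSub (h : G.IsAdmissible Γ R₀ ρ σ ν i) (hα : 0 < α)
    (hK : K.IsBoundedCoercive Γ α β) (k : ℕ) : Submodule ℝ G.VHat :=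
  (G.VH Γ i).map (h.msMap hα hK k)

lemma coe_msSub (h : G.IsAdmissible Γ R₀ ρ σ ν i) (hα : 0 < α)
    (hK : K.IsBoundedCoercive Γ α β) (k : ℕ) :
    (h.msSub hα hK k : Set G.VHat) = K.msSpace Γ i k := by
  ext w
  constructor
  · rintro ⟨v, hv, rfl⟩
    exact ⟨v, hv, rfl⟩
  · rintro ⟨v, hv, rfl⟩
    exact ⟨v, hv, rfl⟩

lemma msSub_le_V (h : G.IsAdmissible Γ R₀ ρ σ ν i) (hα : 0 < α)
    (hK : K.IsBoundedCoercive Γ α β) (k : ℕ) : h.msSub hα hK k ≤ G.V Γ := by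
  rintro _ ⟨v, hv, rfl⟩
  exact Submodule.sub_mem _ (h.VH_le_V hv) (fineSub_le_V (h.corrector_mem hα hK k v))

lemma ritz_spec (h : G.IsAdmissible Γ R₀ ρ σ ν i) (hα : 0 < α)
    (hK : K.IsBoundedCoercive Γ α β) (k : ℕ) (v : G.VHat) :
    K.ritz Γ i k v ∈ h.msSub hα hK k ∧
      ∀ w ∈ h.msSub hα hK k, K.form (K.ritz Γ i k v) w = K.form v w := by
  have := h.solveIn_spec hα hK (h.msSub_le_V hα hK k) (K.bilin v)
  rw [coe_msSub] at this
  exact this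

/-- The Ritz projection as a linear map. -/
noncomputable def ritzLin (h : G.IsAdmissible Γ R₀ ρ σ ν i) (hα : 0 < α)
    (hK : K.IsBoundedCoercive Γ α β) (k : ℕ) : G.VHat →ₗ[ℝ] G.VHat where
  toFun := K.ritz Γ i k
  map_add' u v := by
    have hu := h.ritz_spec hα hK k u
    have hv := h.ritz_spec hα hK k v
    have huv := h.ritz_spec hα hK k (u + v)
    refine h.eq_of_forall_form_eq hα hK (h.msSub_le_V hα hK k) huv.1
      (Submodule.add_mem _ hu.1 hv.1) fun w hw => ?_
    rw [huv.2 w hw, ← K.bilin_apply, ← K.bilin_apply, LinearMap.map_add₂, LinearMap.map_add₂,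
      K.bilin_apply (K.ritz Γ i k u), K.bilin_apply (K.ritz Γ i k v), hu.2 w hw, hv.2 w hw]
    rfl
  map_smul' c v := by
    have hv := h.ritz_spec hα hK k v
    have hcv := h.ritz_spec hα hK k (c • v)
    refine h.eq_of_forall_form_eq hα hK (h.msSub_le_V hα hK k) hcv.1
      (Submodule.smul_mem _ c hv.1) fun w hw => ?_
    rw [RingHom.id_apply, hcv.2 w hw, ← K.bilin_apply, ← K.bilin_apply, LinearMap.map_smul₂,
      LinearMap.map_smul₂, K.bilin_apply (K.ritz Γ i k v), hv.2 w hw]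
    rfl

/-! ### Error of the Ritz projection -/

/-- `|v|_L ≤ α^{-1/2} |v|_K` on `V`. -/
lemma normL_le (hα : 0 < α) (hK : K.IsBoundedCoercive Γ α β) {v : G.VHat} (hv : v ∈ G.V Γ) :
    G.normL v ≤ K.norm v / √α := by
  rw [le_div_iff₀ (Real.sqrt_pos.2 hα), mul_comm, normL, normLOn, LocalOperator.norm,
    ← Real.sqrt_mul hα.le]
  exact Real.sqrt_le_sqrt (hK v hv).1

lemma normM_le (h : G.IsAdmissible Γ R₀ ρ σ ν i) (hα : 0 < α)
    (hK : K.IsBoundedCoercive Γ α β) {v : G.VHat} (hv : v ∈ G.V Γ) :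
    G.normM v ≤ ν / √α * K.norm v := by
  refine (h.poincare.2.2 v hv).trans ?_
  rw [div_mul_eq_mul_div, mul_div_assoc]
  exact mul_le_mul_of_nonneg_left (normL_le hα hK hv) h.nonneg

/-- Fine-scale functions have small `M`-norm. -/
lemma normM_le_of_mem_fineSub (h : G.IsAdmissible Γ R₀ ρ σ ν i) (hα : 0 < α)
    (hK : K.IsBoundedCoercive Γ α β) {v : G.VHat} (hv : v ∈ G.fineSub Γ i) :
    G.normM v ≤ √(15 ^ d * interpConst d σ ν / α) * meshSize i * K.norm v := by
  have hH := meshSize_pos i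
  have hCi := h.interpConst_nonneg
  have h1 := h.formM_sub_interp_le (fineSub_le_V hv) (A := unitCube d) (B := unitCube d)
    fun _ _ x _ => G.nodes_subset x x.2
  rw [(mem_fineSub.1 hv).2, sub_zero] at h1
  have h2 := (hK v (fineSub_le_V hv)).1
  have h3 : G.formM (unitCube d) v v ≤
      (15 ^ d * interpConst d σ ν / α) * meshSize i ^ 2 * K.form v v := by
    refine h1.trans ?_
    calc _ = (15 ^ d * interpConst d σ ν / α) * meshSize i ^ 2 *
          (α * G.quadL (unitCube d) v) := by field_simp
      _ ≤ _ := mul_le_mul_of_nonneg_left h2 (by positivity)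
  calc G.normM v ≤ √((15 ^ d * interpConst d σ ν / α) * meshSize i ^ 2 * K.form v v) :=
        Real.sqrt_le_sqrt h3
    _ = _ := by
        rw [Real.sqrt_mul (by positivity), Real.sqrt_mul (by positivity), Real.sqrt_sq hH.le]
        rfl

/-- Stability of the interpolation in the energy norm. -/
lemma norm_interp_le (h : G.IsAdmissible Γ R₀ ρ σ ν i) (hα : 0 < α) (hαβ : α ≤ β)
    (hK : K.IsBoundedCoercive Γ α β) {v : G.VHat} (hv : v ∈ G.V Γ) :
    K.norm (G.interp Γ i v) ≤ √(β / α * (15 ^ d * interpConst d σ ν)) * K.norm v := by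
  have hβ := hα.trans_le hαβ
  have hCi := h.interpConst_nonneg
  have h1 := (hK _ (h.interp_mem_V v)).2
  have h2 := h.quadL_interp_le hv
  have h3 := (hK v hv).1
  unfold LocalOperator.norm
  rw [← Real.sqrt_mul (by positivity)]
  refine Real.sqrt_le_sqrt ?_
  calc _ ≤ β * (15 ^ d * interpConst d σ ν * G.quadL (unitCube d) v) :=
        h1.trans (mul_le_mul_of_nonneg_left h2 hβ.le)
    _ = β / α * (15 ^ d * interpConst d σ ν) * (α * G.quadL (unitCube d) v) := by field_simp
    _ ≤ _ := mul_le_mul_of_nonneg_left h3 (by positivity)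

end IsAdmissible

/-- The constant of the error estimate of the Ritz projection. -/
noncomputable def ritzConst (d : ℕ) (σ ν α β s : ℝ) : ℝ :=
  √(15 ^ d * interpConst d σ ν / α) + √(localConst d σ ν α β) * s *
    (√(β / α * (15 ^ d * interpConst d σ ν)) * (ν / √α))

namespace IsAdmissible

lemma ritzConst_nonneg (h : G.IsAdmissible Γ R₀ ρ σ ν i) {s : ℝ} (hs : 0 ≤ s) :
    0 ≤ ritzConst d σ ν α β s := by
  have := h.nonneg
  unfold ritzConst
  positivity

/-- Energy error of the Ritz projection for solutions of elliptic problems. -/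
lemma norm_sub_ritz_le (h : G.IsAdmissible Γ R₀ ρ σ ν i) (hα : 0 < α) (hαβ : α ≤ β)
    (hK : K.IsBoundedCoercive Γ α β) {k : ℕ} {s : ℝ} (hs : 0 ≤ s)
    (hk : √(decayRate d σ ν α β ^ ((k - 12) / 40) * ((2 : ℝ) ^ i) ^ d) ≤ s * meshSize i)
    {z g : G.VHat} (hz : z ∈ G.V Γ)
    (hzg : ∀ v ∈ G.V Γ, K.form z v = G.formM (unitCube d) g v) :
    K.norm (z - K.ritz Γ i k z) ≤ ritzConst d σ ν α β s * meshSize i * G.normM g := by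
  have hH := meshSize_pos i
  have hν := h.nonneg
  have hKPSD := K.isPSDForm_bilin
  have hMPSD := G.isPSDForm_bilinM (unitCube d)
  set Iz := G.interp Γ i z with hIz
  have hIzH : Iz ∈ G.VH Γ i := interp_mem_VH z
  have hIzV : Iz ∈ G.V Γ := h.VH_le_V hIzH
  have hg0 : 0 ≤ G.normM g := Real.sqrt_nonneg _
  -- the part orthogonal to the ideal multiscale space
  set e := z - Iz + K.idealCorrector Γ i Iz with he
  have heW : e ∈ G.fineSub Γ i := by
    refine Submodule.add_mem _ (mem_fineSub.2 ⟨Submodule.sub_mem _ hz hIzV, ?_⟩)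
      (h.idealCorrector_mem hα hK Iz)
    rw [← interpLin_apply, map_sub, interpLin_apply, interpLin_apply, ← hIz,
      h.interp_of_mem_VH hIzH, sub_self]
  have he1 : K.norm e ≤ √(15 ^ d * interpConst d σ ν / α) * meshSize i * G.normM g := by
    refine hKPSD.energyNorm_le_of_apply_le (by positivity) ?_
    -- On W the ideal corrector of Iz acts like Iz itself, so both cancel and only the data g of z
    -- remain.
    have h1 : K.bilin e e = G.formM (unitCube d) g e := by
      rw [← hzg e (fineSub_le_V heW)]
      conv_lhs => rw [he, LinearMap.map_add₂, LinearMap.map_sub₂, ← he]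
      have := h.form_idealCorrector hα hK Iz heW
      rw [K.bilin_apply, K.bilin_apply, K.bilin_apply, this]
      ring
    rw [h1]
    calc _ ≤ G.normM g * G.normM e := hMPSD.apply_le g e
      _ ≤ G.normM g * (√(15 ^ d * interpConst d σ ν / α) * meshSize i * K.norm e) :=
          mul_le_mul_of_nonneg_left (h.normM_le_of_mem_fineSub hα hK heW) hg0
      _ = _ := by rw [K.norm_eq]; ring
  have hz1 : K.norm z ≤ ν / √α * G.normM g := by
    refine hKPSD.energyNorm_le_of_apply_le (by positivity) ?_
    rw [K.bilin_apply, hzg z hz]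
    calc _ ≤ G.normM g * G.normM z := hMPSD.apply_le g z
      _ ≤ G.normM g * (ν / √α * K.norm z) :=
          mul_le_mul_of_nonneg_left (h.normM_le hα hK hz) hg0
      _ = _ := by rw [K.norm_eq]; ring
  have hQ : K.norm (K.idealCorrector Γ i Iz - K.corrector Γ i k Iz) ≤
      √(localConst d σ ν α β) * (s * meshSize i) * K.norm Iz := by
    have h1 := h.corrector_error hα hαβ hK k Iz
    have h2 := h.localConst_nonneg hα hαβ
    have h3 := h.decayRate_nonneg hα hαβ
    calc _ ≤ √(localConst d σ ν α β * (decayRate d σ ν α β ^ ((k - 12) / 40) *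
          ((2 : ℝ) ^ i) ^ d) * K.norm Iz ^ 2) := Real.le_sqrt_of_sq_le h1
      _ = √(localConst d σ ν α β) * √(decayRate d σ ν α β ^ ((k - 12) / 40) *
          ((2 : ℝ) ^ i) ^ d) * K.norm Iz := by
          rw [Real.sqrt_mul (by positivity), Real.sqrt_mul (by positivity),
            Real.sqrt_sq (show 0 ≤ K.norm Iz from Real.sqrt_nonneg _)]
      _ ≤ _ := by
          refine mul_le_mul_of_nonneg_right (mul_le_mul_of_nonneg_left hk ?_) ?_ <;>
            exact Real.sqrt_nonneg _
  have hIz1 := (h.norm_interp_le hα hαβ hK hz).trans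
    (mul_le_mul_of_nonneg_left hz1 (Real.sqrt_nonneg _))
  obtain ⟨hr1, hr2⟩ := h.ritz_spec hα hK k z
  have hopt := hKPSD.energyNorm_sub_le_of_orthogonal (z := z) hr1 hr2
    (w := Iz - K.corrector Γ i k Iz) ⟨Iz, hIzH, rfl⟩
  have hsplit : z - (Iz - K.corrector Γ i k Iz) =
      e - (K.idealCorrector Γ i Iz - K.corrector Γ i k Iz) := by
    rw [he]; abel
  rw [hsplit] at hopt
  have htri := hKPSD.energyNorm_sub_le e (K.idealCorrector Γ i Iz - K.corrector Γ i k Iz)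
  calc K.norm (z - K.ritz Γ i k z) ≤
        K.norm e + K.norm (K.idealCorrector Γ i Iz - K.corrector Γ i k Iz) := hopt.trans htri
    _ ≤ √(15 ^ d * interpConst d σ ν / α) * meshSize i * G.normM g +
        √(localConst d σ ν α β) * (s * meshSize i) *
          (√(β / α * (15 ^ d * interpConst d σ ν)) * (ν / √α * G.normM g)) :=
        add_le_add he1 (hQ.trans (mul_le_mul_of_nonneg_left hIz1 (by positivity)))
    _ = _ := by unfold ritzConst; ring

/-- The `M`-norm error of the Ritz projection, by duality. -/
lemma normM_sub_ritz_le (h : G.IsAdmissible Γ R₀ ρ σ ν i) (hα : 0 < α) (hαβ : α ≤ β)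
    (hK : K.IsBoundedCoercive Γ α β) {k : ℕ} {s : ℝ} (hs : 0 ≤ s)
    (hk : √(decayRate d σ ν α β ^ ((k - 12) / 40) * ((2 : ℝ) ^ i) ^ d) ≤ s * meshSize i)
    {v : G.VHat} (hv : v ∈ G.V Γ) :
    G.normM (v - K.ritz Γ i k v) ≤ ritzConst d σ ν α β s * meshSize i * K.norm v := by
  have hH := meshSize_pos i
  have hKPSD := K.isPSDForm_bilin
  have hMPSD := G.isPSDForm_bilinM (unitCube d)
  have hC := h.ritzConst_nonneg (α := α) (β := β) hs
  obtain ⟨hr1, hr2⟩ := h.ritz_spec hα hK k v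
  set e := v - K.ritz Γ i k v with he
  have heV : e ∈ G.V Γ := Submodule.sub_mem _ hv (h.msSub_le_V hα hK k hr1)
  -- Aubin–Nitsche: z solves the dual problem with data e, so |e|_M² = K(e, z - Pz) by Galerkin
  -- orthogonality. For a general v the factor |e|_K is only bounded by |v|_K, hence a single power
  -- of H.
  obtain ⟨z, hz, hze⟩ := IsPSDForm.exists_solution K.bilin (G.V Γ)
    (fun v hv h0 => h.eq_zero_of_form_eq_zero hα hK hv h0) (G.bilinM (unitCube d) e)
  have h1 := h.norm_sub_ritz_le hα hαβ hK hs hk hz hze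
  obtain ⟨hz1, -⟩ := h.ritz_spec hα hK k z
  have h2 : K.norm e ≤ K.norm v := by
    have := hKPSD.energyNorm_sub_le_of_orthogonal (z := v) hr1 hr2 (Submodule.zero_mem _)
    rwa [sub_zero] at this
  have h3 : K.bilin e (K.ritz Γ i k z) = 0 := by
    rw [he, LinearMap.map_sub₂, K.bilin_apply, K.bilin_apply, hr2 _ hz1, sub_self]
  refine (hMPSD.energyNorm_le_of_apply_le (v := e)
    (a := K.norm e * (ritzConst d σ ν α β s * meshSize i)) (by
      have : 0 ≤ K.norm e := Real.sqrt_nonneg _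
      positivity) ?_).trans ?_
  · rw [← hze e heV, hKPSD.symm, ← sub_zero (K.bilin e z), ← h3, ← map_sub, mul_assoc]
    exact (hKPSD.apply_le _ _).trans (mul_le_mul_of_nonneg_left h1 (Real.sqrt_nonneg _))
  · rw [mul_comm]
    exact mul_le_mul_of_nonneg_left h2 (by positivity)

end IsAdmissible

end SpatialNetwork

section TimeInterval

open Set

/-! ### Calculus on a time interval -/

section Scalar

variable {T : ℝ}

lemma abs_sub_le_integral {φ φ' g : ℝ → ℝ}
    (hφ : ∀ t ∈ Icc 0 T, HasDerivWithinAt φ (φ' t) (Icc 0 T) t)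
    (hφ' : ContinuousOn φ' (Icc 0 T)) (hg : ContinuousOn g (Icc 0 T))
    (hb : ∀ t ∈ Icc 0 T, |φ' t| ≤ g t) {a b : ℝ} (ha : 0 ≤ a) (hab : a ≤ b) (hbT : b ≤ T) :
    |φ b - φ a| ≤ ∫ t in a..b, g t := by
  have hsub : Icc a b ⊆ Icc 0 T := Icc_subset_Icc ha hbT
  have h1 : ∫ t in a..b, φ' t = φ b - φ a := by
    refine intervalIntegral.integral_eq_sub_of_hasDerivAt_of_le hab
      (fun t ht => ((hφ t (hsub ht)).continuousWithinAt).mono hsub) (fun t ht => ?_)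
      ((hφ'.mono hsub).intervalIntegrable_of_Icc hab)
    exact (hφ t (hsub (Ioo_subset_Icc_self ht))).hasDerivAt
      (Icc_mem_nhds (by linarith [ht.1]) (by linarith [ht.2]))
  rw [← h1, ← Real.norm_eq_abs]
  refine intervalIntegral.norm_integral_le_of_norm_le hab (Filter.Eventually.of_forall
    fun t ht => hb t (hsub (Ioc_subset_Icc_self ht)))
    ((hg.mono hsub).intervalIntegrable_of_Icc hab)

lemma integral_le_integral_of_subinterval {g : ℝ → ℝ} (hg : ContinuousOn g (Icc 0 T))
    (h0 : ∀ t ∈ Icc 0 T, 0 ≤ g t) {a b c e : ℝ} (hc : 0 ≤ c) (hca : c ≤ a) (hab : a ≤ b)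
    (hbe : b ≤ e) (he : e ≤ T) : ∫ t in a..b, g t ≤ ∫ t in c..e, g t := by
  have hsub : Icc c e ⊆ Icc 0 T := Icc_subset_Icc hc he
  refine intervalIntegral.integral_mono_interval hca hab hbe ?_
    ((hg.mono hsub).intervalIntegrable_of_Icc (by linarith))
  filter_upwards [MeasureTheory.self_mem_ae_restrict measurableSet_Ioc] with t ht
  exact h0 t (hsub (Ioc_subset_Icc_self ht))

lemma HasDerivWithinAt.comp_const_add_Icc {φ : ℝ → ℝ} {φ' : ℝ → ℝ} {t s : ℝ}
    (hφ : ∀ t ∈ Icc 0 T, HasDerivWithinAt φ (φ' t) (Icc 0 T) t) (h0 : 0 ≤ t) (hT : t + s ≤ T)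
    {r : ℝ} (hr : r ∈ Icc 0 s) :
    HasDerivWithinAt (fun r => φ (t + r)) (φ' (t + r)) (Icc 0 s) r := by
  have h1 : MapsTo (fun r => t + r) (Icc 0 s) (Icc 0 T) := fun r hr =>
    ⟨by linarith [hr.1], by linarith [hr.2]⟩
  have := (hφ (t + r) (h1 hr)).comp r ((hasDerivWithinAt_id r (Icc 0 s)).const_add t) h1
  exact this.congr_deriv (by simp)

lemma HasDerivWithinAt.comp_const_sub_Icc {φ : ℝ → ℝ} {φ' : ℝ → ℝ} {t s : ℝ}
    (hφ : ∀ t ∈ Icc 0 T, HasDerivWithinAt φ (φ' t) (Icc 0 T) t) (h0 : 0 ≤ t - s) (hT : t ≤ T)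
    {r : ℝ} (hr : r ∈ Icc 0 s) :
    HasDerivWithinAt (fun r => φ (t - r)) (-φ' (t - r)) (Icc 0 s) r := by
  have h1 : MapsTo (fun r => t - r) (Icc 0 s) (Icc 0 T) := fun r hr =>
    ⟨by linarith [hr.2], by linarith [hr.1]⟩
  have := (hφ (t - r) (h1 hr)).comp r ((hasDerivWithinAt_id r (Icc 0 s)).const_sub t) h1
  exact this.congr_deriv (by simp)

/-- Second differences are controlled by the second derivative. -/
lemma abs_second_diff_le {φ φ' φ'' g : ℝ → ℝ}
    (h1 : ∀ t ∈ Icc 0 T, HasDerivWithinAt φ (φ' t) (Icc 0 T) t)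
    (h2 : ∀ t ∈ Icc 0 T, HasDerivWithinAt φ' (φ'' t) (Icc 0 T) t)
    (h3 : ContinuousOn φ'' (Icc 0 T)) (hg : ContinuousOn g (Icc 0 T))
    (hb : ∀ t ∈ Icc 0 T, |φ'' t| ≤ g t) {t s : ℝ} (hs : 0 ≤ s) (h0 : 0 ≤ t - s)
    (hT : t + s ≤ T) :
    |φ (t + s) + φ (t - s) - 2 * φ t| ≤ s * ∫ r in (t - s)..(t + s), g r := by
  have hg0 : ∀ t ∈ Icc 0 T, 0 ≤ g t := fun t ht => (abs_nonneg _).trans (hb t ht)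
  -- The symmetric sum is regarded as a function of the increment r. Its derivative is a first
  -- difference of φ', bounded by the integral of g over the whole interval, so the mean value
  -- inequality gives one factor s.
  have hd : ∀ r ∈ Icc 0 s, HasDerivWithinAt (fun r => φ (t + r) + φ (t - r))
      (φ' (t + r) - φ' (t - r)) (Icc 0 s) r := fun r hr =>
    (HasDerivWithinAt.comp_const_add_Icc h1 (by linarith) hT hr).add
      (HasDerivWithinAt.comp_const_sub_Icc h1 h0 (by linarith) hr)
  have hbd : ∀ r ∈ Ico 0 s, ‖φ' (t + r) - φ' (t - r)‖ ≤ ∫ r in (t - s)..(t + s), g r := by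
    intro r hr
    rw [Real.norm_eq_abs]
    refine (abs_sub_le_integral h2 h3 hg hb (by linarith [hr.2]) (by linarith [hr.1])
      (by linarith [hr.2])).trans ?_
    exact integral_le_integral_of_subinterval hg hg0 h0 (by linarith [hr.2]) (by linarith [hr.1])
      (by linarith [hr.2]) hT
  have h := norm_image_sub_le_of_norm_deriv_le_segment' hd hbd s ⟨hs, le_rfl⟩
  rw [Real.norm_eq_abs, sub_zero, add_zero, sub_zero, mul_comm, ← two_mul] at h
  exact h

/-- Consistency of the second difference quotient. -/
lemma abs_second_diff_sub_le {φ₀ φ₁ φ₂ φ₃ φ₄ g : ℝ → ℝ}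
    (h0 : ∀ t ∈ Icc 0 T, HasDerivWithinAt φ₀ (φ₁ t) (Icc 0 T) t)
    (h1 : ∀ t ∈ Icc 0 T, HasDerivWithinAt φ₁ (φ₂ t) (Icc 0 T) t)
    (h2 : ∀ t ∈ Icc 0 T, HasDerivWithinAt φ₂ (φ₃ t) (Icc 0 T) t)
    (h3 : ∀ t ∈ Icc 0 T, HasDerivWithinAt φ₃ (φ₄ t) (Icc 0 T) t)
    (h4 : ContinuousOn φ₄ (Icc 0 T)) (hg : ContinuousOn g (Icc 0 T))
    (hb : ∀ t ∈ Icc 0 T, |φ₄ t| ≤ g t) {t s : ℝ} (hs : 0 ≤ s) (hts : 0 ≤ t - s)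
    (hT : t + s ≤ T) :
    |φ₀ (t + s) + φ₀ (t - s) - 2 * φ₀ t - s ^ 2 * φ₂ t| ≤
      s ^ 3 * ∫ r in (t - s)..(t + s), g r := by
  have hg0 : ∀ t ∈ Icc 0 T, 0 ≤ g t := fun t ht => (abs_nonneg _).trans (hb t ht)
  set J := ∫ r in (t - s)..(t + s), g r with hJ
  have hJ0 : 0 ≤ J := intervalIntegral.integral_nonneg (by linarith) fun r hr =>
    hg0 r ⟨by linarith [hr.1], by linarith [hr.2]⟩
  -- Two integrations in r: the derivative of the quantity in `hA` is the second difference of φ₂,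
  -- at most sJ, and that quantity is in turn the derivative of the remainder being estimated.
  have hA : ∀ r ∈ Icc 0 s, |φ₁ (t + r) - φ₁ (t - r) - 2 * r * φ₂ t| ≤ s ^ 2 * J := by
    intro r hr
    have hd : ∀ r ∈ Icc 0 s, HasDerivWithinAt (fun r => φ₁ (t + r) - φ₁ (t - r) - 2 * r * φ₂ t)
        (φ₂ (t + r) - -φ₂ (t - r) - 2 * 1 * φ₂ t) (Icc 0 s) r := fun r hr =>
      ((HasDerivWithinAt.comp_const_add_Icc h1 (by linarith) hT hr).sub
        (HasDerivWithinAt.comp_const_sub_Icc h1 hts (by linarith) hr)).sub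
        (((hasDerivWithinAt_id r (Icc 0 s)).const_mul 2).mul_const (φ₂ t))
    have hbd : ∀ r ∈ Ico 0 s, ‖φ₂ (t + r) - -φ₂ (t - r) - 2 * 1 * φ₂ t‖ ≤ s * J := by
      intro r hr
      rw [Real.norm_eq_abs, sub_neg_eq_add, mul_one]
      refine (abs_second_diff_le h2 h3 h4 hg hb hr.1 (by linarith [hr.2])
        (by linarith [hr.2])).trans ?_
      refine mul_le_mul hr.2.le ?_ ?_ hs
      · exact integral_le_integral_of_subinterval hg hg0 hts (by linarith [hr.2])
          (by linarith [hr.1]) (by linarith [hr.2]) hT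
      · exact intervalIntegral.integral_nonneg (by linarith [hr.1]) fun r' hr' =>
          hg0 r' ⟨by linarith [hr'.1, hr.2], by linarith [hr'.2, hr.2]⟩
    have h := norm_image_sub_le_of_norm_deriv_le_segment' hd hbd r hr
    simp only [Real.norm_eq_abs, add_zero, sub_zero, sub_self, mul_zero, zero_mul] at h
    refine h.trans ?_
    nlinarith [mul_nonneg (mul_nonneg hs hJ0) (sub_nonneg.2 hr.2)]
  have hd : ∀ r ∈ Icc 0 s, HasDerivWithinAt (fun r => φ₀ (t + r) + φ₀ (t - r) - r ^ 2 * φ₂ t)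
      (φ₁ (t + r) + -φ₁ (t - r) - 2 * r * φ₂ t) (Icc 0 s) r := fun r hr => by
    have hp : HasDerivWithinAt (fun r : ℝ => r ^ 2) (2 * r) (Icc 0 s) r := by
      exact (hasDerivAt_pow 2 r).hasDerivWithinAt.congr_deriv (by simp)
    exact ((HasDerivWithinAt.comp_const_add_Icc h0 (by linarith) hT hr).add
      (HasDerivWithinAt.comp_const_sub_Icc h0 hts (by linarith) hr)).sub
      (hp.mul_const (φ₂ t))
  have h := norm_image_sub_le_of_norm_deriv_le_segment' hd
    (fun r hr => hA r (Ico_subset_Icc_self hr)) s ⟨hs, le_rfl⟩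
  rw [Real.norm_eq_abs] at h
  have e : φ₀ (t + s) + φ₀ (t - s) - 2 * φ₀ t - s ^ 2 * φ₂ t =
      φ₀ (t + s) + φ₀ (t - s) - s ^ 2 * φ₂ t - (φ₀ (t + 0) + φ₀ (t - 0) - 0 ^ 2 * φ₂ t) := by
    rw [add_zero, sub_zero]; ring
  rw [e]
  refine h.trans (le_of_eq ?_)
  ring

end Scalar

/-- `u 0, …, u n` are successive time derivatives on `[0,T]`, and `u n` is continuous. -/
structure IsDerivChain {E : Type*} [NormedAddCommGroup E] [NormedSpace ℝ E] (T : ℝ) (n : ℕ)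
    (u : ℕ → ℝ → E) : Prop where
  deriv : ∀ k < n, ∀ t ∈ Icc 0 T, HasDerivWithinAt (u k) (u (k + 1) t) (Icc 0 T) t
  cont : ContinuousOn (u n) (Icc 0 T)

section Vector

variable {E : Type*} [NormedAddCommGroup E] [NormedSpace ℝ E]
  {B : LinearMap.BilinForm ℝ E} {T : ℝ} {n : ℕ} {u : ℕ → ℝ → E}

lemma IsDerivChain.continuousOn (hu : IsDerivChain T n u) {k : ℕ} (hk : k ≤ n) :
    ContinuousOn (u k) (Icc 0 T) := by
  rcases hk.lt_or_eq with h | rfl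
  · exact fun t ht => (hu.deriv k h t ht).continuousWithinAt
  · exact hu.cont

/-- Testing with every vector reduces estimates of u in a seminorm to scalar calculus for t ↦
B(u(t), e), so the non-smooth seminorm is never differentiated. -/
lemma IsPSDForm.energyNorm_le_of_forall (hB : IsPSDForm B) {x : E} {c : ℝ} (hc : 0 ≤ c)
    (h : ∀ e, |B x e| ≤ c * energyNorm B e) : energyNorm B x ≤ c :=
  hB.energyNorm_le_of_apply_le hc ((le_abs_self _).trans (h x))

lemma integral_energyNorm_nonneg (B : LinearMap.BilinForm ℝ E) (v : ℝ → E) {a b : ℝ}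
    (hab : a ≤ b) : 0 ≤ ∫ r in a..b, energyNorm B (v r) :=
  intervalIntegral.integral_nonneg hab fun _ _ => IsPSDForm.energyNorm_nonneg B _

variable [FiniteDimensional ℝ E]

lemma HasDerivWithinAt.linearMap {s : Set ℝ} {v : ℝ → E} {v' : E} {t : ℝ}
    (h : HasDerivWithinAt v v' s t) (ℓ : E →ₗ[ℝ] ℝ) :
    HasDerivWithinAt (fun r => ℓ (v r)) (ℓ v') s t :=
  (LinearMap.toContinuousLinearMap ℓ).hasFDerivAt.comp_hasDerivWithinAt t h

lemma ContinuousOn.linearMap {s : Set ℝ} {v : ℝ → E} (h : ContinuousOn v s) (ℓ : E →ₗ[ℝ] ℝ) :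
    ContinuousOn (fun r => ℓ (v r)) s :=
  (LinearMap.toContinuousLinearMap ℓ).continuous.comp_continuousOn h

lemma ContinuousOn.bilinForm {s : Set ℝ} {v w : ℝ → E} (hv : ContinuousOn v s)
    (hw : ContinuousOn w s) (B : LinearMap.BilinForm ℝ E) :
    ContinuousOn (fun r => B (v r) (w r)) s :=
  ((LinearMap.toContinuousBilinearMap B).continuous.comp_continuousOn hv).clm_apply hw

lemma HasDerivWithinAt.bilinForm {s : Set ℝ} {v w : ℝ → E} {v' w' : E} {t : ℝ}
    (hv : HasDerivWithinAt v v' s t) (hw : HasDerivWithinAt w w' s t)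
    (B : LinearMap.BilinForm ℝ E) :
    HasDerivWithinAt (fun r => B (v r) (w r)) (B v' (w t) + B (v t) w') s t :=
  HasDerivWithinAt.clm_apply
    ((LinearMap.toContinuousBilinearMap B).hasFDerivAt.comp_hasDerivWithinAt t hv) hw

lemma ContinuousOn.energyNorm {s : Set ℝ} {v : ℝ → E} (hv : ContinuousOn v s)
    (B : LinearMap.BilinForm ℝ E) : ContinuousOn (fun r => energyNorm B (v r)) s :=
  (hv.bilinForm hv B).sqrt

lemma IsDerivChain.energyNorm_sub_le (hB : IsPSDForm B) (hu : IsDerivChain T n u) {k : ℕ}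
    (hk : k < n) {a b : ℝ} (ha : 0 ≤ a) (hab : a ≤ b) (hb : b ≤ T) :
    energyNorm B (u k b - u k a) ≤ ∫ r in a..b, energyNorm B (u (k + 1) r) := by
  refine hB.energyNorm_le_of_forall (integral_energyNorm_nonneg B _ hab) fun e => ?_
  have h := abs_sub_le_integral (φ := fun r => B.flip e (u k r))
    (g := fun r => energyNorm B (u (k + 1) r) * energyNorm B e)
    (fun t ht => (hu.deriv k hk t ht).linearMap (B.flip e))
    ((hu.continuousOn hk).linearMap (B.flip e))
    (((hu.continuousOn hk).energyNorm B).mul continuousOn_const)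
    (fun t _ => hB.abs_apply_le _ _) ha hab hb
  rw [intervalIntegral.integral_mul_const] at h
  simpa [LinearMap.flip_apply] using h

lemma IsDerivChain.energyNorm_second_diff_le (hB : IsPSDForm B) (hu : IsDerivChain T n u)
    {k : ℕ} (hk : k + 2 ≤ n) {t s : ℝ} (hs : 0 ≤ s) (h0 : 0 ≤ t - s) (hT : t + s ≤ T) :
    energyNorm B (u k (t + s) + u k (t - s) - (2 : ℝ) • u k t) ≤
      s * ∫ r in (t - s)..(t + s), energyNorm B (u (k + 2) r) := by
  refine hB.energyNorm_le_of_forall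
    (mul_nonneg hs (integral_energyNorm_nonneg B _ (by linarith))) fun e => ?_
  have h := abs_second_diff_le (φ := fun r => B.flip e (u k r))
    (g := fun r => energyNorm B (u (k + 2) r) * energyNorm B e)
    (fun t ht => (hu.deriv k (by omega) t ht).linearMap (B.flip e))
    (fun t ht => (hu.deriv (k + 1) (by omega) t ht).linearMap (B.flip e))
    ((hu.continuousOn hk).linearMap (B.flip e))
    (((hu.continuousOn hk).energyNorm B).mul continuousOn_const)
    (fun t _ => hB.abs_apply_le _ _) hs h0 hT
  rw [intervalIntegral.integral_mul_const, ← mul_assoc] at h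
  simpa [LinearMap.flip_apply] using h

lemma IsDerivChain.energyNorm_consistency_le (hB : IsPSDForm B) (hu : IsDerivChain T 4 u)
    {t s : ℝ} (hs : 0 ≤ s) (h0 : 0 ≤ t - s) (hT : t + s ≤ T) :
    energyNorm B (u 0 (t + s) + u 0 (t - s) - (2 : ℝ) • u 0 t - s ^ 2 • u 2 t) ≤
      s ^ 3 * ∫ r in (t - s)..(t + s), energyNorm B (u 4 r) := by
  refine hB.energyNorm_le_of_forall
    (mul_nonneg (by positivity) (integral_energyNorm_nonneg B _ (by linarith))) fun e => ?_
  have h := abs_second_diff_sub_le (φ₀ := fun r => B.flip e (u 0 r))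
    (g := fun r => energyNorm B (u 4 r) * energyNorm B e)
    (fun t ht => (hu.deriv 0 (by omega) t ht).linearMap (B.flip e))
    (fun t ht => (hu.deriv 1 (by omega) t ht).linearMap (B.flip e))
    (fun t ht => (hu.deriv 2 (by omega) t ht).linearMap (B.flip e))
    (fun t ht => (hu.deriv 3 (by omega) t ht).linearMap (B.flip e))
    (hu.cont.linearMap (B.flip e))
    ((hu.cont.energyNorm B).mul continuousOn_const)
    (fun t _ => hB.abs_apply_le _ _) hs h0 hT
  rw [intervalIntegral.integral_mul_const, ← mul_assoc] at h
  simpa [LinearMap.flip_apply] using h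

/-- A first-order Taylor estimate. -/
lemma IsDerivChain.energyNorm_taylor_le (hB : IsPSDForm B) (hu : IsDerivChain T n u)
    {k : ℕ} (hk : k + 2 ≤ n) {a b : ℝ} (ha : 0 ≤ a) (hab : a ≤ b) (hb : b ≤ T) :
    energyNorm B (u k b - u k a - (b - a) • u (k + 1) a) ≤
      (b - a) * ∫ r in 0..T, energyNorm B (u (k + 2) r) := by
  have hJ := integral_energyNorm_nonneg B (u (k + 2)) (show (0 : ℝ) ≤ T by linarith)
  refine hB.energyNorm_le_of_forall (mul_nonneg (by linarith) hJ) fun e => ?_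
  have hsub : Icc a b ⊆ Icc 0 T := Icc_subset_Icc ha hb
  have hd : ∀ r ∈ Icc a b, HasDerivWithinAt
      (fun r => B.flip e (u k r) - (r - a) * B.flip e (u (k + 1) a))
      (B.flip e (u (k + 1) r) - 1 * B.flip e (u (k + 1) a)) (Icc a b) r := fun r hr =>
    (((hu.deriv k (by omega) r (hsub hr)).mono hsub).linearMap (B.flip e)).sub
      (((hasDerivWithinAt_id r _).sub_const a).mul_const _)
  have hbd : ∀ r ∈ Ico a b, ‖B.flip e (u (k + 1) r) - 1 * B.flip e (u (k + 1) a)‖ ≤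
      (∫ r in 0..T, energyNorm B (u (k + 2) r)) * energyNorm B e := by
    intro r hr
    rw [one_mul, ← map_sub, Real.norm_eq_abs]
    change |B (u (k + 1) r - u (k + 1) a) e| ≤ _
    refine (hB.abs_apply_le _ _).trans (mul_le_mul_of_nonneg_right ?_
      (IsPSDForm.energyNorm_nonneg B e))
    refine (hu.energyNorm_sub_le hB (by omega) ha hr.1 (by linarith [hr.2])).trans ?_
    exact integral_le_integral_of_subinterval ((hu.continuousOn hk).energyNorm B)
      (fun _ _ => IsPSDForm.energyNorm_nonneg B _) le_rfl ha hr.1 (by linarith [hr.2]) le_rfl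
  have h := norm_image_sub_le_of_norm_deriv_le_segment' hd hbd b ⟨hab, le_rfl⟩
  simp only [Real.norm_eq_abs, sub_self, zero_mul, sub_zero] at h
  have e1 : B (u k b - u k a - (b - a) • u (k + 1) a) e =
      B.flip e (u k b) - (b - a) * B.flip e (u (k + 1) a) - B.flip e (u k a) := by
    simp
    ring
  rw [e1]
  refine h.trans (le_of_eq ?_)
  ring

end Vector

end TimeInterval

section AbstractWave

open Set

/-! ### Energy estimates for second-order evolution problems -/

/-- A continuous function is somewhere at most its mean value. -/
lemma exists_mul_le_integral {φ : ℝ → ℝ} {T : ℝ} (hφ : ContinuousOn φ (Icc 0 T))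
    (h0 : ∀ t ∈ Icc 0 T, 0 ≤ φ t) {a b : ℝ} (ha : 0 ≤ a) (hab : a ≤ b) (hb : b ≤ T) :
    ∃ s ∈ Icc a b, (b - a) * φ s ≤ ∫ t in 0..T, φ t := by
  have hsub : Icc a b ⊆ Icc 0 T := Icc_subset_Icc ha hb
  obtain ⟨s, hs, hmin⟩ := isCompact_Icc.exists_isMinOn (nonempty_Icc.2 hab) (hφ.mono hsub)
  refine ⟨s, hs, ?_⟩
  have h1 : ∫ _ in a..b, φ s ≤ ∫ t in a..b, φ t :=
    intervalIntegral.integral_mono_on hab (by simp) ((hφ.mono hsub).intervalIntegrable_of_Icc hab)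
      fun t ht => hmin ht
  rw [intervalIntegral.integral_const, smul_eq_mul] at h1
  exact h1.trans (integral_le_integral_of_subinterval hφ h0 le_rfl ha hab hb le_rfl)

/-- Integrals over overlapping intervals of two time steps. -/
lemma sum_integral_two_steps_le {φ : ℝ → ℝ} {T τ : ℝ} (hφ : ContinuousOn φ (Icc 0 T))
    (h0 : ∀ t ∈ Icc 0 T, 0 ≤ φ t) (hτ : 0 ≤ τ) {n : ℕ} (hn : (n + 1) * τ ≤ T) :
    ∑ j ∈ Finset.range n, ∫ t in (j * τ)..((j + 2) * τ), φ t ≤ 2 * ∫ t in 0..T, φ t := by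
  have hint : ∀ a b : ℝ, 0 ≤ a → a ≤ b → b ≤ T → IntervalIntegrable φ MeasureTheory.volume a b :=
    fun a b ha hab hb => (hφ.mono (Icc_subset_Icc ha hb)).intervalIntegrable_of_Icc hab
  -- Each interval of two steps is split at its middle; the left halves fill [0, mτ] and the right
  -- halves lie in [0, (m+1)τ].
  have key : ∀ m ≤ n, ∑ j ∈ Finset.range m, ∫ t in (j * τ)..((j + 2) * τ), φ t ≤
      (∫ t in 0..(m * τ), φ t) + ∫ t in 0..((m + 1) * τ), φ t := by
    intro m
    induction m with
    | zero =>
      intro _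
      have : τ ≤ T := by nlinarith [(Nat.cast_nonneg n : (0 : ℝ) ≤ n)]
      simpa using intervalIntegral.integral_nonneg hτ fun t ht => h0 t ⟨ht.1, ht.2.trans this⟩
    | succ m ih =>
      intro hm
      have hm' : ((m + 1 + 1 : ℝ)) * τ ≤ T :=
        (mul_le_mul_of_nonneg_right (by exact_mod_cast Nat.succ_le_succ hm) hτ).trans hn
      have e0 : 0 ≤ (m : ℝ) * τ := by positivity
      rw [Finset.sum_range_succ]
      push_cast
      have h1 := intervalIntegral.integral_add_adjacent_intervals
        (hint (m * τ) ((m + 1) * τ) e0 (by linarith) (by linarith))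
        (hint ((m + 1) * τ) ((m + 2) * τ) (by linarith) (by linarith) (by linarith))
      have h2 := intervalIntegral.integral_add_adjacent_intervals
        (hint 0 (m * τ) le_rfl e0 (by linarith))
        (hint (m * τ) ((m + 1) * τ) e0 (by linarith) (by linarith))
      have h3 := intervalIntegral.integral_add_adjacent_intervals
        (hint 0 ((m + 1) * τ) le_rfl (by linarith) (by linarith))
        (hint ((m + 1) * τ) ((m + 2) * τ) (by linarith) (by linarith) (by linarith))
      have e : (m + 1 + 1 : ℝ) = m + 2 := by ring
      rw [e]
      linarith [ih (by omega)]
  have hn0 : 0 ≤ (n : ℝ) * τ := by positivity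
  have h1 := integral_le_integral_of_subinterval hφ h0 le_rfl le_rfl hn0
    (show n * τ ≤ T by linarith) le_rfl
  have h2 := integral_le_integral_of_subinterval hφ h0 le_rfl le_rfl
    (show 0 ≤ (n + 1) * τ by linarith) hn le_rfl
  linarith [key n le_rfl]

lemma le_add_sqrt_of_sq_le {z a e : ℝ} (ha : 0 ≤ a) (he : 0 ≤ e)
    (h : z ^ 2 ≤ 2 * a * z + e ^ 2) : z ≤ 2 * a + e := by
  by_contra hlt
  push Not at hlt
  nlinarith

variable {E : Type*} [NormedAddCommGroup E] [NormedSpace ℝ E]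
  {M K : LinearMap.BilinForm ℝ E} {V : Submodule ℝ E}

/-- The constant in the energy estimate for the wave equation without initial data. -/
noncomputable def waveConst (c T₀ : ℝ) : ℝ := 2 + 18 * c ^ 2 / T₀ ^ 2 + 3 * c / T₀

lemma waveConst_nonneg {c T₀ : ℝ} (hc : 0 ≤ c) (hT₀ : 0 < T₀) : 0 ≤ waveConst c T₀ := by
  unfold waveConst
  positivity

/-- On a time interval that is not too short, the energy norm of a solution `w` of
`(M w'', v) + (K w, v) = (M g, v)` is controlled by `w''` and `g`, without the initial values. -/
theorem energyNorm_wave_le [FiniteDimensional ℝ E] (hM : IsPSDForm M) (hK : IsPSDForm K)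
    {c T₀ T : ℝ} (hc : 0 ≤ c)
    (hMK : ∀ v ∈ V, energyNorm M v ≤ c * energyNorm K v) (hT₀ : 0 < T₀) (hT : T₀ ≤ T)
    {w : ℕ → ℝ → E} (hw : IsDerivChain T 2 w) (hwV : ∀ k ≤ 1, ∀ t ∈ Icc 0 T, w k t ∈ V)
    {g : ℝ → E} (hg : ContinuousOn g (Icc 0 T))
    (heq : ∀ t ∈ Icc 0 T, ∀ v ∈ V, M (w 2 t) v + K (w 0 t) v = M (g t) v)
    {t : ℝ} (ht : t ∈ Icc 0 T) :
    energyNorm K (w 0 t) ≤ waveConst c T₀ *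
      ((∫ r in 0..T, energyNorm M (w 2 r)) + ∫ r in 0..T, energyNorm M (g r)) := by
  have hT0 : 0 < T := hT₀.trans_le hT
  set A := ∫ r in 0..T, energyNorm M (w 2 r) with hA
  set F := ∫ r in 0..T, energyNorm M (g r) with hF
  have hA0 : 0 ≤ A := integral_energyNorm_nonneg M _ hT0.le
  have hF0 : 0 ≤ F := integral_energyNorm_nonneg M _ hT0.le
  have nn := IsPSDForm.energyNorm_nonneg (E := E)
  have hgc := hg.energyNorm M
  have hwc := hw.cont.energyNorm M
  -- Test the equation with w(s) itself and use |w|_M ≤ c|w|_K.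
  have hpt : ∀ s ∈ Icc 0 T,
      energyNorm K (w 0 s) ≤ c * (energyNorm M (w 2 s) + energyNorm M (g s)) := by
    intro s hs
    have hV := hwV 0 (by omega) s hs
    refine hK.energyNorm_le_of_apply_le (mul_nonneg hc (add_nonneg (nn _ _) (nn _ _))) ?_
    have h1 := heq s hs _ hV
    have h2 := hM.abs_apply_le (w 2 s) (w 0 s)
    have h3 := hM.apply_le (g s) (w 0 s)
    have h4 := mul_le_mul_of_nonneg_left (hMK _ hV)
      (add_nonneg (nn M (w 2 s)) (nn M (g s)))
    nlinarith [neg_abs_le (M (w 2 s) (w 0 s))]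
  -- An interval of length T/3 contains a time at which the pointwise bound is at most its mean. One
  -- good time is taken in the first third and one in the last, so they are at least T/3 apart.
  have hgood : ∀ a b : ℝ, 0 ≤ a → b = a + T / 3 → b ≤ T →
      ∃ s ∈ Icc a b, energyNorm K (w 0 s) ≤ c * (3 / T * (A + F)) := by
    intro a b ha hab hb
    obtain ⟨s, hs, h⟩ := exists_mul_le_integral
      (φ := fun r => energyNorm M (w 2 r) + energyNorm M (g r)) (hwc.add hgc)
      (fun t _ => add_nonneg (nn _ _) (nn _ _)) ha (by linarith : a ≤ b) hb
    refine ⟨s, hs, (hpt s ⟨ha.trans hs.1, hs.2.trans hb⟩).trans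
      (mul_le_mul_of_nonneg_left ?_ hc)⟩
    rw [intervalIntegral.integral_add (hwc.intervalIntegrable_of_Icc hT0.le)
      (hgc.intervalIntegrable_of_Icc hT0.le)] at h
    have e : b - a = T / 3 := by linarith
    rw [e] at h
    rw [div_mul_eq_mul_div, le_div_iff₀ hT0]
    linarith
  obtain ⟨s₁, hs₁, hK₁⟩ := hgood 0 (T / 3) le_rfl (by ring) (by linarith)
  obtain ⟨s₂, hs₂, hK₂⟩ := hgood (2 * T / 3) T (by linarith) (by ring) le_rfl
  have hs₁T : s₁ ∈ Icc 0 T := ⟨hs₁.1, by linarith [hs₁.2]⟩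
  have hs₂T : s₂ ∈ Icc 0 T := ⟨by linarith [hs₂.1], hs₂.2⟩
  have hδ : T / 3 ≤ s₂ - s₁ := by linarith [hs₁.2, hs₂.1]
  -- The velocity at s₁ is the difference quotient between the two good times up to a Taylor
  -- remainder A. This supplies the missing initial value for the energy identity.
  have hw1 : energyNorm M (w 1 s₁) ≤ A + 18 * c ^ 2 / T ^ 2 * (A + F) := by
    have h1 := hw.energyNorm_taylor_le hM (k := 0) (by norm_num) hs₁.1
      (by linarith : s₁ ≤ s₂) hs₂.2
    rw [zero_add, zero_add, ← hA] at h1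
    have h2 : energyNorm M ((s₂ - s₁) • w 1 s₁) ≤
        energyNorm M (w 0 s₂ - w 0 s₁) + (s₂ - s₁) * A := by
      have := hM.energyNorm_sub_le (w 0 s₂ - w 0 s₁) (w 0 s₂ - w 0 s₁ - (s₂ - s₁) • w 1 s₁)
      rw [sub_sub_cancel] at this
      linarith
    have h3 := hM.energyNorm_sub_le (w 0 s₂) (w 0 s₁)
    have h4 := hMK _ (hwV 0 (by omega) s₁ hs₁T)
    have h5 := hMK _ (hwV 0 (by omega) s₂ hs₂T)
    have h6 := mul_le_mul_of_nonneg_left hK₁ hc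
    have h7 := mul_le_mul_of_nonneg_left hK₂ hc
    rw [IsPSDForm.energyNorm_smul, abs_of_nonneg (by linarith)] at h2
    have h8 : (s₂ - s₁) * (energyNorm M (w 1 s₁) - A) ≤ T / 3 * (18 * c ^ 2 / T ^ 2 * (A + F)) := by
      have e : T / 3 * (18 * c ^ 2 / T ^ 2 * (A + F)) = 2 * (c * (c * (3 / T * (A + F)))) := by
        field_simp
        ring
      rw [e]
      linarith
    have hq : 0 ≤ 18 * c ^ 2 / T ^ 2 * (A + F) := by positivity
    by_contra hlt
    push Not at hlt
    have h9 : T / 3 * (18 * c ^ 2 / T ^ 2 * (A + F)) <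
        (s₂ - s₁) * (energyNorm M (w 1 s₁) - A) :=
      (mul_le_mul_of_nonneg_right hδ hq).trans_lt
        (mul_lt_mul_of_pos_left (by linarith) (by linarith))
    linarith
  let e : ℝ → ℝ := fun r => M (w 1 r) (w 1 r) + K (w 0 r) (w 0 r)
  have hw1c := hw.continuousOn (k := 1) (by norm_num)
  have hec : ContinuousOn e (Icc 0 T) :=
    (hw1c.bilinForm hw1c M).add ((hw.continuousOn (k := 0) (by norm_num)).bilinForm
      (hw.continuousOn (k := 0) (by norm_num)) K)
  have he0 : ∀ r, 0 ≤ e r := fun r => add_nonneg (hM.nonneg _) (hK.nonneg _)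
  -- The derivative of the energy is 2M(g, w'), so bounding w' by the maximal energy gives a
  -- quadratic inequality for √e(s), started from the good time s₁.
  obtain ⟨s, hs, hmax⟩ := isCompact_Icc.exists_isMaxOn (nonempty_Icc.2 hT0.le) hec
  have hder : ∀ r ∈ Icc 0 T, HasDerivWithinAt e (2 * M (g r) (w 1 r)) (Icc 0 T) r := by
    intro r hr
    have h1 := ((hw.deriv 1 (by norm_num) r hr).bilinForm (hw.deriv 1 (by norm_num) r hr) M).add
      ((hw.deriv 0 (by norm_num) r hr).bilinForm (hw.deriv 0 (by norm_num) r hr) K)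
    refine h1.congr_deriv ?_
    have h2 := heq r hr _ (hwV 1 le_rfl r hr)
    rw [hM.symm (w 1 r) (w (1 + 1) r), hK.symm (w (0 + 1) r) (w 0 r)]
    norm_num
    linarith
  have hbd : ∀ r ∈ Icc 0 T, |2 * M (g r) (w 1 r)| ≤ 2 * √(e s) * energyNorm M (g r) := by
    intro r hr
    rw [abs_mul, abs_two]
    have h1 := hM.abs_apply_le (g r) (w 1 r)
    have h2 : energyNorm M (w 1 r) ≤ √(e s) :=
      Real.sqrt_le_sqrt ((le_add_of_nonneg_right (hK.nonneg _)).trans (hmax hr))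
    nlinarith [mul_le_mul_of_nonneg_left h2 (nn M (g r))]
  have hgc' : ContinuousOn (fun r => 2 * √(e s) * energyNorm M (g r)) (Icc 0 T) :=
    continuousOn_const.mul hgc
  have hderc : ContinuousOn (fun r => 2 * M (g r) (w 1 r)) (Icc 0 T) :=
    continuousOn_const.mul (hg.bilinForm hw1c M)
  have hnn : ∀ r ∈ Icc 0 T, 0 ≤ 2 * √(e s) * energyNorm M (g r) := fun r _ =>
    mul_nonneg (by positivity) (nn _ _)
  have hinc : |e s - e s₁| ≤ 2 * √(e s) * F := by
    rw [hF, ← intervalIntegral.integral_const_mul]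
    rcases le_total s₁ s with hle | hle
    · exact (abs_sub_le_integral hder hderc hgc' hbd hs₁.1 hle hs.2).trans
        (integral_le_integral_of_subinterval hgc' hnn le_rfl hs₁.1 hle hs.2 le_rfl)
    · rw [abs_sub_comm]
      exact (abs_sub_le_integral hder hderc hgc' hbd hs.1 hle hs₁T.2).trans
        (integral_le_integral_of_subinterval hgc' hnn le_rfl hs.1 hle hs₁T.2 le_rfl)
  have hZ : √(e s) ≤ 2 * F + (energyNorm M (w 1 s₁) + energyNorm K (w 0 s₁)) := by
    refine le_add_sqrt_of_sq_le hF0 (add_nonneg (nn _ _) (nn _ _)) ?_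
    rw [Real.sq_sqrt (he0 s)]
    have h1 : e s₁ = energyNorm M (w 1 s₁) ^ 2 + energyNorm K (w 0 s₁) ^ 2 := by
      rw [hM.energyNorm_sq, hK.energyNorm_sq]
    nlinarith [le_abs_self (e s - e s₁), mul_nonneg (nn M (w 1 s₁)) (nn K (w 0 s₁))]
  have hfin : energyNorm K (w 0 t) ≤ √(e s) :=
    Real.sqrt_le_sqrt ((le_add_of_nonneg_left (hM.nonneg _)).trans (hmax ht))
  have hAF : 0 ≤ A + F := add_nonneg hA0 hF0
  have hc1 : 18 * c ^ 2 / T ^ 2 * (A + F) ≤ 18 * c ^ 2 / T₀ ^ 2 * (A + F) := by gcongr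
  have hc2 : c * (3 / T * (A + F)) ≤ 3 * c / T₀ * (A + F) := by
    have : c * (3 / T * (A + F)) = 3 * c / T * (A + F) := by ring
    rw [this]
    gcongr
  unfold waveConst
  linarith

/-- Discrete energy conservation: stability of the time stepping. -/
theorem discrete_energy_le (hM : IsPSDForm M) (hK : IsPSDForm K) {τ : ℝ} (hτ : 0 < τ)
    {D A r : ℕ → E} {n : ℕ} (hDA : ∀ j, A (j + 1) - A j = (τ / 2) • (D (j + 1) + D j))
    (heq : ∀ j < n, M (τ⁻¹ • (D (j + 1) - D j)) (D (j + 1) + D j) +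
      K ((1 / 2 : ℝ) • (A (j + 1) + A j)) (D (j + 1) + D j) = M (r j) (D (j + 1) + D j)) :
    energyNorm K (A n) ≤ energyNorm M (D 0) + energyNorm K (A 0) +
      τ * ∑ j ∈ Finset.range n, energyNorm M (r j) := by
  let e : ℕ → ℝ := fun j => √(M (D j) (D j) + K (A j) (A j))
  have nn := IsPSDForm.energyNorm_nonneg (E := E)
  have he : ∀ j, e j ^ 2 = M (D j) (D j) + K (A j) (A j) := fun j =>
    Real.sq_sqrt (add_nonneg (hM.nonneg _) (hK.nonneg _))
  have he0 : ∀ j, 0 ≤ e j := fun j => Real.sqrt_nonneg _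
  have hD : ∀ j, energyNorm M (D j) ≤ e j := fun j =>
    Real.sqrt_le_sqrt (le_add_of_nonneg_right (hK.nonneg _))
  have hA : ∀ j, energyNorm K (A j) ≤ e j := fun j =>
    Real.sqrt_le_sqrt (le_add_of_nonneg_left (hM.nonneg _))
  have hstep : ∀ j < n, e (j + 1) ≤ e j + τ * energyNorm M (r j) := by
    intro j hj
    have h1 : e (j + 1) ^ 2 - e j ^ 2 = τ * M (r j) (D (j + 1) + D j) := by
      have e1 : K ((1 / 2 : ℝ) • (A (j + 1) + A j)) (D (j + 1) + D j) =
          τ⁻¹ * (K (A (j + 1)) (A (j + 1)) - K (A j) (A j)) := by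
        -- With this test vector both forms become differences of squares, and the left-hand side is
        -- an exact increment of the discrete energy.
        have : D (j + 1) + D j = (2 / τ) • (A (j + 1) - A j) := by
          rw [hDA, smul_smul, div_mul_div_cancel₀ hτ.ne', div_self two_ne_zero, one_smul]
        rw [this]
        simp only [map_smul, map_add, map_sub, LinearMap.smul_apply, LinearMap.add_apply,
          smul_eq_mul]
        rw [hK.symm (A j) (A (j + 1))]
        field_simp
        ring
      have e2 : M (τ⁻¹ • (D (j + 1) - D j)) (D (j + 1) + D j) =
          τ⁻¹ * (M (D (j + 1)) (D (j + 1)) - M (D j) (D j)) := by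
        simp only [map_smul, map_add, map_sub, LinearMap.smul_apply, LinearMap.sub_apply,
          smul_eq_mul]
        rw [hM.symm (D j) (D (j + 1))]
        ring
      rw [← heq j hj, e1, e2, he, he]
      field_simp
      ring
    have h2 : M (r j) (D (j + 1) + D j) ≤ energyNorm M (r j) * (e (j + 1) + e j) :=
      (hM.apply_le _ _).trans (mul_le_mul_of_nonneg_left
        ((hM.energyNorm_add_le _ _).trans (add_le_add (hD _) (hD _))) (nn _ _))
    have h3 := mul_le_mul_of_nonneg_left h2 hτ.le
    have h4 : 0 ≤ τ * energyNorm M (r j) := mul_nonneg hτ.le (nn _ _)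
    -- The increment of e² factors through e_{j+1} + e_j, which cancels against the same factor from
    -- the right-hand side.
    by_contra hlt
    push Not at hlt
    nlinarith [he0 j, he0 (j + 1)]
  have hsum : ∀ m ≤ n, e m ≤ e 0 + τ * ∑ j ∈ Finset.range m, energyNorm M (r j) := by
    intro m
    induction m with
    | zero => simp
    | succ m ih =>
      intro hm
      rw [Finset.sum_range_succ, mul_add]
      linarith [ih (by omega), hstep m (by omega)]
  have h0 : e 0 ≤ energyNorm M (D 0) + energyNorm K (A 0) := by
    refine Real.sqrt_le_iff.2 ⟨add_nonneg (nn _ _) (nn _ _), ?_⟩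
    nlinarith [hM.energyNorm_sq (D 0), hK.energyNorm_sq (A 0),
      mul_nonneg (nn M (D 0)) (nn K (A 0))]
  linarith [hA n, hsum n le_rfl]

end AbstractWave

section AbstractScheme

open Set

/-! ### Abstract error analysis of the fully discrete method -/

variable {E : Type*} [NormedAddCommGroup E] [NormedSpace ℝ E]
  {M K : LinearMap.BilinForm ℝ E} {V S : Submodule ℝ E}

/-- `P` is the `K`-orthogonal projection onto `S ⊆ V`, with approximation error `η`. -/
structure IsRitzProjection (M K : LinearMap.BilinForm ℝ E) (V S : Submodule ℝ E)
    (P : E →ₗ[ℝ] E) (η : ℝ) : Prop where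
  le : S ≤ V
  mem : ∀ x, P x ∈ S
  orthogonal : ∀ x, ∀ w ∈ S, K (P x) w = K x w
  nonneg : 0 ≤ η
  error_left : ∀ v ∈ V, energyNorm M (v - P v) ≤ η * energyNorm K v
  error_right : ∀ z ∈ V, ∀ g, (∀ v ∈ V, K z v = M g v) → energyNorm K (z - P z) ≤ η * energyNorm M g

/-- `u 0, u 1, …` are the time derivatives of a solution `u 0` of the wave equation with
right-hand side `f 0`. -/
structure IsSmoothWave (M K : LinearMap.BilinForm ℝ E) (V : Submodule ℝ E) (T : ℝ)
    (f u : ℕ → ℝ → E) : Prop where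
  chain_u : IsDerivChain T 4 u
  chain_f : IsDerivChain T 2 f
  mem : ∀ k ≤ 3, ∀ t ∈ Icc 0 T, u k t ∈ V
  eqn : ∀ t ∈ Icc 0 T, ∀ v ∈ V, M (u 2 t) v + K (u 0 t) v = M (f 0 t) v
  eqn_two : ∀ t ∈ Icc 0 T, ∀ v ∈ V, M (u 4 t) v + K (u 2 t) v = M (f 2 t) v

variable {P : E →ₗ[ℝ] E} {η T τ : ℝ} {f u : ℕ → ℝ → E}

/-- The residual of the Ritz projection of a solution in the time stepping scheme. -/
noncomputable def ritzResidual (P : E →ₗ[ℝ] E) (τ : ℝ) (f u : ℕ → ℝ → E) (t : ℝ) : E :=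
  -- In order: the averaging defect of f, that of D_t²u, the consistency error of the second
  -- difference, and the Ritz error of the second difference. The weight 1/4 arises since the
  -- averaged K-term is K(u + δ²u/4), where δ²u is the second difference, and Ku = M(f - D_t²u) on
  -- V.
  -((1 / 4 : ℝ) • (f 0 (t + τ) + f 0 (t - τ) - (2 : ℝ) • f 0 t)) +
    (1 / 4 : ℝ) • (u 2 (t + τ) + u 2 (t - τ) - (2 : ℝ) • u 2 t) -
    (τ ^ 2)⁻¹ • (u 0 (t + τ) + u 0 (t - τ) - (2 : ℝ) • u 0 t - τ ^ 2 • u 2 t) +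
    (τ ^ 2)⁻¹ • ((u 0 (t + τ) + u 0 (t - τ) - (2 : ℝ) • u 0 t) -
      P (u 0 (t + τ) + u 0 (t - τ) - (2 : ℝ) • u 0 t))

/-- The averaging defect of D_t²u contributes τ/4 and the consistency error τ, together 5τ/4. In the
last term P acts on a second difference of K-norm at most 2τ²`SK`, which absorbs the factor τ^{-2}.
-/
lemma IsSmoothWave.energyNorm_residual_le [FiniteDimensional ℝ E]
    (hu : IsSmoothWave M K V T f u) (hM : IsPSDForm M) (hK : IsPSDForm K)
    (hP : IsRitzProjection M K V S P η) {SK : ℝ} (hSK : ∀ t ∈ Icc 0 T, energyNorm K (u 2 t) ≤ SK)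
    (hτ : 0 < τ) {t : ℝ} (h0 : 0 ≤ t - τ) (hT : t + τ ≤ T) :
    energyNorm M (ritzResidual P τ f u t) ≤
      τ / 4 * (∫ r in (t - τ)..(t + τ), energyNorm M (f 2 r)) +
      5 * τ / 4 * (∫ r in (t - τ)..(t + τ), energyNorm M (u 4 r)) + 2 * η * SK := by
  have hV : ∀ r ∈ Icc (t - τ) (t + τ), u 0 r ∈ V := fun r hr =>
    hu.mem 0 (by omega) r ⟨h0.trans hr.1, hr.2.trans hT⟩
  have h1 := hu.chain_f.energyNorm_second_diff_le hM (k := 0) le_rfl hτ.le h0 hT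
  have h2 := hu.chain_u.energyNorm_second_diff_le hM (k := 2) le_rfl hτ.le h0 hT
  have h3 := hu.chain_u.energyNorm_consistency_le hM hτ.le h0 hT
  have h4 := hu.chain_u.energyNorm_second_diff_le hK (k := 0) (by norm_num) hτ.le h0 hT
  have h5 : ∫ r in (t - τ)..(t + τ), energyNorm K (u (0 + 2) r) ≤ 2 * τ * SK := by
    have hsub : Icc (t - τ) (t + τ) ⊆ Icc 0 T := Icc_subset_Icc h0 hT
    have := intervalIntegral.integral_mono_on (by linarith : t - τ ≤ t + τ)
      (((hu.chain_u.continuousOn (k := 2) (by norm_num)).energyNorm K |>.mono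
        hsub).intervalIntegrable_of_Icc (by linarith))
      (intervalIntegrable_const (μ := MeasureTheory.volume) (c := SK)) fun r hr => hSK r (hsub hr)
    rw [intervalIntegral.integral_const, smul_eq_mul] at this
    refine this.trans (le_of_eq ?_)
    ring
  have h6 := hP.error_left _ (V.sub_mem (V.add_mem (hV (t + τ) ⟨by linarith, le_rfl⟩)
    (hV (t - τ) ⟨le_rfl, by linarith⟩)) (V.smul_mem (2 : ℝ) (hV t ⟨by linarith, by linarith⟩)))
  set a := f 0 (t + τ) + f 0 (t - τ) - (2 : ℝ) • f 0 t
  set b := u 2 (t + τ) + u 2 (t - τ) - (2 : ℝ) • u 2 t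
  set x := u 0 (t + τ) + u 0 (t - τ) - (2 : ℝ) • u 0 t
  have hτ2 : 0 < τ ^ 2 := by positivity
  have t1 : energyNorm M (-((1 / 4 : ℝ) • a)) ≤
      τ / 4 * ∫ r in (t - τ)..(t + τ), energyNorm M (f 2 r) := by
    rw [IsPSDForm.energyNorm_neg, IsPSDForm.energyNorm_smul, abs_of_pos (by norm_num)]
    linarith
  have t2 : energyNorm M ((1 / 4 : ℝ) • b) ≤
      τ / 4 * ∫ r in (t - τ)..(t + τ), energyNorm M (u 4 r) := by
    rw [IsPSDForm.energyNorm_smul, abs_of_pos (by norm_num)]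
    linarith
  have t3 : energyNorm M ((τ ^ 2)⁻¹ • (x - τ ^ 2 • u 2 t)) ≤
      τ * ∫ r in (t - τ)..(t + τ), energyNorm M (u 4 r) := by
    rw [IsPSDForm.energyNorm_smul, abs_of_pos (by positivity), inv_mul_le_iff₀ hτ2]
    refine h3.trans (le_of_eq ?_)
    ring
  have t4 : energyNorm M ((τ ^ 2)⁻¹ • (x - P x)) ≤ 2 * η * SK := by
    rw [IsPSDForm.energyNorm_smul, abs_of_pos (by positivity), inv_mul_le_iff₀ hτ2]
    refine h6.trans ((mul_le_mul_of_nonneg_left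
      (h4.trans (mul_le_mul_of_nonneg_left h5 hτ.le)) hP.nonneg).trans (le_of_eq ?_))
    ring
  have s1 := hM.energyNorm_add_le (-((1 / 4 : ℝ) • a)) ((1 / 4 : ℝ) • b)
  have s2 := hM.energyNorm_sub_le (-((1 / 4 : ℝ) • a) + (1 / 4 : ℝ) • b)
    ((τ ^ 2)⁻¹ • (x - τ ^ 2 • u 2 t))
  have s3 := hM.energyNorm_add_le
    (-((1 / 4 : ℝ) • a) + (1 / 4 : ℝ) • b - (τ ^ 2)⁻¹ • (x - τ ^ 2 • u 2 t))
    ((τ ^ 2)⁻¹ • (x - P x))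
  unfold ritzResidual
  linarith

/-- The error equation satisfied by `U j - P (u (j τ))`. -/
lemma IsSmoothWave.error_equation (hu : IsSmoothWave M K V T f u)
    (hP : IsRitzProjection M K V S P η) (hτ : 0 < τ) {U₀ U₁ U₂ v : E} (hv : v ∈ S) {t : ℝ}
    (h0 : 0 ≤ t - τ) (hT : t + τ ≤ T)
    (hU : M (τ⁻¹ • (τ⁻¹ • (U₂ - U₁) - τ⁻¹ • (U₁ - U₀))) v +
      K ((1 / 2 : ℝ) • ((1 / 2 : ℝ) • (U₂ + U₁) + (1 / 2 : ℝ) • (U₁ + U₀))) v = M (f 0 t) v) :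
    M (τ⁻¹ • (τ⁻¹ • ((U₂ - P (u 0 (t + τ))) - (U₁ - P (u 0 t))) -
        τ⁻¹ • ((U₁ - P (u 0 t)) - (U₀ - P (u 0 (t - τ)))))) v +
      K ((1 / 2 : ℝ) • ((1 / 2 : ℝ) • ((U₂ - P (u 0 (t + τ))) + (U₁ - P (u 0 t))) +
        (1 / 2 : ℝ) • ((U₁ - P (u 0 t)) + (U₀ - P (u 0 (t - τ)))))) v =
      M (ritzResidual P τ f u t) v := by
  -- P drops out of the K-terms by orthogonality, and the equation at the three times then turns
  -- every K(u,·) into an M-term, so that the residual can be written against M.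
  have e1 := hu.eqn t ⟨by linarith, by linarith⟩ v (hP.le hv)
  have e2 := hu.eqn (t + τ) ⟨by linarith, by linarith⟩ v (hP.le hv)
  have e3 := hu.eqn (t - τ) ⟨by linarith, by linarith⟩ v (hP.le hv)
  have p1 := hP.orthogonal (u 0 t) v hv
  have p2 := hP.orthogonal (u 0 (t + τ)) v hv
  have p3 := hP.orthogonal (u 0 (t - τ)) v hv
  unfold ritzResidual
  simp only [map_smul, map_add, map_sub, map_neg, LinearMap.smul_apply, LinearMap.add_apply,
    LinearMap.sub_apply, LinearMap.neg_apply, smul_eq_mul] at hU ⊢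
  rw [p1, p2, p3]
  have hτ' : τ ≠ 0 := hτ.ne'
  have k1 : K (u 0 t) v = M (f 0 t) v - M (u 2 t) v := by linarith
  have k2 : K (u 0 (t + τ)) v = M (f 0 (t + τ)) v - M (u 2 (t + τ)) v := by linarith
  have k3 : K (u 0 (t - τ)) v = M (f 0 (t - τ)) v - M (u 2 (t - τ)) v := by linarith
  have hinv : (τ ^ 2)⁻¹ = τ⁻¹ * τ⁻¹ := by rw [sq, mul_inv]
  have hc : τ⁻¹ * τ⁻¹ * (τ ^ 2 * M (u 2 t) v) = M (u 2 t) v := by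
    field_simp
  rw [k1, k2, k3, hinv]
  linear_combination hU - hc

/-- Error estimate for the fully discrete method, for a solution with bounded second derivative
in the energy norm. -/
theorem IsSmoothWave.discrete_error_le [FiniteDimensional ℝ E]
    (hu : IsSmoothWave M K V T f u) (hM : IsPSDForm M) (hK : IsPSDForm K)
    (hP : IsRitzProjection M K V S P η) {SK SB Sf Sw : ℝ}
    (hSK : ∀ t ∈ Icc 0 T, energyNorm K (u 2 t) ≤ SK)
    (hSB : ∀ t ∈ Icc 0 T, energyNorm K (u 2 t) ≤ SB)
    (hSf : ∀ t ∈ Icc 0 T, energyNorm M (f 0 t) ≤ Sf)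
    (hSw : ∀ t ∈ Icc 0 T, energyNorm M (u 2 t) ≤ Sw)
    (hτ : 0 < τ) {U : ℕ → E} {n : ℕ} (hn : (n + 1) * τ ≤ T) (hUS : ∀ j ≤ n + 1, U j ∈ S)
    (hU : ∀ j < n, ∀ v ∈ S, M (τ⁻¹ • (τ⁻¹ • (U (j + 2) - U (j + 1)) -
        τ⁻¹ • (U (j + 1) - U j))) v +
      K ((1 / 2 : ℝ) • ((1 / 2 : ℝ) • (U (j + 2) + U (j + 1)) +
        (1 / 2 : ℝ) • (U (j + 1) + U j))) v = M (f 0 ((j + 1) * τ)) v) :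
    energyNorm K ((1 / 2 : ℝ) • (U (n + 1) + U n) - u 0 ((n + 1 / 2) * τ)) ≤
      energyNorm M (τ⁻¹ • (U 1 - U 0) - P (τ⁻¹ • (u 0 τ - u 0 0))) +
      energyNorm K ((1 / 2 : ℝ) • (U 1 + U 0) - P (u 0 (τ / 2))) +
      η * (Sf + Sw) + 2 * η * T * SK +
      τ ^ 2 * ((1 / 2) * (∫ r in 0..T, energyNorm M (f 2 r)) +
        (5 / 2) * (∫ r in 0..T, energyNorm M (u 4 r)) + SB / 2) := by
  have nn := IsPSDForm.energyNorm_nonneg (E := E)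
  have hn0 : (0 : ℝ) ≤ n := Nat.cast_nonneg n
  have hη := hP.nonneg
  have hτT : τ ≤ T := by nlinarith
  have h0T : (0 : ℝ) ∈ Icc 0 T := ⟨le_rfl, by linarith⟩
  have hSK0 : 0 ≤ SK := (nn _ _).trans (hSK 0 h0T)
  have hjT : ∀ j : ℕ, j ≤ n + 1 → (j : ℝ) * τ ∈ Icc 0 T := fun j hj =>
    ⟨by positivity, (mul_le_mul_of_nonneg_right (by exact_mod_cast hj) hτ.le).trans hn⟩
  -- midpoint values
  have hmid : ∀ t, 0 ≤ t → t + τ ≤ T →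
      energyNorm K ((1 / 2 : ℝ) • (u 0 (t + τ) + u 0 t) - u 0 (t + τ / 2)) ≤ τ ^ 2 * (SB / 4) := by
    intro t ht htT
    have h1 := hu.chain_u.energyNorm_second_diff_le hK (k := 0) (by norm_num)
      (by linarith : 0 ≤ τ / 2) (t := t + τ / 2) (by linarith) (by linarith)
    have e1 : t + τ / 2 + τ / 2 = t + τ := by ring
    have e2 : t + τ / 2 - τ / 2 = t := by ring
    rw [e1, e2] at h1
    have hsub : Icc t (t + τ) ⊆ Icc 0 T := Icc_subset_Icc ht htT
    have h2 := intervalIntegral.integral_mono_on (by linarith : t ≤ t + τ)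
      (((hu.chain_u.continuousOn (k := 2) (by norm_num)).energyNorm K |>.mono
        hsub).intervalIntegrable_of_Icc (by linarith))
      (intervalIntegrable_const (μ := MeasureTheory.volume) (c := SB)) fun r hr => hSB r (hsub hr)
    rw [intervalIntegral.integral_const, smul_eq_mul] at h2
    have e3 : (1 / 2 : ℝ) • (u 0 (t + τ) + u 0 t) - u 0 (t + τ / 2) =
        (1 / 2 : ℝ) • (u 0 (t + τ) + u 0 t - (2 : ℝ) • u 0 (t + τ / 2)) := by
      rw [smul_sub, smul_smul]
      norm_num
    rw [e3, IsPSDForm.energyNorm_smul, abs_of_pos (by norm_num)]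
    nlinarith [mul_le_mul_of_nonneg_left h2 hτ.le]
  -- the Ritz projection error
  have hritz : ∀ t ∈ Icc 0 T, energyNorm K (u 0 t - P (u 0 t)) ≤ η * (Sf + Sw) := by
    intro t ht
    refine (hP.error_right _ (hu.mem 0 (by omega) t ht) (f 0 t - u 2 t) fun v hv => ?_).trans
      (mul_le_mul_of_nonneg_left ?_ hη)
    · rw [map_sub, LinearMap.sub_apply]
      linarith [hu.eqn t ht v hv]
    · exact (hM.energyNorm_sub_le _ _).trans (add_le_add (hSf t ht) (hSw t ht))
  -- stability
  let Θ : ℕ → E := fun j => U j - P (u 0 (j * τ))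
  let D : ℕ → E := fun j => τ⁻¹ • (Θ (j + 1) - Θ j)
  let A : ℕ → E := fun j => (1 / 2 : ℝ) • (Θ (j + 1) + Θ j)
  let r : ℕ → E := fun j => ritzResidual P τ f u ((j + 1) * τ)
  have hΘ : ∀ j ≤ n + 1, Θ j ∈ S := fun j hj => S.sub_mem (hUS j hj) (hP.mem _)
  have hDA : ∀ j, A (j + 1) - A j = (τ / 2) • (D (j + 1) + D j) := by
    intro j
    have : (τ / 2) • (D (j + 1) + D j) = (1 / 2 : ℝ) • (Θ (j + 1 + 1) - Θ j) := by
      simp only [D]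
      rw [← smul_add, smul_smul, div_mul_eq_mul_div, mul_inv_cancel₀ hτ.ne', sub_add_sub_cancel]
    rw [this]
    simp only [A]
    rw [← smul_sub, add_comm (Θ (j + 1)) (Θ j), add_sub_add_comm, add_comm]
    congr 1
    abel
  have hstab := discrete_energy_le hM hK (n := n) (r := r) hτ hDA fun j hj => by
    have hv : D (j + 1) + D j ∈ S := S.add_mem
      (S.smul_mem _ (S.sub_mem (hΘ _ (by omega)) (hΘ _ (by omega))))
      (S.smul_mem _ (S.sub_mem (hΘ _ (by omega)) (hΘ _ (by omega))))
    have hj2 := (hjT (j + 2) (by omega)).2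
    have hj0 := (hjT j (by omega)).1
    push_cast at hj2
    have h := hu.error_equation hP hτ hv (t := (j + 1) * τ) (by linarith) (by linarith)
      (hU j hj _ hv)
    have e1 : ((j : ℝ) + 1) * τ + τ = ((j + 1 + 1 : ℕ) : ℝ) * τ := by push_cast; ring
    have e2 : ((j : ℝ) + 1) * τ - τ = (j : ℝ) * τ := by ring
    have e3 : ((j : ℝ) + 1) * τ = ((j + 1 : ℕ) : ℝ) * τ := by push_cast; ring
    rw [e1, e2] at h
    simp only [r]
    rw [← h]
    simp only [A, D, Θ, e3]
  -- The two-step intervals cover every time at most twice, which doubles 1/4 and 5/4; the terms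
  -- constant in j add up over a time at most T.
  have hsum : τ * ∑ j ∈ Finset.range n, energyNorm M (r j) ≤
      2 * η * T * SK + τ ^ 2 * ((1 / 2) * (∫ r in 0..T, energyNorm M (f 2 r)) +
        (5 / 2) * (∫ r in 0..T, energyNorm M (u 4 r))) := by
    have h1 : ∑ j ∈ Finset.range n, energyNorm M (r j) ≤ ∑ j ∈ Finset.range n,
        (τ / 4 * (∫ r in (j * τ)..((j + 2) * τ), energyNorm M (f 2 r)) +
          5 * τ / 4 * (∫ r in (j * τ)..((j + 2) * τ), energyNorm M (u 4 r)) + 2 * η * SK) := by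
      refine Finset.sum_le_sum fun j hj => ?_
      have hj' := Finset.mem_range.1 hj
      have hj2 := (hjT (j + 2) (by omega)).2
      have hj0 := (hjT j (by omega)).1
      push_cast at hj2
      have h := hu.energyNorm_residual_le hM hK hP hSK hτ (t := (j + 1) * τ) (by linarith)
        (by linarith)
      have e1 : ((j : ℝ) + 1) * τ + τ = ((j : ℝ) + 2) * τ := by ring
      have e2 : ((j : ℝ) + 1) * τ - τ = (j : ℝ) * τ := by ring
      rwa [e1, e2] at h
    rw [Finset.sum_add_distrib, Finset.sum_add_distrib, ← Finset.mul_sum, ← Finset.mul_sum,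
      Finset.sum_const, Finset.card_range, nsmul_eq_mul] at h1
    have h2 := sum_integral_two_steps_le (hu.chain_f.cont.energyNorm M) (fun _ _ => nn _ _)
      hτ.le hn
    have h3 := sum_integral_two_steps_le (hu.chain_u.cont.energyNorm M) (fun _ _ => nn _ _)
      hτ.le hn
    have h4 : n * τ * (2 * η * SK) ≤ T * (2 * η * SK) :=
      mul_le_mul_of_nonneg_right (by linarith) (by positivity)
    have hτ2 : 0 ≤ τ ^ 2 := by positivity
    nlinarith [mul_le_mul_of_nonneg_left h1 hτ.le, mul_le_mul_of_nonneg_left h2 hτ2,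
      mul_le_mul_of_nonneg_left h3 hτ2]
  have hD0 : D 0 = τ⁻¹ • (U 1 - U 0) - P (τ⁻¹ • (u 0 τ - u 0 0)) := by
    simp only [D, Θ, map_smul, map_sub]
    rw [← smul_sub]
    congr 1
    norm_num
    abel
  -- The initial error is measured against P u(τ/2) rather than the projected mean of u(0) and u(τ).
  -- The difference is the projected midpoint defect, and P does not increase the K-norm.
  have hA0 : energyNorm K (A 0) ≤
      energyNorm K ((1 / 2 : ℝ) • (U 1 + U 0) - P (u 0 (τ / 2))) + τ ^ 2 * (SB / 4) := by
    have h1 := hmid 0 le_rfl (by linarith)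
    rw [zero_add, zero_add] at h1
    have h2 := hK.energyNorm_le_of_orthogonal
      (hP.mem ((1 / 2 : ℝ) • (u 0 τ + u 0 0) - u 0 (τ / 2))) (hP.orthogonal _)
    have e : A 0 = ((1 / 2 : ℝ) • (U 1 + U 0) - P (u 0 (τ / 2))) -
        P ((1 / 2 : ℝ) • (u 0 τ + u 0 0) - u 0 (τ / 2)) := by
      simp only [A, Θ, map_smul, map_sub, map_add]
      norm_num
      module
    rw [e]
    linarith [hK.energyNorm_sub_le ((1 / 2 : ℝ) • (U 1 + U 0) - P (u 0 (τ / 2)))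
      (P ((1 / 2 : ℝ) • (u 0 τ + u 0 0) - u 0 (τ / 2)))]
  -- the error splitting
  have hnT : (n : ℝ) * τ + τ ≤ T := by linarith
  have hm := hmid (n * τ) (hjT n (by omega)).1 hnT
  have r1 := hritz (n * τ) (hjT n (by omega))
  have r2 := hritz (n * τ + τ) ⟨by positivity, hnT⟩
  have en : ((n + 1 : ℕ) : ℝ) * τ = n * τ + τ := by push_cast; ring
  have en' : ((n : ℝ) + 1 / 2) * τ = n * τ + τ / 2 := by ring
  set x := u 0 (n * τ + τ)
  set y := u 0 (n * τ)
  have hsplit : (1 / 2 : ℝ) • (U (n + 1) + U n) - u 0 ((n + 1 / 2) * τ) =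
      A n - (1 / 2 : ℝ) • ((x - P x) + (y - P y)) +
        ((1 / 2 : ℝ) • (x + y) - u 0 (n * τ + τ / 2)) := by
    simp only [A, Θ, en, en']
    module
  have s1 := hK.energyNorm_add_le (A n - (1 / 2 : ℝ) • ((x - P x) + (y - P y)))
    ((1 / 2 : ℝ) • (x + y) - u 0 (n * τ + τ / 2))
  have s2 := hK.energyNorm_sub_le (A n) ((1 / 2 : ℝ) • ((x - P x) + (y - P y)))
  rw [IsPSDForm.energyNorm_smul K _ ((x - P x) + (y - P y)),
    abs_of_pos (by norm_num : (0 : ℝ) < 1 / 2)] at s2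
  have s3 := hK.energyNorm_add_le (x - P x) (y - P y)
  rw [hsplit]
  rw [hD0] at hstab
  linarith

end AbstractScheme

section Regularity

open Set

/-! ### Regularity in time of wave solutions -/

lemma contDiffOn_four_of_iteratedDerivWithin_two {E : Type*} [NormedAddCommGroup E]
    [NormedSpace ℝ E] {s : Set ℝ} (hs : UniqueDiffOn ℝ s) {u : ℝ → E} (hu : ContDiffOn ℝ 2 u s)
    (h2 : ContDiffOn ℝ 2 (iteratedDerivWithin 2 u s) s) : ContDiffOn ℝ 4 u s := by
  have d0 : DifferentiableOn ℝ u s := hu.differentiableOn (by norm_num)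
  have d1 : DifferentiableOn ℝ (derivWithin u s) s := by
    rw [← iteratedDerivWithin_one]
    exact hu.differentiableOn_iteratedDerivWithin (by norm_num) hs
  rw [show (2 : ℕ) = 1 + 1 from rfl, iteratedDerivWithin_succ, iteratedDerivWithin_one] at h2
  have h3 : ContDiffOn ℝ (2 + 1) (derivWithin u s) s :=
    (contDiffOn_succ_iff_derivWithin hs).2 ⟨d1, fun h => by simp at h, h2⟩
  have h4 : ContDiffOn ℝ (2 + 1 + 1) u s :=
    (contDiffOn_succ_iff_derivWithin hs).2 ⟨d0, fun h => by simp at h, h3⟩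
  norm_num at h4
  exact h4

lemma ContDiffOn.isDerivChain {E : Type*} [NormedAddCommGroup E] [NormedSpace ℝ E] {T : ℝ}
    (hT : 0 < T) {n : ℕ} {u : ℝ → E} (hu : ContDiffOn ℝ n u (Icc 0 T)) :
    IsDerivChain T n fun k => iteratedDerivWithin k u (Icc 0 T) where
  deriv k hk t ht := by
    have h := (hu.differentiableOn_iteratedDerivWithin (m := k) (by exact_mod_cast hk)
      (uniqueDiffOn_Icc hT) t ht).hasDerivWithinAt
    rw [iteratedDerivWithin_succ]
    exact h
  cont := hu.continuousOn_iteratedDerivWithin le_rfl (uniqueDiffOn_Icc hT)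

/-- A linear relation is inherited by the time derivative. -/
lemma IsDerivChain.eq_of_eq {E F : Type*} [NormedAddCommGroup E] [NormedSpace ℝ E]
    [FiniteDimensional ℝ E] [NormedAddCommGroup F] [NormedSpace ℝ F] [FiniteDimensional ℝ F]
    {T : ℝ} (hT : 0 < T) {n m : ℕ}
    {u : ℕ → ℝ → E} {f : ℕ → ℝ → F} (hu : IsDerivChain T n u) (hf : IsDerivChain T m f)
    {j k l : ℕ} (hj : j < n) (hk : k < n) (hl : l < m) {a b : E →ₗ[ℝ] ℝ} {c : F →ₗ[ℝ] ℝ}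
    (h : ∀ t ∈ Icc 0 T, a (u j t) + b (u k t) = c (f l t)) :
    ∀ t ∈ Icc 0 T, a (u (j + 1) t) + b (u (k + 1) t) = c (f (l + 1) t) := by
  intro t ht
  have h1 := ((hu.deriv j hj t ht).linearMap a).add ((hu.deriv k hk t ht).linearMap b)
  have h2 := (hf.deriv l hl t ht).linearMap c
  exact (uniqueDiffOn_Icc hT t ht).eq_deriv _ h1 (h2.congr h (h t ht))

namespace SpatialNetwork

variable {d : ℕ} {G : SpatialNetwork d} {Γ : Set (EuclideanSpace ℝ (Fin d))}
  {K : G.LocalOperator} {T : ℝ} {f u : ℝ → G.VHat}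

open scoped Classical in
lemma formM_single (v : G.VHat) (x : G.nodes) :
    G.formM (unitCube d) v (Pi.single x 1) = G.mass x * v x := by
  rw [formM_eq, sumOver_of_forall fun y : G.nodes => G.nodes_subset y y.2,
    Finset.sum_eq_single x]
  · simp
  · intro y _ hy
    simp [hy]
  · simp

lemma timeDeriv_zero (T : ℝ) (v : ℝ → G.VHat) : timeDeriv T 0 v = v :=
  iteratedDerivWithin_zero

lemma timeDeriv_mem_V (hT : 0 < T) {n : ℕ} (hu : ContDiffOn ℝ n u (Icc 0 T))
    (hV : ∀ t ∈ Icc 0 T, u t ∈ G.V Γ) :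
    ∀ k ≤ n, ∀ t ∈ Icc 0 T, timeDeriv T k u t ∈ G.V Γ := by
  have hc := hu.isDerivChain hT
  intro k
  induction k with
  | zero =>
    intro _ t ht
    simpa [timeDeriv] using hV t ht
  | succ k ih =>
    intro hk t ht x hx
    have h := hc.eq_of_eq hT hc (j := k) (k := k) (l := k) hk hk hk
      (a := LinearMap.proj x) (b := 0) (c := 0) (fun t ht => by
        simpa [timeDeriv] using ih (by omega) t ht x hx) t ht
    simpa [timeDeriv] using h

/-- M is diagonal with positive masses. Testing with the indicator of a node x off Γ gives D_t²u(x)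
as f(x) minus a multiple of (Ku)(x), which is C² in time; at nodes on Γ it is zero. So two time
derivatives are gained. -/
theorem LocalOperator.IsWaveSolution.contDiffOn_four (hT : 0 < T)
    (hmass : ∀ x : G.nodes, 0 < G.mass x) (hf : ContDiffOn ℝ 2 f (Icc 0 T))
    (hu : K.IsWaveSolution Γ T f u) : ContDiffOn ℝ 4 u (Icc 0 T) := by
  classical
  refine contDiffOn_four_of_iteratedDerivWithin_two (uniqueDiffOn_Icc hT) hu.contDiff ?_
  refine contDiffOn_pi.2 fun x => ?_
  by_cases hx : (x : EuclideanSpace ℝ (Fin d)) ∈ Γ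
  · refine (contDiffOn_const (c := (0 : ℝ))).congr fun t ht => ?_
    exact timeDeriv_mem_V hT (n := 2) (by exact_mod_cast hu.contDiff) hu.mem 2 le_rfl t ht x hx
  · have hl : ContDiffOn ℝ 2 (fun t => f t x -
        (G.mass x)⁻¹ * LinearMap.toContinuousLinearMap (K.bilin.flip (Pi.single x 1)) (u t))
        (Icc 0 T) :=
      (contDiffOn_pi.1 hf x).sub (contDiffOn_const.mul
        ((ContinuousLinearMap.contDiff _).comp_contDiffOn hu.contDiff))
    refine hl.congr fun t ht => ?_
    have hv : (Pi.single x 1 : G.VHat) ∈ G.V Γ := by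
      intro y hy
      have : y ≠ x := fun h => hx (h ▸ hy)
      simp [this]
    have h := hu.eqn t ht _ hv
    rw [formM_single, formM_single] at h
    change timeDeriv T 2 u t x = f t x - (G.mass x)⁻¹ * K.form (u t) (Pi.single x 1)
    have hm := (hmass x).ne'
    field_simp
    linarith

/-- A solution of the wave equation with `C²` data satisfies the equation twice differentiated
in time. -/
theorem LocalOperator.IsWaveSolution.isSmoothWave (hT : 0 < T)
    (hmass : ∀ x : G.nodes, 0 < G.mass x) (hf : ContDiffOn ℝ 2 f (Icc 0 T))
    (hu : K.IsWaveSolution Γ T f u) :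
    IsSmoothWave (G.bilinM (unitCube d)) K.bilin (G.V Γ) T (fun k => timeDeriv T k f)
      (fun k => timeDeriv T k u) := by
  have hu4 := hu.contDiffOn_four hT hmass hf
  have hcu := ContDiffOn.isDerivChain (n := 4) hT (by exact_mod_cast hu4)
  have hcf := ContDiffOn.isDerivChain (n := 2) hT (by exact_mod_cast hf)
  have heq : ∀ v ∈ G.V Γ, ∀ t ∈ Icc 0 T,
      (G.bilinM (unitCube d)).flip v (iteratedDerivWithin 2 u (Icc 0 T) t) +
        K.bilin.flip v (iteratedDerivWithin 0 u (Icc 0 T) t) =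
      (G.bilinM (unitCube d)).flip v (iteratedDerivWithin 0 f (Icc 0 T) t) := by
    intro v hv t ht
    rw [iteratedDerivWithin_zero, iteratedDerivWithin_zero]
    exact hu.eqn t ht v hv
  refine ⟨hcu, hcf, fun k hk => timeDeriv_mem_V hT (n := 4) (by exact_mod_cast hu4) hu.mem k
    (by omega), fun t ht v hv => heq v hv t ht, fun t ht v hv => ?_⟩
  have h1 := hcu.eq_of_eq hT hcf (by norm_num) (by norm_num) (by norm_num) (heq v hv)
  exact hcu.eq_of_eq hT hcf (by norm_num) (by norm_num) (by norm_num) h1 t ht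

lemma le_supNorm {nrm : G.VHat → ℝ} {v : ℝ → G.VHat}
    (hc : ContinuousOn (fun t => nrm (v t)) (Icc 0 T)) {t : ℝ} (ht : t ∈ Icc 0 T) :
    nrm (v t) ≤ supNorm nrm T v :=
  le_csSup (isCompact_Icc.bddAbove_image hc) (mem_image_of_mem _ ht)

end SpatialNetwork

end Regularity

namespace SpatialNetwork

variable {d : ℕ} {σ ν α β : ℝ}

/-! ### The error estimate -/

/-- The constants c₀ and C are fixed before any network is given, so positivity must follow from σ ≥
0 alone and not from an admissible network. -/
lemma stepConst_pos_of_nonneg (hσ : 0 ≤ σ) (hα : 0 < α) (hαβ : α ≤ β) :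
    0 < stepConst d σ ν α β := by
  have h1 : 0 ≤ interpConst d σ ν := by
    unfold interpConst
    positivity
  have h2 : 0 < β := hα.trans_le hαβ
  unfold stepConst cutConst
  positivity

lemma decayRate_pos (hσ : 0 ≤ σ) (hα : 0 < α) (hαβ : α ≤ β) : 0 < decayRate d σ ν α β := by
  have := stepConst_pos_of_nonneg (d := d) (ν := ν) hσ hα hαβ
  unfold decayRate
  positivity

lemma decayRate_lt_one (hσ : 0 ≤ σ) (hα : 0 < α) (hαβ : α ≤ β) : decayRate d σ ν α β < 1 := by
  have := stepConst_pos_of_nonneg (d := d) (ν := ν) hσ hα hαβ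
  unfold decayRate
  rw [div_lt_one (by linarith)]
  linarith

/-- Logarithmically many layers make the localization error of the order of the mesh size. -/
lemma sqrt_decay_le {γ : ℝ} (h0 : 0 < γ) (h1 : γ < 1) {i k : ℕ}
    (hk : 40 * (d + 2) / Real.log γ⁻¹ * Real.log (1 / meshSize i) ≤ k) :
    √(γ ^ ((k - 12) / 40) * ((2 : ℝ) ^ i) ^ d) ≤ γ⁻¹ * meshSize i := by
  have hH := meshSize_pos i
  have hℓ : 0 < Real.log γ⁻¹ := Real.log_pos ((one_lt_inv₀ h0).2 h1)
  rw [meshSize, one_div, inv_inv, div_mul_eq_mul_div, div_le_iff₀ hℓ] at hk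
  set n := (k - 12) / 40 with hn
  -- Rounding in (k - 12)/40 loses at most 51 layers, hence fewer than two blocks of 40. These two
  -- spare powers of γ become the factor γ⁻¹ under the square root.
  have hkn : (k : ℝ) ≤ 40 * (n + 2) := by
    have : k ≤ 40 * (n + 2) := by omega
    exact_mod_cast this
  have h2 : (0 : ℝ) < 2 ^ i := by positivity
  -- d powers of 1/H absorb the number of elements; the two extra ones leave a factor H after the
  -- square root.
  have key : γ ^ (n + 2) * ((2 : ℝ) ^ i) ^ (d + 2) ≤ 1 := by
    rw [← Real.log_nonpos_iff (by positivity), Real.log_mul (by positivity) (by positivity),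
      Real.log_pow, Real.log_pow]
    have e : Real.log γ = -Real.log γ⁻¹ := by rw [Real.log_inv, neg_neg]
    rw [e]
    push_cast
    nlinarith [mul_le_mul_of_nonneg_right hkn hℓ.le]
  refine Real.sqrt_le_iff.2 ⟨by positivity, ?_⟩
  rw [meshSize, ← mul_inv, inv_pow, le_inv_comm₀ (by positivity) (by positivity),
    ← one_div, le_div_iff₀ (by positivity)]
  refine le_trans (le_of_eq ?_) key
  ring

variable {G : SpatialNetwork d} {Γ : Set (EuclideanSpace ℝ (Fin d))} {R₀ ρ : ℝ} {i k : ℕ}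
  {K : G.LocalOperator} {T : ℝ}

namespace IsAdmissible

lemma isRitzProjection (h : G.IsAdmissible Γ R₀ ρ σ ν i) (hα : 0 < α) (hαβ : α ≤ β)
    (hK : K.IsBoundedCoercive Γ α β) {s : ℝ} (hs : 0 ≤ s)
    (hk : √(decayRate d σ ν α β ^ ((k - 12) / 40) * ((2 : ℝ) ^ i) ^ d) ≤ s * meshSize i) :
    IsRitzProjection (G.bilinM (unitCube d)) K.bilin (G.V Γ) (h.msSub hα hK k)
      (h.ritzLin hα hK k) (ritzConst d σ ν α β s * meshSize i) where
  le := h.msSub_le_V hα hK k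
  mem x := (h.ritz_spec hα hK k x).1
  orthogonal x := (h.ritz_spec hα hK k x).2
  nonneg := mul_nonneg (h.ritzConst_nonneg hs) (meshSize_pos i).le
  error_left _ hv := h.normM_sub_ritz_le hα hαβ hK hs hk hv
  error_right _ hz _ hg := h.norm_sub_ritz_le hα hαβ hK hs hk hz hg

/-- The error estimate with explicit constants. -/
theorem error_le (h : G.IsAdmissible Γ R₀ ρ σ ν i) (hα : 0 < α) (hαβ : α ≤ β)
    (hK : K.IsBoundedCoercive Γ α β) {s : ℝ} (hs : 0 ≤ s)
    (hk : √(decayRate d σ ν α β ^ ((k - 12) / 40) * ((2 : ℝ) ^ i) ^ d) ≤ s * meshSize i)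
    {T₀ τ : ℝ} {N : ℕ} {f u : ℝ → G.VHat} {U : ℕ → G.VHat} (hT₀ : 0 < T₀) (hT : T₀ ≤ T)
    (hN : 1 ≤ N) (hτ : τ = T / N) (hf : ContDiffOn ℝ 2 f (Set.Icc 0 T))
    (hu : K.IsWaveSolution Γ T f u) (hU : K.IsMultiscaleSolution Γ i k N τ f U)
    {n : ℕ} (hn : n + 1 ≤ N) :
    K.norm (halfStep U n - u ((n + 1 / 2) * τ)) ≤
      G.normM (fwdDiff τ U 0 - K.ritz Γ i k (τ⁻¹ • (u τ - u 0))) +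
      K.norm (halfStep U 0 - K.ritz Γ i k (u (τ / 2))) +
      ritzConst d σ ν α β s * meshSize i *
        (supNorm G.normM T f + supNorm G.normM T (timeDeriv T 2 u)) +
      2 * (ritzConst d σ ν α β s * meshSize i) * T * supNorm K.norm T (timeDeriv T 2 u) +
      τ ^ 2 * ((1 / 2) * oneNorm G.normM T (timeDeriv T 2 f) +
        (5 / 2) * oneNorm G.normM T (timeDeriv T 4 u) +
        waveConst (ν / √α) T₀ * (oneNorm G.normM T (timeDeriv T 4 u) +
          oneNorm G.normM T (timeDeriv T 2 f)) / 2) := by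
  have hT0 : 0 < T := hT₀.trans_le hT
  have hN0 : (0 : ℝ) < N := by exact_mod_cast hN
  have hτ0 : 0 < τ := hτ ▸ div_pos hT0 hN0
  have hsm := hu.isSmoothWave hT0 h.mass_pos hf
  have hM := G.isPSDForm_bilinM (unitCube d)
  have hKB := K.isPSDForm_bilin
  have hnT : ((n : ℝ) + 1) * τ ≤ T := by
    rw [hτ, mul_div_assoc', div_le_iff₀ hN0, mul_comm]
    exact mul_le_mul_of_nonneg_left (by exact_mod_cast hn) hT0.le
  have hu2c := hsm.chain_u.continuousOn (k := 2) (by norm_num)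
  -- The norm of D_t²u in K is bounded twice. Where it is multiplied by H its maximum is used; where
  -- it comes with τ² from the midpoint defects it is bounded by L¹ norms, applying the wave
  -- estimate to w = D_t²u with data D_t²f.
  have hwave : ∀ t ∈ Set.Icc 0 T, energyNorm K.bilin (timeDeriv T 2 u t) ≤
      waveConst (ν / √α) T₀ * (oneNorm G.normM T (timeDeriv T 4 u) +
          oneNorm G.normM T (timeDeriv T 2 f)) := fun t ht =>
    energyNorm_wave_le (w := fun k => timeDeriv T (k + 2) u) hM hKB
      (div_nonneg h.nonneg (Real.sqrt_nonneg α)) (fun v hv => h.normM_le hα hK hv) hT₀ hT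
      ⟨fun k hk t ht => hsm.chain_u.deriv (k + 2) (by omega) t ht, hsm.chain_u.cont⟩
      (fun k hk t ht => hsm.mem (k + 2) (by omega) t ht) hsm.chain_f.cont hsm.eqn_two ht
  have key := hsm.discrete_error_le hM hKB (h.isRitzProjection hα hαβ hK hs hk)
    (SK := supNorm K.norm T (timeDeriv T 2 u)) (Sf := supNorm G.normM T f)
    (Sw := supNorm G.normM T (timeDeriv T 2 u))
    (fun t ht => le_supNorm (nrm := K.norm) (hu2c.energyNorm K.bilin) ht) hwave
    (fun t ht => by
      rw [timeDeriv_zero]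
      exact le_supNorm (nrm := G.normM) (hf.continuousOn.energyNorm (G.bilinM (unitCube d))) ht)
    (fun t ht => le_supNorm (nrm := G.normM) (hu2c.energyNorm (G.bilinM (unitCube d))) ht)
    hτ0 (U := U) hnT
    (fun j hj => by
      have := hU.mem j (by omega)
      rwa [← h.coe_msSub hα hK k] at this)
    (fun j hj v hv => by
      have hv' : v ∈ K.msSpace Γ i k := by
        rw [← h.coe_msSub hα hK k]
        exact hv
      have := hU.eqn (j + 1) (by omega) (by omega) v hv'
      rw [Nat.cast_add, Nat.cast_one] at this
      rw [timeDeriv_zero]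
      exact this)
  simp only [timeDeriv_zero] at key
  exact key

end IsAdmissible

end SpatialNetwork

/-! ### Choice of the constants and conclusion. -/

open SpatialNetwork in
theorem theorem1 (d : ℕ) (hd : 1 ≤ d) (σ μ α β : ℝ) (hα : 0 < α) (hαβ : α ≤ β) :
    ∃ c₀ : ℝ, 0 < c₀ ∧ ∀ T₀ : ℝ, 0 < T₀ → ∃ C : ℝ, 0 < C ∧
      ∀ (G : SpatialNetwork d) (Γ : Set (EuclideanSpace ℝ (Fin d))) (R₀ ρ : ℝ)
        (K : G.LocalOperator) (i k : ℕ),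
        Γ.Nonempty → IsUnionOfBoundaryFaces i Γ →
        G.NetworkProperties Γ R₀ ρ σ → G.poincareConst Γ R₀ ≤ μ →
        K.IsBoundedCoercive Γ α β →
        8 * d * R₀ ≤ meshSize i →
        1 ≤ k → c₀ * Real.log (1 / meshSize i) ≤ k →
        ∀ (T τ : ℝ) (N : ℕ) (f u : ℝ → G.VHat) (U : ℕ → G.VHat),
          T₀ ≤ T → 1 ≤ N → τ = T / N →
          ContDiffOn ℝ 2 f (Set.Icc 0 T) →
          K.IsWaveSolution Γ T f u →
          K.IsMultiscaleSolution Γ i k N τ f U →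
          ∀ n : ℕ, 1 ≤ n → n + 1 ≤ N →
            K.norm (halfStep U n - u ((n + 1 / 2) * τ)) ≤
              C * (meshSize i *
                    (supNorm G.normM T f + supNorm G.normM T (timeDeriv T 2 u)
                      + supNorm K.norm T u + T * supNorm K.norm T (timeDeriv T 2 u))
                  + τ ^ 2 *
                    (oneNorm G.normM T (timeDeriv T 4 u) + oneNorm G.normM T (timeDeriv T 2 f)
                      + meshSize i * oneNorm K.norm T (timeDeriv T 2 u))
                  + G.normM (fwdDiff τ U 0 - K.ritz Γ i k (τ⁻¹ • (u τ - u 0)))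
                  + K.norm (halfStep U 0 - K.ritz Γ i k (u (τ / 2)))) := by
  have hadm : ∀ (G : SpatialNetwork d) (Γ : Set (EuclideanSpace ℝ (Fin d))) (R₀ ρ : ℝ) (i : ℕ),
      Γ.Nonempty → IsUnionOfBoundaryFaces i Γ → G.NetworkProperties Γ R₀ ρ σ →
      G.poincareConst Γ R₀ ≤ μ → 8 * d * R₀ ≤ meshSize i →
      G.IsAdmissible Γ R₀ ρ σ (|μ| + 1) i := by
    intro G Γ R₀ ρ i hΓ hfaces hprops hμ hmesh
    have hR₀ : R₀ ≤ 1 / 2 := by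
      have h1 := hprops.R₀_pos
      have h2 := meshSize_le_one i
      have h3 : (1 : ℝ) ≤ d := by exact_mod_cast hd
      nlinarith
    exact ⟨hd, hprops, hprops.isPoincareBound hR₀ hΓ hμ, by positivity, hfaces, hmesh⟩
  -- For σ < 1 no admissible network exists, since the two homogeneity bounds force σ ≥ 1, so any
  -- constants will do.
  rcases lt_or_ge σ 1 with hσ | hσ
  · refine ⟨1, one_pos, fun _ _ => ⟨1, one_pos, ?_⟩⟩
    intro G Γ R₀ ρ K i k hΓ hfaces hprops hμ hK hmesh
    exact absurd (hadm G Γ R₀ ρ i hΓ hfaces hprops hμ hmesh).one_le_σ (not_le.2 hσ)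
  have hσ0 : 0 ≤ σ := zero_le_one.trans hσ
  set γ := decayRate d σ (|μ| + 1) α β with hγ
  have hγ0 : 0 < γ := decayRate_pos hσ0 hα hαβ
  have hγ1 : γ < 1 := decayRate_lt_one hσ0 hα hαβ
  have hℓ : 0 < Real.log γ⁻¹ := Real.log_pos ((one_lt_inv₀ hγ0).2 hγ1)
  refine ⟨40 * (d + 2) / Real.log γ⁻¹, by positivity, fun T₀ hT₀ => ?_⟩
  set c := ritzConst d σ (|μ| + 1) α β γ⁻¹ with hc
  have hc0 : 0 ≤ c := by
    rw [hc, ritzConst]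
    positivity
  set w := waveConst ((|μ| + 1) / √α) T₀ with hw
  have hw0 : 0 ≤ w := waveConst_nonneg (by positivity) hT₀
  -- The terms with H need at most 2c, those with τ² at most 5/2 + w/2, and the initial errors 1.
  refine ⟨3 + 2 * c + w, by positivity, ?_⟩
  intro G Γ R₀ ρ K i k hΓ hfaces hprops hμ hK hmesh _ hk T τ N f u U hT hN hτ hf hu hU n _ hn
  have h := hadm G Γ R₀ ρ i hΓ hfaces hprops hμ hmesh
  refine (h.error_le hα hαβ hK (inv_nonneg.2 hγ0.le) (sqrt_decay_le hγ0 hγ1 hk) hT₀ hT hN hτ hf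
    hu hU hn).trans ?_
  rw [← hc, ← hw]
  have hT0 : 0 < T := hT₀.trans_le hT
  have hH := meshSize_pos i
  have hsup : ∀ (nrm : G.VHat → ℝ) (v : ℝ → G.VHat), (∀ x, 0 ≤ nrm x) → 0 ≤ supNorm nrm T v :=
    fun nrm v h0 => Real.sSup_nonneg (by rintro _ ⟨t, _, rfl⟩; exact h0 _)
  have hone : ∀ (nrm : G.VHat → ℝ) (v : ℝ → G.VHat), (∀ x, 0 ≤ nrm x) → 0 ≤ oneNorm nrm T v :=
    fun nrm v h0 => intervalIntegral.integral_nonneg hT0.le fun _ _ => h0 _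
  have hnM : ∀ x, 0 ≤ G.normM x := fun x => Real.sqrt_nonneg _
  have hnK : ∀ x, 0 ≤ K.norm x := fun x => Real.sqrt_nonneg _
  have a1 := hsup _ f hnM
  have a2 := hsup _ (timeDeriv T 2 u) hnM
  have a3 := hsup _ u hnK
  have a4 := hsup _ (timeDeriv T 2 u) hnK
  have a5 := hone _ (timeDeriv T 4 u) hnM
  have a6 := hone _ (timeDeriv T 2 f) hnM
  have a7 := hone _ (timeDeriv T 2 u) hnK
  have a8 := hnM (fwdDiff τ U 0 - K.ritz Γ i k (τ⁻¹ • (u τ - u 0)))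
  have a9 := hnK (halfStep U 0 - K.ritz Γ i k (u (τ / 2)))
  generalize supNorm G.normM T f = s1 at *
  generalize supNorm G.normM T (timeDeriv T 2 u) = s2 at *
  generalize supNorm K.norm T u = s3 at *
  generalize supNorm K.norm T (timeDeriv T 2 u) = s4 at *
  generalize oneNorm G.normM T (timeDeriv T 4 u) = s5 at *
  generalize oneNorm G.normM T (timeDeriv T 2 f) = s6 at *
  generalize oneNorm K.norm T (timeDeriv T 2 u) = s7 at *
  generalize G.normM (fwdDiff τ U 0 - K.ritz Γ i k (τ⁻¹ • (u τ - u 0))) = s8 at *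
  generalize K.norm (halfStep U 0 - K.ritz Γ i k (u (τ / 2))) = s9 at *
  generalize meshSize i = H at *
  have b1 : c * H * (s1 + s2) + 2 * (c * H) * T * s4 ≤
      (3 + 2 * c + w) * (H * (s1 + s2 + s3 + T * s4)) := by
    have e : (3 + 2 * c + w) * (H * (s1 + s2 + s3 + T * s4)) -
        (c * H * (s1 + s2) + 2 * (c * H) * T * s4) =
        (3 + c + w) * (H * (s1 + s2)) + (3 + 2 * c + w) * (H * s3) +
          (3 + w) * (H * (T * s4)) := by ring
    have : 0 ≤ (3 + c + w) * (H * (s1 + s2)) + (3 + 2 * c + w) * (H * s3) +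
          (3 + w) * (H * (T * s4)) := by positivity
    linarith
  have b2 : τ ^ 2 * (1 / 2 * s6 + 5 / 2 * s5 + w * (s5 + s6) / 2) ≤
      (3 + 2 * c + w) * (τ ^ 2 * (s5 + s6 + H * s7)) := by
    have e : (3 + 2 * c + w) * (τ ^ 2 * (s5 + s6 + H * s7)) -
        τ ^ 2 * (1 / 2 * s6 + 5 / 2 * s5 + w * (s5 + s6) / 2) =
        τ ^ 2 * (5 / 2 * s6 + 1 / 2 * s5 + (2 * c + w / 2) * (s5 + s6) +
          (3 + 2 * c + w) * (H * s7)) := by ring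
    have : 0 ≤ τ ^ 2 * (5 / 2 * s6 + 1 / 2 * s5 + (2 * c + w / 2) * (s5 + s6) +
          (3 + 2 * c + w) * (H * s7)) := by positivity
    linarith
  have b3 : s8 + s9 ≤ (3 + 2 * c + w) * (s8 + s9) :=
    le_mul_of_one_le_left (by positivity) (by linarith)
  linarith
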